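/- \textbf{Setting.} Let $N\to\infty$ and $T\to\infty$ (along a sequence) with $\log T\sim N^{\zeta}$ for some $0<\zeta\le 1$. The observations $X^n_t$ ($1\le n\le N$, $1\le t\le T$) are independent with $X^n_t\sim\mathrm{Poisson}(\mu^n_t)$. Let $\tau_1<\dots<\tau_J$ be the change-points, i.e. the $1\le t<T$ with $\mu^n_t\ne\mu^n_{t+1}$ for some $n$, and put $\tau_0=0$, $\tau_{J+1}=T$. Fix $\mu_0>0$ and $\Delta>0$, and let $$\Lambda=\{\mu:\mu^n_t\ge\mu_0\ \forall n,t\},\qquad \Lambda_0=\{\mu\in\Lambda:J=0\},$$ $$\Lambda_1(\Delta,V,h)=\Big\{\mu\in\Lambda:\ \exists\,1\le j\le J,\ \min(\tau_{j+1}-\tau_j,\tau_j-\tau_{j-1})\ge h,\ \#\{n:|\log(\mu^n_{\tau_j+1}/\mu^n_{\tau_j})|\ge\Delta\}\ge V\Big\}.$$ \textbf{The p-values.} For $0\le s<t<u\le T$ let $Y^n_{st}=\sum_{v=s+1}^{t}X^n_v$, and, given $Y^n_{su}=y$, let $B\sim\mathrm{Bin}(y,\frac{t-s}{u-s})$. With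 $W=P(B<Y^n_{st})+\xi^n_{stu}\,P(B=Y^n_{st})$ set $p^n_{stu}=2\min(W,1-W)$. Here the randomizers $\xi$ are independent of the observations and, for each $(s,t,u)$, the variables $\xi^1_{stu},\dots,\xi^N_{stu}$ are i.i.d. $\mathrm{Uniform}(0,1)$ (the joint law over different windows is arbitrary), so that $p^n_{stu}\sim\mathrm{Uniform}(0,1)$ if there is no change-point in $(s,u)$. \textbf{The algorithm.} Let $f_1(p)=\frac{1}{p(2-\log p)^2}-\frac12$, $f_2(p)=\frac{1}{\sqrt p}-2$, $$\ell(p)=\log\Big(1+\tfrac{\lambda_1\log N}{N}f_1(p)+\tfrac{\lambda_2}{\sqrt{N\log N}}f_2(p)\Big),\qquad p\ell_{stu}=\sum_{n=1}^N\ell(p^n_{stu})-\log\Big(\tfrac T4\big(\tfrac1{t-s}+\tfrac1{u-t}\big)\Big).$$ Let $1\le h_1<h_2<\cdots$ and $1\le d_1<d_2<\cdots$ be integers with $h_i\ge d_i$. For $g\ge 1$ let $i_g=\max\{i:h_i+d_i\le g\}$, $K_i(g)=\lfloor\frac{g-1}{d_i}\rfloor$, $s(ik)=\max(0,kd_i-h_i)$,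 $t(ik)=kd_i$, $u(ik)=\min(kd_i+h_i,g)$. Applied to the segment $b\le t\le e$ of length $g=e-b+1$ from scale $i_0$, the procedure SL-estimate (with positions counted inside the segment) takes the first $i\in\{i_0,\dots,i_g\}$ for which $\max_{1\le k\le K_i(g)}p\ell_{s(ik)t(ik)u(ik)}\ge c_T$, lets $j$ be a maximizing $k$, and outputs $\hat\tau=b-1+\operatorname{argmax}_{s(ij)<t<u(ij)}p\ell_{s(ij)\,t\,u(ij)}$ together with $i$; if there is no such $i$ it reports no change-point. The sparsity likelihood algorithm starts SL-estimate from scale $1$ on $\{1,\dots,T\}$ and, whenever $(\hat\tau,i)$ is reported, adds $\hat\tau$ to the estimated change-point set and continues from scale $i$ on the two segments $(b,\hat\tau)$ and $(\hat\tau,e)$. A Type I error occurs when $\mu\in\Lambda_0$ and the estimated change-point set is non-empty; a Type II error occurs when $\mu\in\Lambda_1(\Delta,V,h)$ and it is empty. \textbf{Parameters.} Assume $h_{i+1}/h_i\to1$ and $d_i=o(h_i)$ as $i\to\infty$; $\log\big(\sum_{i=1}^{i_T}\frac{h_i}{d_i}\big)=o(\log T)$, $c_T=o(\log T)$ and $c_T-\log\big(\sum_{i=1}^{i_T}\frac{h_i}{d_i}\big)\to\infty$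 as $T\to\infty$; $\lambda_1>0$ is fixed and $\lambda_2=\sqrt{\log T/\log\log T}$. \textbf{Constants.} For $r>1$ let $I_r=r\log\frac{2r}{r+1}+\log\frac{2}{r+1}$, $g_r(\omega)=\big(\frac{1+r^\omega}{2}\big)^{1/\omega}$ and $$\rho_r(\beta,\zeta)=\max_{\frac{1-\zeta}{\beta}<\omega\le2}\frac{\beta-\omega^{-1}(1-\zeta)}{2g_r(\omega)-1-r}\qquad\text{for }\tfrac{1-\zeta}2<\beta<1-\zeta.$$ \textbf{Theorem.} Let $1<r<e^{\Delta}$ be fixed. Then $$\sup_{\mu\in\Lambda_0}P_\mu(\text{Type I error})+\sup_{\mu\in\Lambda_1(\Delta,V,h)}P_\mu(\text{Type II error})\to0$$ (with $V$ a natural number and $h$ a real number, both depending on the position in the sequence) under either of the following conditions: (a) $V=o\big(\frac{N^\zeta}{\log N}\big)$ and $h\,V\,I_r\,\mu_0=(1+\epsilon)\log T$ for some fixed $\epsilon>0$; (b) $V\sim N^{1-\beta}$ for some $\frac{1-\zeta}2<\beta<1-\zeta$ and $h\,\mu_0=(1+\epsilon)\rho_r(\beta,\zeta)\log N$ for some fixed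 $\epsilon>0$. -/

import Mathlib

open MeasureTheory ProbabilityTheory Filter Asymptotics Topology
open scoped NNReal ENNReal unitInterval

namespace SparsityLikelihood

noncomputable section

/-! ### Sparsity likelihood score -/

def f₁ (p : ℝ) : ℝ := 1 / (p * (2 - Real.log p) ^ 2) - 1 / 2

def f₂ (p : ℝ) : ℝ := 1 / √p - 2

/-- The score `ℓ(p)` of a single p-value. -/
def score (lam1 lam2 : ℝ) (N : ℕ) (p : ℝ) : ℝ :=
  Real.log (1 + lam1 * Real.log N / N * f₁ p + lam2 / √(N * Real.log N) * f₂ p)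

/-- The penalized score of the window `(s, t, u)`, where `p n` is the p-value of the `n`-th sequence
in this window. -/
def penalizedScore (lam1 lam2 : ℝ) (N T : ℕ) (p : Fin N → ℝ) (s t u : ℕ) : ℝ :=
  (∑ n, score lam1 lam2 N (p n))
    - Real.log ((T : ℝ) / 4 * (1 / ((t : ℝ) - s) + 1 / ((u : ℝ) - t)))

/-! ### The algorithm -/

/-- `K_i(g) = ⌊(g - 1) / d_i⌋`. -/
def numWindows (d : ℕ → ℕ) (i g : ℕ) : ℕ := (g - 1) / d i

/-- Left end `s(ik)` of the `k`-th window at scale `i`. -/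
def winLeft (h d : ℕ → ℕ) (i k : ℕ) : ℕ := k * d i - h i

/-- Centre `t(ik)` of the `k`-th window at scale `i`. -/
def winMid (d : ℕ → ℕ) (i k : ℕ) : ℕ := k * d i

/-- Right end `u(ik)` of the `k`-th window at scale `i`, in a dataset of length `g`. -/
def winRight (h d : ℕ → ℕ) (i k g : ℕ) : ℕ := min (k * d i + h i) g

/-- `i_g = max {i : h_i + d_i ≤ g}` (equal to `0` if there is no such `i`). -/
def maxScale (h d : ℕ → ℕ) (g : ℕ) : ℕ := sSup {i : ℕ | 1 ≤ i ∧ h i + d i ≤ g}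

/-- The (smallest) maximizer of `f` over a finite set of indices. -/
def argmax (S : Finset ℕ) (f : ℕ → ℝ) : ℕ := sInf {k | k ∈ S ∧ ∀ l ∈ S, f l ≤ f k}

open Classical in
/-- `SL-estimate(c, i₀, b, e)`. Here `pl s t u` is the penalized score of the window `(s, t, u)`
of the full dataset; the windows of the dataset `X_{b:e}` are shifted by `b - 1`. -/
def slEstimate (h d : ℕ → ℕ) (pl : ℕ → ℕ → ℕ → ℝ) (c : ℝ) (i₀ b e : ℕ) : ℕ × ℕ :=
  let g := e + 1 - b
  let local_pl : ℕ → ℕ → ℕ → ℝ := fun s t u => pl (s + b - 1) (t + b - 1) (u + b - 1)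
  let windowScore : ℕ → ℕ → ℝ := fun i k =>
    local_pl (winLeft h d i k) (winMid d i k) (winRight h d i k g)
  if H : ∃ i, i₀ ≤ i ∧ i ≤ maxScale h d g ∧
      ∃ k ∈ Finset.Icc 1 (numWindows d i g), c ≤ windowScore i k then
    let i := Nat.find H
    let j := argmax (Finset.Icc 1 (numWindows d i g)) (windowScore i)
    let s := winLeft h d i j
    let u := winRight h d i j g
    (argmax (Finset.Ioo s u) (fun t => local_pl s t u) + b - 1, i)
  else (0, 0)

/-- The calls `(i₀, b, e)` of `SL-detect` that are made, directly or recursively, when it is started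
on the full dataset of length `T`; `est i₀ b e` is the output of `SL-estimate`. -/
inductive Called (est : ℕ → ℕ → ℕ → ℕ × ℕ) (T : ℕ) : ℕ → ℕ → ℕ → Prop
  | start : Called est T 1 1 T
  | left {i₀ b e : ℕ} : Called est T i₀ b e → 0 < (est i₀ b e).1 →
      Called est T (est i₀ b e).2 b (est i₀ b e).1
  | right {i₀ b e : ℕ} : Called est T i₀ b e → 0 < (est i₀ b e).1 →
      Called est T (est i₀ b e).2 (est i₀ b e).1 e

/-- The estimated change-point set: the output of `SL-detect` on the full dataset. -/
def slDetect (h d : ℕ → ℕ) (pl : ℕ → ℕ → ℕ → ℝ) (c : ℝ) (T : ℕ) : Set ℕ :=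
  {τ | 0 < τ ∧ ∃ i₀ b e, Called (slEstimate h d pl c) T i₀ b e ∧ (slEstimate h d pl c i₀ b e).1 = τ}

/-! ### The Poisson model -/

/-- Observations `X^n_t`, for `n` in `Fin N` and `1 ≤ t ≤ T`. -/
abbrev Data (N T : ℕ) : Type := Fin N → Finset.Icc 1 T → ℕ

/-- Auxiliary randomization: a number in `[0, 1]` for every sequence and every window `(s, t, u)`. -/
abbrev Randomizers (N : ℕ) : Type := Fin N → ℕ × ℕ × ℕ → I

/-- `Y^n_{st} = ∑_{s < v ≤ t} X^n_v`. -/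
def partialSum {N T : ℕ} (x : Data N T) (n : Fin N) (s t : ℕ) : ℕ :=
  ∑ v : Finset.Icc 1 T, if s < (v : ℕ) ∧ (v : ℕ) ≤ t then x n v else 0

/-- The number `(t - s) / (u - s)` of the unit interval, for `s ≤ t ≤ u`, `s < u`. -/
def successProb (s t u : ℕ) : I :=
  Set.projIcc 0 1 zero_le_one (((t : ℝ) - s) / ((u : ℝ) - s))

/-- Lower tail probability of the count `j` for the law `Bin(y, θ)`, with the atom at `j` counted
with weight `w`. -/
def randomizedCDF (y : ℕ) (θ : I) (j : ℕ) (w : ℝ) : ℝ :=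
  (binomial y θ).real (Set.Iio j) + w * (binomial y θ).real {j}

/-- Two-sided p-value (twice the smaller tail) of the conditional binomial test, made continuous
by randomization. -/
def pValue {N T : ℕ} (x : Data N T) (ξ : Randomizers N) (n : Fin N) (s t u : ℕ) : ℝ :=
  let w := randomizedCDF (partialSum x n s u) (successProb s t u) (partialSum x n s t)
    (ξ n (s, t, u))
  2 * min w (1 - w)

/-- The change-point set estimated from the observations by the sparsity likelihood algorithm. -/
def estimatedChangePoints (h d : ℕ → ℕ) (lam1 lam2 c : ℝ) {N T : ℕ}
    (ω : Data N T × Randomizers N) : Set ℕ :=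
  slDetect h d
    (fun s t u => penalizedScore lam1 lam2 N T (fun n => pValue ω.1 ω.2 n s t u) s t u) c T

/-- The law of the observations, which are independent with `X^n_t ∼ Poisson(μ^n_t)`, together with
independent randomizers of law `ν`. -/
def dataLaw (N T : ℕ) (ν : Measure (Randomizers N)) (μ : Fin N → ℕ → ℝ≥0) :
    Measure (Data N T × Randomizers N) :=
  (Measure.pi fun n => Measure.pi fun t : Finset.Icc 1 T => poissonMeasure (μ n t)).prod ν

/-- The true change-point set. -/
def changePoints {N : ℕ} (T : ℕ) (μ : Fin N → ℕ → ℝ≥0) : Set ℕ :=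
  {t | 1 ≤ t ∧ t + 1 ≤ T ∧ ∃ n, μ n t ≠ μ n (t + 1)}

/-- The number of sequences whose log-mean changes by at least `Δ` at `τ`. -/
def numChanges {N : ℕ} (μ : Fin N → ℕ → ℝ≥0) (Δ : ℝ) (τ : ℕ) : ℕ :=
  {n : Fin N | Δ ≤ |Real.log ((μ n (τ + 1) : ℝ) / (μ n τ : ℝ))|}.ncard

/-- Mean configurations bounded below by `μ₀`. -/
def Lam (N T : ℕ) (μ₀ : ℝ) : Set (Fin N → ℕ → ℝ≥0) :=
  {μ | ∀ n, ∀ t ∈ Finset.Icc 1 T, μ₀ ≤ (μ n t : ℝ)}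

def Lam₀ (N T : ℕ) (μ₀ : ℝ) : Set (Fin N → ℕ → ℝ≥0) :=
  {μ | μ ∈ Lam N T μ₀ ∧ changePoints T μ = ∅}

/-- `a`, `τ`, `b` are consecutive elements `τ_{j-1}`, `τ_j`, `τ_{j+1}` of the change-point set
with `0` and `T` added. -/
def Lam₁ (N T : ℕ) (μ₀ Δ : ℝ) (V : ℕ) (h : ℝ) : Set (Fin N → ℕ → ℝ≥0) :=
  {μ | μ ∈ Lam N T μ₀ ∧ ∃ a τ b : ℕ,
    τ ∈ changePoints T μ ∧
    a ∈ insert 0 (changePoints T μ) ∧ b ∈ insert T (changePoints T μ) ∧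
    a < τ ∧ τ < b ∧ (∀ t ∈ changePoints T μ, a < t → t < b → t = τ) ∧
    h ≤ min ((b : ℝ) - τ) ((τ : ℝ) - a) ∧ V ≤ numChanges μ Δ τ}

/-- Worst-case Type I error probability plus worst-case Type II error probability of the algorithm
for the test of `Λ₀` against `Λ₁(Δ, V, hmin)`. -/
def totalError (h d : ℕ → ℕ) (lam1 lam2 c : ℝ) (N T : ℕ) (ν : Measure (Randomizers N))
    (μ₀ Δ : ℝ) (V : ℕ) (hmin : ℝ) : ℝ≥0∞ :=
  (⨆ μ ∈ Lam₀ N T μ₀,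
      dataLaw N T ν μ {ω | (estimatedChangePoints h d lam1 lam2 c ω).Nonempty}) +
  (⨆ μ ∈ Lam₁ N T μ₀ Δ V hmin,
      dataLaw N T ν μ {ω | estimatedChangePoints h d lam1 lam2 c ω = ∅})

/-! ### Constants of the detection boundary and of the algorithm -/

/-- `I_r`. -/
def largeDev (r : ℝ) : ℝ :=
  r * Real.log (2 * r / (r + 1)) + Real.log (2 / (r + 1))

/-- `g_r(ω)`. -/
def powerMean (r ω : ℝ) : ℝ := ((1 + r ^ ω) / 2) ^ (1 / ω)

/-- `ρ_r(β, ζ)`. -/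
def rho (r β ζ : ℝ) : ℝ :=
  sSup ((fun ω : ℝ => (β - ω⁻¹ * (1 - ζ)) / (2 * powerMean r ω - 1 - r)) ''
    Set.Ioc ((1 - ζ) / β) 2)

/-- `log (∑_{i ≤ i_T} h_i / d_i)`. -/
def logWindowSum (h d : ℕ → ℕ) (T : ℕ) : ℝ :=
  Real.log (∑ i ∈ Finset.Icc 1 (maxScale h d T), (h i : ℝ) / (d i : ℝ))

/-- `λ₂ = √(log T / log log T)`. -/
def lambda2 (T : ℕ) : ℝ := √(Real.log T / Real.log (Real.log T))

end

end SparsityLikelihood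

open SparsityLikelihood

namespace SparsityLikelihood

/-! ### The joint law of the p-values of a window -/

noncomputable section

/-! The recursion of the algorithm plays no role for either error: the estimated set is non-empty
exactly when some grid window of the full dataset reaches the threshold (`slDetect_nonempty_iff`).
In a fixed window the p-values of the sequences are independent (`map_pValue_dataLaw`), so
everything reduces to exponential moments of a single score, whose exponential is `likRatio`, that
is 1 + α f₁ + β f₂ with small weights α and β.

Type I error: f₁ and f₂ integrate to zero on (0, 1], so `likRatio` has mean one at a uniform
p-value. Markov's inequality bounds the probability of one window at scale i by exp(-c) · 2 h_i / T,
and with at most T / d_i windows per scale the union bound leaves 2 exp(`logWindowSum` - c), which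
vanishes (`typeI_error_le`).

Type II error: one scale slightly below the minimal distance and the grid window centred just left
of the change suffice (`typeII_error_le`). There each changing sequence has two Poisson counts whose
means differ by a factor r' > r, and the penalty is at most log T, so the total score has to exceed
c + log T with high probability. Lower deviations are controlled by the mean of 1 / `likRatio`.
Whatever the two means are, the p-value of the symmetric test is stochastically at most uniform
(`lintegral_pValueLaw_half_le`), so no sequence contributes more than 1 + `nullExcess`, and λ₂ is
small enough to make N · `nullExcess` negligible against log T (`eventually_nullExcess_le`).

In case (a) the f₁ part decides. A changing sequence has p-value at most 2 exp(-a I_r) except with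
exponentially small probability (`exists_pValueLaw_half_Ioi_le`), hence a score of almost a I_r, and
V such scores add up to more than log T (`pi_sum_score_le_of_large`).

In case (b) the f₂ part decides. A changing sequence lowers the mean of 1 / `likRatio` by about P(p
≤ p₀) · min(1, β / √p₀) for any p₀ (`lintegral_inv_likRatio_le_of_small`). Bounding this below by
forcing the two counts to atypical values is a large deviation problem. Its optimal tilts are
indexed by ω in [1, 2], and the definition of ρ says that some tilt yields a gain larger than
N^(ζ-1+β) by a power of N (`exists_tilt`, `eventually_likelySmall`). Multiplied by V ≈ N^(1-β) this
dominates log T ≈ N^ζ. -/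

/-- The p-value of the randomized binomial test, as a function of the two counts. -/
def testPValue (θ : I) (k : ℕ × ℕ) (ξ : I) : ℝ :=
  2 * min (randomizedCDF (k.1 + k.2) θ k.1 ξ) (1 - randomizedCDF (k.1 + k.2) θ k.1 ξ)

/-- The law of the p-value when the two counts are independent Poisson variables. -/
def pValueLaw (θ : I) (a b : ℝ≥0) : Measure ℝ :=
  (((poissonMeasure a).prod (poissonMeasure b)).prod (volume : Measure I)).map
    fun z => testPValue θ z.1 z.2

end

theorem continuous_testPValue (θ : I) (k : ℕ × ℕ) : Continuous (testPValue θ k) := by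
  unfold testPValue randomizedCDF
  fun_prop

theorem measurable_testPValue (θ : I) :
    Measurable fun z : (ℕ × ℕ) × I => testPValue θ z.1 z.2 :=
  measurable_from_prod_countable_right fun k => (continuous_testPValue θ k).measurable

instance (θ : I) (a b : ℝ≥0) : IsProbabilityMeasure (pValueLaw θ a b) :=
  Measure.isProbabilityMeasure_map (measurable_testPValue θ).aemeasurable

/-! ### Products of independent variables and sums of Poisson variables. -/

theorem lintegral_pi_prod {ι : Type*} [Fintype ι] {X : ι → Type*} [∀ i, MeasurableSpace (X i)]
    (Q : ∀ i, Measure (X i)) [∀ i, IsProbabilityMeasure (Q i)] (f : ∀ i, X i → ℝ≥0∞)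
    (hf : ∀ i, Measurable (f i)) :
    ∫⁻ x, ∏ i, f i (x i) ∂(Measure.pi Q) = ∏ i, ∫⁻ x, f i x ∂(Q i) := by
  have hind : iIndepFun (fun i (x : ∀ i, X i) => f i (x i)) (Measure.pi Q) :=
    iIndepFun_pi fun i => (hf i).aemeasurable
  have h := lintegral_prod_eq_prod_lintegral_of_indepFun (μ := Measure.pi Q) Finset.univ
    (fun i (x : ∀ i, X i) => f i (x i)) hind (fun i => (hf i).comp (measurable_pi_apply i))
  rw [h]
  refine Finset.prod_congr rfl fun i _ => ?_
  exact (measurePreserving_eval Q i).lintegral_comp (hf i)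

theorem hasLaw_sum_poissonMeasure {ι : Type*} [Fintype ι] (m : ι → ℝ≥0) (S : Finset ι) :
    HasLaw (fun x : ι → ℕ => ∑ v ∈ S, x v) (poissonMeasure (∑ v ∈ S, m v))
      (Measure.pi fun v => poissonMeasure (m v)) := by
  classical
  have hind : iIndepFun (fun v (x : ι → ℕ) => x v) (Measure.pi fun v => poissonMeasure (m v)) :=
    iIndepFun_pi (X := fun _ (k : ℕ) => k) fun v => aemeasurable_id
  induction S using Finset.induction_on with
  | empty =>
    refine ⟨by fun_prop, ?_⟩
    simp only [Finset.sum_empty]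
    rw [Measure.map_const]
    refine Measure.ext_of_singleton fun k => ?_
    rw [poissonMeasure_singleton]
    rcases Nat.eq_zero_or_pos k with rfl | hk
    · simp
    · simp [hk.ne']
  | insert i S hi ih =>
    have h1 := hind.indepFun_finsetSum_of_notMem (fun v => measurable_pi_apply v) hi
    have h2 : HasLaw (fun x : ι → ℕ => x i) (poissonMeasure (m i))
        (Measure.pi fun v => poissonMeasure (m v)) :=
      ⟨(measurable_pi_apply i).aemeasurable, (measurePreserving_eval _ i).map_eq⟩
    have h3 : HasLaw (∑ j ∈ S, fun x : ι → ℕ => x j) (poissonMeasure (∑ v ∈ S, m v))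
        (Measure.pi fun v => poissonMeasure (m v)) := by
      convert ih using 1
      ext x; simp
    have h4 := h1.hasLaw_add_poissonMeasure h3 h2
    rw [Finset.sum_insert hi, add_comm]
    convert h4 using 1
    ext x
    simp [Finset.sum_insert hi, add_comm]

theorem map_sums_poissonMeasure {ι : Type*} [Fintype ι] (m : ι → ℝ≥0) (S S' : Finset ι)
    (hS : Disjoint S S') :
    (Measure.pi fun v => poissonMeasure (m v)).map
        (fun x : ι → ℕ => (∑ v ∈ S, x v, ∑ v ∈ S', x v)) =
      (poissonMeasure (∑ v ∈ S, m v)).prod (poissonMeasure (∑ v ∈ S', m v)) := by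
  have hind : iIndepFun (fun v (x : ι → ℕ) => x v) (Measure.pi fun v => poissonMeasure (m v)) :=
    iIndepFun_pi (X := fun _ (k : ℕ) => k) fun v => aemeasurable_id
  have h1 := hind.indepFun_finset S S' hS (fun v => measurable_pi_apply v)
  have h2 := h1.comp (φ := fun y : S → ℕ => ∑ v : S, y v) (ψ := fun y : S' → ℕ => ∑ v : S', y v)
    (by fun_prop) (by fun_prop)
  have h3 : IndepFun (fun x : ι → ℕ => ∑ v ∈ S, x v) (fun x : ι → ℕ => ∑ v ∈ S', x v)
      (Measure.pi fun v => poissonMeasure (m v)) := by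
    convert h2 using 1 <;> ext x <;>
      simp [Function.comp, Finset.sum_attach _ (fun v => x v)]
  rw [(indepFun_iff_map_prod_eq_prod_map_map (by fun_prop) (by fun_prop)).1 h3,
    (hasLaw_sum_poissonMeasure m S).map_eq, (hasLaw_sum_poissonMeasure m S').map_eq]

/-- The observation times in `(s, t]`. -/
def timesIn (T s t : ℕ) : Finset (Finset.Icc 1 T) :=
  Finset.univ.filter fun v : Finset.Icc 1 T => s < (v : ℕ) ∧ (v : ℕ) ≤ t

theorem partialSum_eq_sum_timesIn {N T : ℕ} (x : Data N T) (n : Fin N) (s t : ℕ) :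
    partialSum x n s t = ∑ v ∈ timesIn T s t, x n v := by
  rw [partialSum, timesIn, Finset.sum_filter]

theorem partialSum_add {N T : ℕ} (x : Data N T) (n : Fin N) {s t u : ℕ} (hst : s ≤ t)
    (htu : t ≤ u) : partialSum x n s u = partialSum x n s t + partialSum x n t u := by
  simp only [partialSum, ← Finset.sum_add_distrib]
  refine Finset.sum_congr rfl fun v _ => ?_
  split_ifs <;> omega

theorem pValue_eq_testPValue {N T : ℕ} (x : Data N T) (ξ : Randomizers N) (n : Fin N)
    {s t u : ℕ} (hst : s ≤ t) (htu : t ≤ u) :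
    pValue x ξ n s t u = testPValue (successProb s t u) (partialSum x n s t, partialSum x n t u)
      (ξ n (s, t, u)) := by
  simp only [pValue, testPValue, partialSum_add x n hst htu]

theorem sum_timesIn_eq_sum_Ioc (T : ℕ) (f : ℕ → ℝ≥0) {s t : ℕ} (ht : t ≤ T) :
    ∑ v ∈ timesIn T s t, f v = ∑ v ∈ Finset.Ioc s t, f v := by
  rw [timesIn, Finset.sum_filter, Finset.sum_coe_sort (Finset.Icc 1 T)
    (fun v => if s < v ∧ v ≤ t then f v else 0), ← Finset.sum_filter]
  refine Finset.sum_congr ?_ fun _ _ => rfl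
  ext v
  simp only [Finset.mem_filter, Finset.mem_Icc, Finset.mem_Ioc]
  omega

section WindowLaw

variable {N T : ℕ}

theorem measurable_pValue (n : Fin N) {s t u : ℕ} (hst : s ≤ t) (htu : t ≤ u) :
    Measurable fun ω : Data N T × Randomizers N => pValue ω.1 ω.2 n s t u := by
  have h0 : (fun ω : Data N T × Randomizers N => pValue ω.1 ω.2 n s t u) =
      (fun z : (ℕ × ℕ) × I => testPValue (successProb s t u) z.1 z.2) ∘
        fun ω => ((partialSum ω.1 n s t, partialSum ω.1 n t u), ω.2 n (s, t, u)) :=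
    funext fun ω => pValue_eq_testPValue ω.1 ω.2 n hst htu
  rw [h0]
  have h : Measurable fun ω : Data N T × Randomizers N =>
      ((partialSum ω.1 n s t, partialSum ω.1 n t u), ω.2 n (s, t, u)) := by
    simp only [partialSum_eq_sum_timesIn]
    fun_prop
  exact (measurable_testPValue (successProb s t u)).comp h

/-- In a fixed window the p-values of the sequences are independent. -/
theorem map_pValue_dataLaw (ν : Measure (Randomizers N)) (μ : Fin N → ℕ → ℝ≥0) {s t u : ℕ}
    (hν : ν.map (fun ξ n => ξ n (s, t, u)) = Measure.pi fun _ : Fin N => (volume : Measure I))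
    (hst : s ≤ t) (htu : t ≤ u) (hu : u ≤ T) :
    (dataLaw N T ν μ).map (fun ω n => pValue ω.1 ω.2 n s t u) =
      Measure.pi fun n => pValueLaw (successProb s t u)
        (∑ v ∈ Finset.Ioc s t, μ n v) (∑ v ∈ Finset.Ioc t u, μ n v) := by
  -- The randomizer law is not assumed to be normalized; its uniform image in one window forces
  -- total mass one.
  have hνp : IsProbabilityMeasure ν := by
    have h0 : IsProbabilityMeasure
        (ν.map (fun (ξ : Randomizers N) (n : Fin N) => ξ n (s, t, u))) := by
      rw [hν]; infer_instance
    exact Measure.isProbabilityMeasure_of_map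
      (fun (ξ : Randomizers N) (n : Fin N) => ξ n (s, t, u))
  have hdisj : Disjoint (timesIn T s t) (timesIn T t u) := by
    rw [Finset.disjoint_left]
    intro v
    simp only [timesIn, Finset.mem_filter]
    omega
  set F : (Finset.Icc 1 T → ℕ) → ℕ × ℕ :=
    fun x => (∑ v ∈ timesIn T s t, x v, ∑ v ∈ timesIn T t u, x v) with hF
  have hFm : Measurable F := measurable_of_countable _
  have h1 : (Measure.pi fun n => Measure.pi fun t : Finset.Icc 1 T => poissonMeasure (μ n t)).map
      (fun x n => F (x n)) = Measure.pi fun n =>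
        (poissonMeasure (∑ v ∈ Finset.Ioc s t, μ n v)).prod
          (poissonMeasure (∑ v ∈ Finset.Ioc t u, μ n v)) := by
    have hpm : ∀ n, IsProbabilityMeasure ((Measure.pi fun t : Finset.Icc 1 T =>
        poissonMeasure (μ n t)).map F) := fun n =>
      Measure.isProbabilityMeasure_map hFm.aemeasurable
    rw [Measure.pi_map_pi (f := fun _ => F) (fun n => hFm.aemeasurable)]
    congr 1
    ext1 n
    rw [map_sums_poissonMeasure (fun v : Finset.Icc 1 T => μ n v) _ _ hdisj,
      sum_timesIn_eq_sum_Ioc T (μ n) (htu.trans hu), sum_timesIn_eq_sum_Ioc T (μ n) hu]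
  have h2 : (dataLaw N T ν μ).map
      (Prod.map (fun (x : Data N T) n => F (x n)) (fun (ξ : Randomizers N) n => ξ n (s, t, u))) =
      (Measure.pi fun n => (poissonMeasure (∑ v ∈ Finset.Ioc s t, μ n v)).prod
          (poissonMeasure (∑ v ∈ Finset.Ioc t u, μ n v))).prod
        (Measure.pi fun _ : Fin N => (volume : Measure I)) := by
    rw [dataLaw, ← Measure.map_prod_map _ _ (by fun_prop) (by fun_prop), h1, hν]
  -- Regroups (all counts, all randomizers) into one independent pair per sequence, on which the
  -- p-value map acts coordinatewise.
  have h3 := (measurePreserving_arrowProdEquivProdArrow (ℕ × ℕ) I (Fin N)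
    (fun n => (poissonMeasure (∑ v ∈ Finset.Ioc s t, μ n v)).prod
          (poissonMeasure (∑ v ∈ Finset.Ioc t u, μ n v))) (fun _ => volume))
  have h4 := h3.symm.map_eq
  rw [← h2, Measure.map_map (MeasurableEquiv.measurable _) (by fun_prop)] at h4
  have h5 := congrArg (Measure.map (fun (z : Fin N → (ℕ × ℕ) × I) n =>
    testPValue (successProb s t u) (z n).1 (z n).2)) h4
  have hmt : Measurable (fun (z : Fin N → (ℕ × ℕ) × I) n =>
      testPValue (successProb s t u) (z n).1 (z n).2) :=
    measurable_pi_lambda _ fun n => (measurable_testPValue _).comp (measurable_pi_apply n)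
  rw [Measure.map_map hmt (by
    exact (MeasurableEquiv.measurable _).comp (by fun_prop))] at h5
  rw [Measure.pi_map_pi (f := fun _ (z : (ℕ × ℕ) × I) => testPValue (successProb s t u) z.1 z.2)
    (hμ := fun n => by
      have : IsProbabilityMeasure (pValueLaw (successProb s t u)
        (∑ v ∈ Finset.Ioc s t, μ n v) (∑ v ∈ Finset.Ioc t u, μ n v)) := inferInstance
      unfold pValueLaw at this
      infer_instance)
    (fun n => (measurable_testPValue _).aemeasurable)] at h5
  unfold pValueLaw
  rw [← h5]
  congr 1
  ext ω n
  rw [pValue_eq_testPValue _ _ _ hst htu, partialSum_eq_sum_timesIn, partialSum_eq_sum_timesIn]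
  rfl

end WindowLaw

/-! ### The randomized binomial distribution function -/

theorem measureReal_Iio_eq_sum (P : Measure ℕ) [IsProbabilityMeasure P] (j : ℕ) :
    P.real (Set.Iio j) = ∑ i ∈ Finset.range j, P.real {i} := by
  rw [sum_measureReal_singleton]
  congr 1
  ext i; simp

theorem randomizedCDF_eq (y : ℕ) (θ : I) (j : ℕ) (w : ℝ) :
    randomizedCDF y θ j w =
      ∑ i ∈ Finset.range j, (binomial y θ).real {i} + (binomial y θ).real {j} * w := by
  rw [randomizedCDF, measureReal_Iio_eq_sum, mul_comm]

theorem sum_binomial_real (y : ℕ) (θ : I) :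
    ∑ i ∈ Finset.range (y + 1), (binomial y θ).real {i} = 1 := by
  have h := add_pow (θ : ℝ) (1 - θ) y
  simp only [add_sub_cancel, one_pow] at h
  rw [h]
  refine Finset.sum_congr rfl fun i _ => ?_
  rw [binomial_real_singleton]; ring

/-- Change of variables. The slope is kept as a factor on the left so that atoms of mass zero need
no separate treatment later. -/
theorem lintegral_comp_affine (H : ℝ → ℝ≥0∞) (a b : ℝ) (hb : 0 ≤ b) :
    ENNReal.ofReal b * ∫⁻ ξ : I, H (a + b * ξ) = ∫⁻ x in Set.Ioc a (a + b), H x := by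
  rcases hb.eq_or_lt with rfl | hb
  · simp
  have h1 : ∫⁻ ξ : I, H (a + b * ξ) = ∫⁻ x in Set.Ioc (0 : ℝ) 1, H (a + b * x) := by
    rw [show (volume : Measure I) = Measure.comap Subtype.val volume from rfl,
      lintegral_subtype_comap measurableSet_Icc (fun x : ℝ => H (a + b * x)),
      restrict_Ioc_eq_restrict_Icc]
  have h2 : (fun x : ℝ => a + b * x) '' Set.Ioc 0 1 = Set.Ioc a (a + b) := by
    have := Set.image_affine_Ioc hb a 0 1
    simpa [add_comm] using this
  rw [h1, ← h2, lintegral_image_eq_lintegral_abs_deriv_mul (f' := fun _ => b) measurableSet_Ioc,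
    lintegral_const_mul']
  · simp [abs_of_pos hb]
  · simp
  · intro x _
    simpa using (((hasDerivAt_id x).const_mul b).const_add a).hasDerivWithinAt
  · intro x _ y _ h
    simpa [hb.ne'] using h

/-- A uniform randomizer spreads the atom `b j` over an interval of length `b j` that starts at the
mass of the preceding atoms. These intervals tile, which is the randomized probability integral
transform. -/
theorem sum_lintegral_partition (H : ℝ → ℝ≥0∞) (b : ℕ → ℝ) (hb : ∀ i, 0 ≤ b i) (n : ℕ) :
    ∑ j ∈ Finset.range n,
        ENNReal.ofReal (b j) * ∫⁻ ξ : I, H (∑ i ∈ Finset.range j, b i + b j * ξ) =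
      ∫⁻ x in Set.Ioc 0 (∑ i ∈ Finset.range n, b i), H x := by
  induction n with
  | zero => simp
  | succ n ih =>
    rw [Finset.sum_range_succ, ih, lintegral_comp_affine _ _ _ (hb n), Finset.sum_range_succ,
      ← lintegral_union measurableSet_Ioc (Set.Ioc_disjoint_Ioc_of_le le_rfl),
      Set.Ioc_union_Ioc_eq_Ioc (Finset.sum_nonneg fun i _ => hb i) (by linarith [hb n])]

/-- Each half of the unit interval is mapped affinely onto (0, 1] with slope of modulus two, so
folding preserves the uniform law. -/
theorem lintegral_two_mul_min (F : ℝ → ℝ≥0∞) :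
    ∫⁻ w in Set.Ioc (0 : ℝ) 1, F (2 * min w (1 - w)) = ∫⁻ p in Set.Ioc (0 : ℝ) 1, F p := by
  have h1 : ∫⁻ p in Set.Ioc (0 : ℝ) 1, F p =
      2 * ∫⁻ w in Set.Ioc (0 : ℝ) (1 / 2), F (2 * w) := by
    have him : (fun x : ℝ => 2 * x) '' Set.Ioc 0 (1 / 2) = Set.Ioc 0 1 := by
      have := Set.image_affine_Ioc (a := (2 : ℝ)) (by norm_num) 0 0 (1 / 2)
      simpa using this
    rw [← him, lintegral_image_eq_lintegral_abs_deriv_mul (f' := fun _ => 2) measurableSet_Ioc,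
      lintegral_const_mul']
    · simp
    · simp
    · intro x _
      simpa using ((hasDerivAt_id x).const_mul (2 : ℝ)).hasDerivWithinAt
    · intro x _ y _ h
      simpa using h
  have h2 : ∫⁻ p in Set.Ioc (0 : ℝ) 1, F p =
      2 * ∫⁻ w in Set.Ioc (1 / 2 : ℝ) 1, F (2 * (1 - w)) := by
    have him : (fun x : ℝ => 2 * (1 - x)) '' Set.Ico (1 / 2) 1 = Set.Ioc 0 1 := by
      ext y
      constructor
      · rintro ⟨x, hx, rfl⟩
        constructor <;> simp only <;> linarith [hx.1, hx.2]
      · intro hy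
        exact ⟨1 - y / 2, ⟨by linarith [hy.2], by linarith [hy.1]⟩, by simp only; ring⟩
    rw [← him, lintegral_image_eq_lintegral_abs_deriv_mul (f' := fun _ => -2) measurableSet_Ico,
      lintegral_const_mul', restrict_Ico_eq_restrict_Ioc]
    · simp
    · simp
    · intro x _
      simpa using (((hasDerivAt_id x).const_sub 1).const_mul (2 : ℝ)).hasDerivWithinAt
    · intro x _ y _ h
      simpa using h
  have h3 : ∫⁻ w in Set.Ioc (0 : ℝ) 1, F (2 * min w (1 - w)) =
      (∫⁻ w in Set.Ioc (0 : ℝ) (1 / 2), F (2 * w)) +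
        ∫⁻ w in Set.Ioc (1 / 2 : ℝ) 1, F (2 * (1 - w)) := by
    rw [← Set.Ioc_union_Ioc_eq_Ioc (by norm_num : (0 : ℝ) ≤ 1 / 2) (by norm_num : (1 / 2 : ℝ) ≤ 1),
      lintegral_union measurableSet_Ioc (Set.Ioc_disjoint_Ioc_of_le le_rfl)]
    congr 1
    · refine setLIntegral_congr_fun measurableSet_Ioc fun w hw => ?_
      rw [min_eq_left (by linarith [hw.2])]
    · refine setLIntegral_congr_fun measurableSet_Ioc fun w hw => ?_
      rw [min_eq_right (by linarith [hw.1])]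
  have h4 : ∫⁻ w in Set.Ioc (1 / 2 : ℝ) 1, F (2 * (1 - w)) =
      ∫⁻ w in Set.Ioc (0 : ℝ) (1 / 2), F (2 * w) :=
    (ENNReal.mul_right_inj (by simp) (by simp)).1 (h2.symm.trans h1)
  rw [h3, h4, h1, two_mul]

/-- Uniformity holds conditionally on the total count y, for every y. The law of the total therefore
never enters the null distribution. -/
theorem sum_lintegral_testPValue (θ : I) (F : ℝ → ℝ≥0∞) (y : ℕ) :
    ∑ j ∈ Finset.range (y + 1), ENNReal.ofReal ((binomial y θ).real {j}) *
        ∫⁻ ξ : I, F (testPValue θ (j, y - j) ξ) = ∫⁻ p in Set.Ioc (0 : ℝ) 1, F p := by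
  rw [← lintegral_two_mul_min, ← sum_binomial_real y θ,
    ← sum_lintegral_partition _ _ (fun i => measureReal_nonneg)]
  refine Finset.sum_congr rfl fun j hj => ?_
  have : j + (y - j) = y := by have := Finset.mem_range.1 hj; omega
  simp only [testPValue, randomizedCDF_eq, this, sum_binomial_real]

/-! ### Poisson splitting -/

/-- Given their sum, two independent Poisson counts are binomial. The condition on `θ` is
multiplicative so that the degenerate case a + b = 0 is included. -/
theorem poissonMeasure_mul_poissonMeasure (a b : ℝ≥0) (θ : I) (hθ : (θ : ℝ) * (a + b) = a)
    (i j : ℕ) :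
    poissonMeasure a {i} * poissonMeasure b {j} =
      poissonMeasure (a + b) {i + j} * ENNReal.ofReal ((binomial (i + j) θ).real {i}) := by
  simp only [poissonMeasure_singleton, binomial_real_singleton]
  rw [← ENNReal.ofReal_mul (by positivity), ← ENNReal.ofReal_mul (by positivity)]
  congr 1
  have hθ' : (1 - (θ : ℝ)) * (a + b) = b := by linarith
  rw [Nat.add_sub_cancel_left, Nat.cast_add_choose]
  have h1 : (Nat.factorial (i + j) : ℝ) ≠ 0 := by positivity
  have h2 : (Nat.factorial i : ℝ) ≠ 0 := by positivity
  have h3 : (Nat.factorial j : ℝ) ≠ 0 := by positivity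
  have h4 : (a : ℝ) ^ i * (b : ℝ) ^ j = ((a + b : ℝ≥0) : ℝ) ^ (i + j) * (θ : ℝ) ^ i *
      (1 - (θ : ℝ)) ^ j := by
    have e1 : (a : ℝ) ^ i = (θ : ℝ) ^ i * (a + b) ^ i := by rw [← mul_pow, hθ]
    have e2 : (b : ℝ) ^ j = (1 - (θ : ℝ)) ^ j * (a + b) ^ j := by rw [← mul_pow, hθ']
    rw [e1, e2]
    push_cast
    ring
  have h5 : Real.exp (-((a + b : ℝ≥0) : ℝ)) = Real.exp (-a) * Real.exp (-b) := by
    rw [← Real.exp_add]; push_cast; ring_nf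
  rw [h5]
  field_simp
  linear_combination h4

theorem lintegral_poissonMeasure_prod (a b : ℝ≥0) (θ : I) (hθ : (θ : ℝ) * (a + b) = a)
    (G : ℕ × ℕ → ℝ≥0∞) :
    ∫⁻ k, G k ∂((poissonMeasure a).prod (poissonMeasure b)) =
      ∑' y, poissonMeasure (a + b) {y} * ∑ j ∈ Finset.range (y + 1),
        ENNReal.ofReal ((binomial y θ).real {j}) * G (j, y - j) := by
  rw [lintegral_countable', ← Finset.HasAntidiagonal.sigmaAntidiagonalEquivProd.tsum_eq, ENNReal.tsum_sigma']
  refine tsum_congr fun y => ?_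
  rw [tsum_fintype]
  refine (Finset.sum_coe_sort (Finset.HasAntidiagonal.antidiagonal y)
    (fun k => G k * ((poissonMeasure a).prod (poissonMeasure b)) {k})).trans ?_
  rw [Finset.Nat.sum_antidiagonal_eq_sum_range_succ_mk, Finset.mul_sum]
  refine Finset.sum_congr rfl fun j hj => ?_
  have hjy : j + (y - j) = y := by have := Finset.mem_range.1 hj; omega
  rw [← Set.singleton_prod_singleton, Measure.prod_prod,
    poissonMeasure_mul_poissonMeasure a b θ hθ, hjy]
  ring

/-- Two success probabilities are needed: `θ` is the one used by the test, `θ'` is the true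
conditional one. They agree only when the rates on both sides of the centre agree. -/
theorem lintegral_pValueLaw (θ θ' : I) (a b : ℝ≥0) (hθ : (θ' : ℝ) * (a + b) = a) {F : ℝ → ℝ≥0∞}
    (hF : Measurable F) :
    ∫⁻ p, F p ∂(pValueLaw θ a b) =
      ∑' y, poissonMeasure (a + b) {y} * ∑ j ∈ Finset.range (y + 1),
        ENNReal.ofReal ((binomial y θ').real {j}) *
          ∫⁻ ξ : I, F (testPValue θ (j, y - j) ξ) := by
  rw [pValueLaw, lintegral_map hF (measurable_testPValue θ), lintegral_prod
    (fun z : (ℕ × ℕ) × I => F (testPValue θ z.1 z.2))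
    (hF.comp (measurable_testPValue θ)).aemeasurable, lintegral_poissonMeasure_prod a b θ' hθ]

theorem tsum_poissonMeasure_singleton (a : ℝ≥0) : ∑' y, poissonMeasure a {y} = 1 := by
  have := lintegral_countable' (μ := poissonMeasure a) (fun _ => 1)
  simpa using this.symm

/-- Without a change-point the p-value is uniform. -/
theorem lintegral_pValueLaw_null (θ : I) (a b : ℝ≥0) (hθ : (θ : ℝ) * (a + b) = a) {F : ℝ → ℝ≥0∞}
    (hF : Measurable F) :
    ∫⁻ p, F p ∂(pValueLaw θ a b) = ∫⁻ p in Set.Ioc (0 : ℝ) 1, F p := by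
  simp_rw [lintegral_pValueLaw θ θ a b hθ hF, sum_lintegral_testPValue]
  rw [ENNReal.tsum_mul_right, tsum_poissonMeasure_singleton, one_mul]

/-! ### Unbiasedness of the symmetric test -/

noncomputable section

/-- The success probability `1 / 2`. -/
def half : I := ⟨1 / 2, by norm_num, by norm_num⟩

end

@[simp]
theorem coe_half : ((half : I) : ℝ) = 1 / 2 := rfl

theorem binomial_half_real (y j : ℕ) (hj : j ≤ y) :
    (binomial y half).real {j} = y.choose j / 2 ^ y := by
  rw [binomial_real_singleton, coe_half, show (1 : ℝ) - 1 / 2 = 1 / 2 by norm_num, mul_assoc,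
    ← pow_add, Nat.add_sub_cancel' hj, one_div, inv_pow, div_eq_mul_inv]

theorem binomial_real_reflect (y j : ℕ) (θ : I) (hj : j ≤ y) :
    (binomial y θ).real {y - j} = (binomial y (unitInterval.symm θ)).real {j} := by
  rw [binomial_real_singleton, binomial_real_singleton, Nat.choose_symm hj, Nat.sub_sub_self hj,
    unitInterval.coe_symm_eq]
  ring

theorem sum_range_reflect_binomial_half (y j : ℕ) (hj : j ≤ y) :
    ∑ i ∈ Finset.range (y - j), (binomial y half).real {i} =
      1 - ∑ i ∈ Finset.range (j + 1), (binomial y half).real {i} := by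
  rw [eq_sub_iff_add_eq, ← sum_binomial_real y half,
    ← Finset.sum_range_add_sum_Ico _ (show y - j ≤ y + 1 by omega)]
  congr 1
  have hs : half = unitInterval.symm half := by ext; norm_num [half]
  refine Finset.sum_bij' (fun i _ => y - i) (fun i _ => y - i) ?_ ?_ ?_ ?_ ?_
  · intro i hi; simp only [Finset.mem_range, Finset.mem_Ico] at *; omega
  · intro i hi; simp only [Finset.mem_range, Finset.mem_Ico] at *; omega
  · intro i hi; simp only [Finset.mem_range] at hi; omega
  · intro i hi; simp only [Finset.mem_Ico] at hi; omega
  · intro i hi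
    rw [binomial_real_reflect y i half (by simp only [Finset.mem_range] at hi; omega), ← hs]

theorem randomizedCDF_half_symm (A B : ℕ) (w : ℝ) :
    randomizedCDF (A + B) half B (1 - w) = 1 - randomizedCDF (A + B) half A w := by
  have h1 := sum_range_reflect_binomial_half (A + B) A (by omega)
  have h2 := binomial_half_real (A + B) A (by omega)
  have h3 := binomial_half_real (A + B) B (by omega)
  rw [Nat.add_sub_cancel_left] at h1
  rw [randomizedCDF_eq, randomizedCDF_eq, h1, h3, h2, Finset.sum_range_succ, h2,
    Nat.choose_symm_add]
  ring

theorem testPValue_half_swap (A B : ℕ) (ξ : I) :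
    testPValue half (B, A) (unitInterval.symm ξ) = testPValue half (A, B) ξ := by
  simp only [testPValue, unitInterval.coe_symm_eq, add_comm B A, randomizedCDF_half_symm]
  rw [min_comm]
  ring_nf

/-- Exchanging the counts and reflecting the randomizer leaves the two-sided p-value unchanged.
Decreasing means are thereby reduced to increasing ones. -/
theorem pValueLaw_half_comm (a b : ℝ≥0) : pValueLaw half a b = pValueLaw half b a := by
  have h1 : MeasurePreserving
      (Prod.map (Prod.swap : ℕ × ℕ → ℕ × ℕ) unitInterval.symm)
      (((poissonMeasure a).prod (poissonMeasure b)).prod (volume : Measure I))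
      (((poissonMeasure b).prod (poissonMeasure a)).prod (volume : Measure I)) :=
    (Measure.measurePreserving_swap).prod unitInterval.measurePreserving_symm
  rw [pValueLaw, pValueLaw, ← h1.map_eq, Measure.map_map (measurable_testPValue half) h1.measurable]
  congr 1
  ext z
  exact (testPValue_half_swap z.1.1 z.1.2 z.2).symm

theorem testPValue_le_one (θ : I) (k : ℕ × ℕ) (ξ : I) : testPValue θ k ξ ≤ 1 := by
  have h1 := min_le_left (randomizedCDF (k.1 + k.2) θ k.1 ξ)
    (1 - randomizedCDF (k.1 + k.2) θ k.1 ξ)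
  have h2 := min_le_right (randomizedCDF (k.1 + k.2) θ k.1 ξ)
    (1 - randomizedCDF (k.1 + k.2) θ k.1 ξ)
  simp only [testPValue]
  linarith

theorem randomizedCDF_le (y : ℕ) (θ : I) (j : ℕ) (ξ : I) :
    randomizedCDF y θ j ξ ≤ ∑ i ∈ Finset.range (j + 1), (binomial y θ).real {i} := by
  rw [randomizedCDF_eq, Finset.sum_range_succ]
  have : (binomial y θ).real {j} * (ξ : ℝ) ≤ (binomial y θ).real {j} * 1 :=
    mul_le_mul_of_nonneg_left ξ.2.2 measureReal_nonneg
  linarith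

theorem le_randomizedCDF (y : ℕ) (θ : I) (j : ℕ) (ξ : I) :
    ∑ i ∈ Finset.range j, (binomial y θ).real {i} ≤ randomizedCDF y θ j ξ := by
  rw [randomizedCDF_eq]
  have : 0 ≤ (binomial y θ).real {j} * (ξ : ℝ) := mul_nonneg measureReal_nonneg ξ.2.1
  linarith

theorem sum_range_binomial_mono (y : ℕ) (θ : I) {i j : ℕ} (hij : i ≤ j) :
    ∑ i ∈ Finset.range i, (binomial y θ).real {i} ≤
      ∑ i ∈ Finset.range j, (binomial y θ).real {i} :=
  Finset.sum_le_sum_of_subset_of_nonneg (Finset.range_mono hij) fun _ _ _ => measureReal_nonneg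

theorem testPValue_pos (θ : I) (hθ0 : 0 < (θ : ℝ)) (hθ1 : (θ : ℝ) < 1) (k : ℕ × ℕ) (ξ : I)
    (hξ0 : 0 < (ξ : ℝ)) (hξ1 : (ξ : ℝ) < 1) : 0 < testPValue θ k ξ := by
  have hb : 0 < (binomial (k.1 + k.2) θ).real {k.1} := by
    rw [binomial_real_singleton]
    have : 0 < (1 - (θ : ℝ)) := by linarith
    have : 0 < (k.1 + k.2).choose k.1 := Nat.choose_pos (by omega)
    positivity
  have h0 : 0 ≤ ∑ i ∈ Finset.range k.1, (binomial (k.1 + k.2) θ).real {i} :=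
    Finset.sum_nonneg fun _ _ => measureReal_nonneg
  have h1 := sum_range_binomial_mono (k.1 + k.2) θ (show k.1 + 1 ≤ k.1 + k.2 + 1 by omega)
  rw [sum_binomial_real, Finset.sum_range_succ] at h1
  simp only [testPValue, randomizedCDF_eq]
  refine mul_pos two_pos (lt_min ?_ ?_) <;> nlinarith

theorem testPValue_half_le (A B : ℕ) (ξ : I) :
    testPValue half (A, B) ξ ≤
      2 * ∑ i ∈ Finset.range (min A B + 1), (binomial (A + B) half).real {i} := by
  simp only [testPValue]
  refine mul_le_mul_of_nonneg_left ?_ two_pos.le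
  rcases le_total A B with h | h
  · rw [min_eq_left h]
    exact (min_le_left _ _).trans (randomizedCDF_le _ _ _ _)
  · rw [min_eq_right h]
    refine (min_le_right _ _).trans ?_
    rw [← randomizedCDF_half_symm]
    exact randomizedCDF_le _ _ _ (unitInterval.symm ξ)

/-- Together with `testPValue_half_le` this brackets the p-value independently of the randomizer.
Brackets for consecutive values of min(A, B) only touch, so p-values with the same total are ordered
by min(A, B). -/
theorem le_testPValue_half (A B m : ℕ) (hA : m ≤ A) (hB : m ≤ B) (ξ : I) :
    2 * ∑ i ∈ Finset.range m, (binomial (A + B) half).real {i} ≤ testPValue half (A, B) ξ := by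
  simp only [testPValue]
  refine mul_le_mul_of_nonneg_left (le_min ?_ ?_) two_pos.le
  · exact (sum_range_binomial_mono _ _ hA).trans (le_randomizedCDF _ _ _ _)
  · rw [← randomizedCDF_half_symm]
    exact (sum_range_binomial_mono _ _ hB).trans (le_randomizedCDF _ _ _ (unitInterval.symm ξ))

theorem ae_unitInterval_mem_Ioo : ∀ᵐ ξ : I, 0 < (ξ : ℝ) ∧ (ξ : ℝ) < 1 := by
  have h : ∀ a : I, ∀ᵐ ξ : I, ξ ≠ a := fun a => by
    simp [ae_iff]
  filter_upwards [h 0, h 1] with ξ h0 h1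
  exact ⟨lt_of_le_of_ne ξ.2.1 fun h => h0 (Subtype.ext h.symm),
    lt_of_le_of_ne ξ.2.2 fun h => h1 (Subtype.ext h)⟩

theorem ae_pValueLaw_mem_Ioc (θ : I) (hθ0 : 0 < (θ : ℝ)) (hθ1 : (θ : ℝ) < 1) (a b : ℝ≥0) :
    ∀ᵐ p ∂(pValueLaw θ a b), p ∈ Set.Ioc (0 : ℝ) 1 := by
  rw [pValueLaw, ae_map_iff (p := fun p => p ∈ Set.Ioc (0 : ℝ) 1)
    (measurable_testPValue θ).aemeasurable measurableSet_Ioc]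
  have h : ∀ᵐ z ∂((poissonMeasure a).prod (poissonMeasure b)).prod (volume : Measure I),
      0 < (z.2 : ℝ) ∧ (z.2 : ℝ) < 1 :=
    Measure.quasiMeasurePreserving_snd.ae ae_unitInterval_mem_Ioo
  filter_upwards [h] with z hz
  exact ⟨testPValue_pos θ hθ0 hθ1 _ _ hz.1 hz.2, testPValue_le_one _ _ _⟩

/-- Weighted Chebyshev sum inequality for oppositely ordered families. -/
theorem sum_mul_mul_le_of_antivary {ι : Type*} (S : Finset ι) (w ρ φ : ι → ℝ)
    (hw : ∀ i ∈ S, 0 ≤ w i) (h : ∀ i ∈ S, ∀ j ∈ S, (ρ i - ρ j) * (φ i - φ j) ≤ 0) :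
    (∑ i ∈ S, w i) * ∑ i ∈ S, w i * ρ i * φ i ≤
      (∑ i ∈ S, w i * ρ i) * ∑ i ∈ S, w i * φ i := by
  have h1 : ∑ i ∈ S, ∑ j ∈ S, w i * w j * ((ρ i - ρ j) * (φ i - φ j)) ≤ 0 :=
    Finset.sum_nonpos fun i hi => Finset.sum_nonpos fun j hj =>
      mul_nonpos_of_nonneg_of_nonpos (mul_nonneg (hw i hi) (hw j hj)) (h i hi j hj)
  have h2 : ∑ i ∈ S, ∑ j ∈ S, w i * w j * ((ρ i - ρ j) * (φ i - φ j)) =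
      2 * ((∑ i ∈ S, w i) * ∑ i ∈ S, w i * ρ i * φ i) -
        2 * ((∑ i ∈ S, w i * ρ i) * ∑ i ∈ S, w i * φ i) := by
    have e : ∀ i j, w i * w j * ((ρ i - ρ j) * (φ i - φ j)) =
        (w i * ρ i * φ i) * w j + w i * (w j * ρ j * φ j)
          - (w i * ρ i) * (w j * φ j) - (w i * φ i) * (w j * ρ j) := fun i j => by ring
    simp only [e, Finset.sum_sub_distrib, Finset.sum_add_distrib, ← Finset.sum_mul_sum]
    ring
  linarith

/-- The difference of the two sides factors as (pq)^i (p^d - q^d)(p^(d+e) - q^(d+e)), and the last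
two factors have the same sign. -/
theorem symm_pow_sum_antitone (p q : ℝ) (hp : 0 ≤ p) (hq : 0 ≤ q) (y i j : ℕ) (hij : i ≤ j)
    (hj : 2 * j ≤ y) :
    p ^ j * q ^ (y - j) + p ^ (y - j) * q ^ j ≤ p ^ i * q ^ (y - i) + p ^ (y - i) * q ^ i := by
  obtain ⟨d, rfl⟩ := Nat.exists_eq_add_of_le hij
  obtain ⟨e, rfl⟩ := Nat.exists_eq_add_of_le hj
  rw [show 2 * (i + d) + e - (i + d) = i + d + e by omega,
    show 2 * (i + d) + e - i = i + d + (d + e) by omega]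
  have h : 0 ≤ (p ^ d - q ^ d) * (p ^ (d + e) - q ^ (d + e)) := by
    rcases le_total p q with h | h
    · exact mul_nonneg_of_nonpos_of_nonpos (sub_nonpos.2 (pow_le_pow_left₀ hp h _))
        (sub_nonpos.2 (pow_le_pow_left₀ hp h _))
    · exact mul_nonneg (sub_nonneg.2 (pow_le_pow_left₀ hq h _))
        (sub_nonneg.2 (pow_le_pow_left₀ hq h _))
  have h' := mul_nonneg (mul_nonneg (pow_nonneg hp i) (pow_nonneg hq i)) h
  have e1 : p ^ i * q ^ (i + d + (d + e)) + p ^ (i + d + (d + e)) * q ^ i -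
      (p ^ (i + d) * q ^ (i + d + e) + p ^ (i + d + e) * q ^ (i + d)) =
      p ^ i * q ^ i * ((p ^ d - q ^ d) * (p ^ (d + e) - q ^ (d + e))) := by ring
  linarith

/-- The symmetrized law of Bin(y, θ) has a density with respect to Bin(y, 1/2) that decreases in
min(j, y - j), while φ increases in it. Chebyshev's sum inequality compares the means, and for
symmetric φ symmetrizing the law changes nothing. -/
theorem sum_binomial_mul_le_half (y : ℕ) (θ : I) (φ : ℕ → ℝ)
    (hsymm : ∀ j ≤ y, φ (y - j) = φ j)
    (hmono : ∀ i ≤ y, ∀ j ≤ y, min i (y - i) < min j (y - j) → φ i ≤ φ j) :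
    ∑ j ∈ Finset.range (y + 1), (binomial y θ).real {j} * φ j ≤
      ∑ j ∈ Finset.range (y + 1), (binomial y half).real {j} * φ j := by
  set q : ℝ := 1 - θ with hq
  have hp0 : 0 ≤ (θ : ℝ) := θ.2.1
  have hq0 : 0 ≤ q := by linarith [θ.2.2]
  -- Density of the average of Bin(y, θ) and Bin(y, 1 - θ) with respect to Bin(y, 1/2).
  set ρ : ℕ → ℝ := fun j => 2 ^ y / 2 * ((θ : ℝ) ^ j * q ^ (y - j) + (θ : ℝ) ^ (y - j) * q ^ j)
  have hmem : ∀ {j}, j ∈ Finset.range (y + 1) → j ≤ y := fun h => by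
    have := Finset.mem_range.1 h; omega
  have hρ : ∀ j ≤ y, ρ j =
      2 ^ y / 2 * ((θ : ℝ) ^ (min j (y - j)) * q ^ (y - min j (y - j)) +
        (θ : ℝ) ^ (y - min j (y - j)) * q ^ (min j (y - j))) := by
    intro j hj
    rcases le_total j (y - j) with h | h
    · rw [min_eq_left h]
    · rw [min_eq_right h, Nat.sub_sub_self hj]
      simp only [ρ]; ring
  have hanti : ∀ i ∈ Finset.range (y + 1), ∀ j ∈ Finset.range (y + 1),
      (ρ i - ρ j) * (φ i - φ j) ≤ 0 := by
    intro i hi j hj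
    have key : ∀ i ≤ y, ∀ j ≤ y, min i (y - i) < min j (y - j) → (ρ i - ρ j) * (φ i - φ j) ≤ 0 := by
      intro i hi j hj hlt
      refine mul_nonpos_of_nonneg_of_nonpos ?_ (sub_nonpos.2 (hmono i hi j hj hlt))
      rw [hρ i hi, hρ j hj, ← mul_sub]
      refine mul_nonneg (by positivity) (sub_nonneg.2 ?_)
      exact symm_pow_sum_antitone _ _ hp0 hq0 y _ _ hlt.le (by omega)
    rcases lt_trichotomy (min i (y - i)) (min j (y - j)) with h | h | h
    · exact key i (hmem hi) j (hmem hj) h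
    · rw [hρ i (hmem hi), hρ j (hmem hj), h]; simp
    · have := key j (hmem hj) i (hmem hi) h
      linarith
  have hrefl : ∀ f : ℕ → ℝ, ∑ j ∈ Finset.range (y + 1), f (y - j) =
      ∑ j ∈ Finset.range (y + 1), f j := fun f => by
    simpa using Finset.sum_range_reflect f (y + 1)
  have hwρ : ∀ f : ℕ → ℝ, (∀ j ≤ y, f (y - j) = f j) →
      ∑ j ∈ Finset.range (y + 1), (binomial y half).real {j} * ρ j * f j =
        ∑ j ∈ Finset.range (y + 1), (binomial y θ).real {j} * f j := by
    intro f hf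
    have e1 : ∑ j ∈ Finset.range (y + 1), (binomial y (unitInterval.symm θ)).real {j} * f j =
        ∑ j ∈ Finset.range (y + 1), (binomial y θ).real {j} * f j := by
      rw [← hrefl (fun j => (binomial y θ).real {j} * f j)]
      refine Finset.sum_congr rfl fun j hj => ?_
      rw [binomial_real_reflect y j θ (hmem hj), hf j (hmem hj)]
    have e2 : ∑ j ∈ Finset.range (y + 1), (binomial y half).real {j} * ρ j * f j =
        (∑ j ∈ Finset.range (y + 1), (binomial y θ).real {j} * f j +
          ∑ j ∈ Finset.range (y + 1), (binomial y (unitInterval.symm θ)).real {j} * f j) / 2 := by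
      rw [← Finset.sum_add_distrib, Finset.sum_div]
      refine Finset.sum_congr rfl fun j hj => ?_
      rw [binomial_half_real y j (hmem hj), binomial_real_singleton, binomial_real_singleton,
        unitInterval.coe_symm_eq]
      simp only [ρ, ← hq]
      have : (2 : ℝ) ^ y ≠ 0 := by positivity
      rw [show (1 : ℝ) - q = θ by rw [hq]; ring]
      field_simp
    rw [e2, e1]; ring
  have hmain := sum_mul_mul_le_of_antivary (Finset.range (y + 1))
    (fun j => (binomial y half).real {j}) ρ φ (fun _ _ => measureReal_nonneg) hanti
  have hone : ∑ j ∈ Finset.range (y + 1), (binomial y half).real {j} * ρ j = 1 := by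
    have := hwρ (fun _ => 1) fun _ _ => rfl
    simpa only [mul_one, sum_binomial_real] using this
  rw [sum_binomial_real, one_mul, hone, one_mul, hwρ φ hsymm] at hmain
  exact hmain

/-- In a symmetric window the p-value is stochastically smallest under the null hypothesis. -/
theorem lintegral_pValueLaw_half_le (a b : ℝ≥0) (hab : 0 < a + b) (ψ : ℝ → ℝ)
    (hψ : Measurable ψ) (M : ℝ) (hM : ∀ p ∈ Set.Ioc (0 : ℝ) 1, ψ p ≤ M)
    (hmono : MonotoneOn ψ (Set.Ioc 0 1)) :
    ∫⁻ p, ENNReal.ofReal (ψ p) ∂(pValueLaw half a b) ≤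
      ∫⁻ p in Set.Ioc (0 : ℝ) 1, ENNReal.ofReal (ψ p) := by
  have hab' : (0 : ℝ) < a + b := by exact_mod_cast hab
  set θ : I := ⟨a / (a + b), by positivity, by
    rw [div_le_one hab']; linarith [b.coe_nonneg]⟩ with hθ
  have hθe : (θ : ℝ) * (a + b) = a := by
    simp only [hθ]; field_simp
  set Φ : ℕ → ℕ → ℝ≥0∞ := fun y j =>
    ∫⁻ ξ : I, ENNReal.ofReal (ψ (testPValue half (j, y - j) ξ)) with hΦ
  have hmem : ∀ k : ℕ × ℕ, ∀ᵐ ξ : I, testPValue half k ξ ∈ Set.Ioc (0 : ℝ) 1 := fun k => by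
    filter_upwards [ae_unitInterval_mem_Ioo] with ξ hξ
    exact ⟨testPValue_pos half (by norm_num) (by norm_num) k ξ hξ.1 hξ.2,
      testPValue_le_one _ _ _⟩
  have hfin : ∀ y j, Φ y j ≠ ∞ := fun y j => by
    refine ((lintegral_mono_ae (g := fun _ => ENNReal.ofReal M) ?_).trans_lt ?_).ne
    · filter_upwards [hmem (j, y - j)] with ξ hξ
      exact ENNReal.ofReal_le_ofReal (hM _ hξ)
    · simp
  have hstep : ∀ y (θ' : I), ∑ j ∈ Finset.range (y + 1),
      ENNReal.ofReal ((binomial y θ').real {j}) * Φ y j =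
      ENNReal.ofReal (∑ j ∈ Finset.range (y + 1),
        (binomial y θ').real {j} * (Φ y j).toReal) := fun y θ' => by
    rw [ENNReal.ofReal_sum_of_nonneg fun j _ => by positivity]
    refine Finset.sum_congr rfl fun j _ => ?_
    rw [ENNReal.ofReal_mul measureReal_nonneg, ENNReal.ofReal_toReal (hfin y j)]
  rw [lintegral_pValueLaw half θ a b hθe hψ.ennreal_ofReal]
  have hle : ∀ y, ∑ j ∈ Finset.range (y + 1),
      ENNReal.ofReal ((binomial y θ).real {j}) * Φ y j ≤
        ∫⁻ p in Set.Ioc (0 : ℝ) 1, ENNReal.ofReal (ψ p) := fun y => by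
    rw [← sum_lintegral_testPValue half (fun p => ENNReal.ofReal (ψ p)) y]
    change _ ≤ ∑ j ∈ Finset.range (y + 1), ENNReal.ofReal ((binomial y half).real {j}) * Φ y j
    rw [hstep, hstep]
    refine ENNReal.ofReal_le_ofReal (sum_binomial_mul_le_half y θ _ ?_ ?_)
    · intro j hj
      congr 1
      simp only [hΦ]
      rw [← unitInterval.measurePreserving_symm.lintegral_comp
        (f := fun ξ => ENNReal.ofReal (ψ (testPValue half (y - j, y - (y - j)) ξ)))
        (hψ.comp (continuous_testPValue half _).measurable).ennreal_ofReal]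
      refine lintegral_congr fun ξ => ?_
      rw [Nat.sub_sub_self hj]
      rw [testPValue_half_swap]
    · intro i hi j hj hij
      refine ENNReal.toReal_mono (hfin y j) (lintegral_mono_ae ?_)
      filter_upwards [hmem (i, y - i), hmem (j, y - j)] with ξ h1 h2
      refine ENNReal.ofReal_le_ofReal (hmono h1 h2 ?_)
      -- The upper bracket at `i` is the lower bracket with m = min(i, y - i) + 1, which is
      -- admissible at `j` because its minimum is strictly larger.
      refine (testPValue_half_le _ _ _).trans (le_trans ?_
        (le_testPValue_half j (y - j) (min i (y - i) + 1) (by omega) (by omega) ξ))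
      rw [Nat.add_sub_cancel' hi, Nat.add_sub_cancel' hj]
  calc _ ≤ ∑' y, poissonMeasure (a + b) {y} *
        ∫⁻ p in Set.Ioc (0 : ℝ) 1, ENNReal.ofReal (ψ p) :=
        ENNReal.tsum_le_tsum fun y => mul_le_mul_right (hle y) _
    _ = _ := by rw [ENNReal.tsum_mul_right, tsum_poissonMeasure_singleton, one_mul]

/-! ### Small p-values -/

/-- Chernoff's bound: the indicator of i ≤ A is at most z^(A - i), and the binomial theorem
evaluates the resulting sum. -/
theorem sum_range_binomial_half_le (z : ℝ) (hz : 1 ≤ z) (A B : ℕ) :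
    ∑ i ∈ Finset.range (A + 1), (binomial (A + B) half).real {i} ≤
      ((1 + z) / 2) ^ A * ((1 + z) / (2 * z)) ^ B := by
  have hz0 : 0 < z := by linarith
  have h1 : ∑ i ∈ Finset.range (A + B + 1),
      (binomial (A + B) half).real {i} * (z ^ A * (1 / z) ^ i) =
      ((1 + z) / 2) ^ A * ((1 + z) / (2 * z)) ^ B := by
    have h2 := add_pow (1 / z) 1 (A + B)
    have h3 : ((1 + z) / 2) ^ A * ((1 + z) / (2 * z)) ^ B =
        z ^ A * (1 / z + 1) ^ (A + B) / 2 ^ (A + B) := by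
      rw [show 1 / z + 1 = (1 + z) / z by field_simp, div_pow, div_pow, div_pow, mul_pow]
      simp only [pow_add]
      field_simp
    rw [h3, h2, Finset.mul_sum, Finset.sum_div]
    refine Finset.sum_congr rfl fun i hi => ?_
    rw [binomial_half_real _ _ (by have := Finset.mem_range.1 hi; omega)]
    simp only [one_pow, mul_one]
    ring
  rw [← h1]
  refine le_trans ?_ (Finset.sum_le_sum_of_subset_of_nonneg
    (Finset.range_mono (show A + 1 ≤ A + B + 1 by omega)) fun i _ _ =>
      mul_nonneg measureReal_nonneg (by positivity))
  refine Finset.sum_le_sum fun i hi => le_mul_of_one_le_right measureReal_nonneg ?_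
  have hi' : i ≤ A := by have := Finset.mem_range.1 hi; omega
  rw [one_div, inv_pow, ← div_eq_mul_inv, one_le_div (by positivity)]
  exact pow_le_pow_right₀ hz hi'

theorem testPValue_half_le_pow (z : ℝ) (hz : 1 ≤ z) (A B : ℕ) (ξ : I) :
    testPValue half (A, B) ξ ≤ 2 * (((1 + z) / 2) ^ A * ((1 + z) / (2 * z)) ^ B) := by
  refine (testPValue_half_le A B ξ).trans (mul_le_mul_of_nonneg_left ?_ two_pos.le)
  exact (sum_range_binomial_mono _ _ (by omega)).trans (sum_range_binomial_half_le z hz A B)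

theorem lintegral_pow_poissonMeasure (a : ℝ≥0) (x : ℝ) (hx : 0 ≤ x) :
    ∫⁻ k, ENNReal.ofReal (x ^ k) ∂(poissonMeasure a) = ENNReal.ofReal (Real.exp (a * (x - 1))) := by
  have h1 : HasSum (fun k : ℕ => Real.exp (-a) * ((a * x) ^ k / k.factorial))
      (Real.exp (-a) * Real.exp (a * x)) := by
    refine HasSum.mul_left _ ?_
    have := NormedSpace.expSeries_div_hasSum_exp ((a : ℝ) * x)
    rwa [← Real.exp_eq_exp_ℝ] at this
  rw [lintegral_countable']
  have h2 : ∀ k, ENNReal.ofReal (x ^ k) * poissonMeasure a {k} =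
      ENNReal.ofReal (Real.exp (-a) * ((a * x) ^ k / k.factorial)) := fun k => by
    rw [poissonMeasure_singleton, ← ENNReal.ofReal_mul (by positivity)]
    congr 1
    rw [mul_pow]; ring
  simp_rw [h2]
  rw [← ENNReal.ofReal_tsum_of_nonneg (fun k => by positivity) h1.summable, h1.tsum_eq,
    ← Real.exp_add]
  congr 2; ring

/-- The Chernoff bound on the p-value increases with the first count and decreases with the second,
so it is at most its value at (A, B) on a quadrant, whose probability factors. -/
theorem pValueLaw_half_Iic_ge (a b : ℝ≥0) (z : ℝ) (hz : 1 ≤ z) (A B : ℕ) :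
    poissonMeasure a (Set.Iic A) * poissonMeasure b (Set.Ici B) ≤
      pValueLaw half a b (Set.Iic (2 * (((1 + z) / 2) ^ A * ((1 + z) / (2 * z)) ^ B))) := by
  rw [pValueLaw, Measure.map_apply (measurable_testPValue half) measurableSet_Iic,
    ← Measure.prod_prod]
  have h : ((poissonMeasure a).prod (poissonMeasure b)) (Set.Iic A ×ˢ Set.Ici B) =
      (((poissonMeasure a).prod (poissonMeasure b)).prod (volume : Measure I))
        ((Set.Iic A ×ˢ Set.Ici B) ×ˢ Set.univ) := by
    rw [Measure.prod_prod (Set.Iic A ×ˢ Set.Ici B), measure_univ, mul_one]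
  rw [h]
  refine measure_mono ?_
  rintro ⟨⟨i, j⟩, ξ⟩ ⟨⟨hi, hj⟩, -⟩
  simp only [Set.mem_Iic, Set.mem_Ici, Set.mem_preimage] at *
  refine (testPValue_half_le_pow z hz i j ξ).trans (mul_le_mul_of_nonneg_left ?_ two_pos.le)
  refine mul_le_mul (pow_le_pow_right₀ (by linarith) hi) ?_ (by positivity) (by positivity)
  refine pow_le_pow_of_le_one (by positivity) ?_ hj
  rw [div_le_one (by linarith)]
  linarith

/-- This form shows I_r as the exponent of the bound in `testPValue_half_le_pow` with z = r, for
counts in the proportion 1 : r. -/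
theorem largeDev_eq (r : ℝ) :
    largeDev r = -Real.log ((1 + r) / 2) - r * Real.log ((1 + r) / (2 * r)) := by
  have h1 : 2 * r / (r + 1) = ((1 + r) / (2 * r))⁻¹ := by rw [inv_div, add_comm]
  have h2 : 2 / (r + 1) = ((1 + r) / 2)⁻¹ := by rw [inv_div, add_comm]
  rw [largeDev, h1, h2, Real.log_inv, Real.log_inv]
  ring

/-- Under a sufficiently large change the p-value is exponentially small, except with exponentially
small probability. -/
theorem exists_pValueLaw_half_Ioi_le {r r' : ℝ} (hr : 1 < r) (hr' : r < r') :
    ∃ κ > 0, ∀ a b : ℝ≥0, r' * a ≤ b →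
      pValueLaw half a b (Set.Ioi (2 * Real.exp (-(a * largeDev r)))) ≤
        ENNReal.ofReal (Real.exp (-(κ * a))) := by
  have hr0 : 0 < r := by linarith
  set u : ℝ := (1 + r) / 2 with hu
  set v : ℝ := (1 + r) / (2 * r) with hv
  have hu0 : 0 < u := by positivity
  have hv0 : 0 < v := by positivity
  have hv1 : v < 1 := by rw [hv, div_lt_one (by linarith)]; linarith
  -- Logarithm, per unit of `a`, of the Markov bound for the s-th power of u^A v^B when b = r' a. It
  -- vanishes at 0 with derivative (r' - r) log v < 0, so some small s > 0 makes it negative.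
  set Ψ : ℝ → ℝ := fun s => s * largeDev r + (u ^ s - 1) + r' * (v ^ s - 1) with hΨ
  have hder : HasDerivAt Ψ (largeDev r + Real.log u + r' * Real.log v) 0 := by
    have h1 := ((hasDerivAt_id (0 : ℝ)).mul_const (largeDev r))
    have h2 := (hasDerivAt_id (0 : ℝ)).const_rpow hu0
    have h3 := (hasDerivAt_id (0 : ℝ)).const_rpow hv0
    have := (h1.add (h2.sub_const 1)).add ((h3.sub_const 1).const_mul r')
    refine HasDerivAt.congr_deriv (f := Ψ) this ?_
    simp
  have hneg : largeDev r + Real.log u + r' * Real.log v < 0 := by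
    rw [largeDev_eq r, ← hu, ← hv]
    have := Real.log_neg hv0 hv1
    nlinarith
  have hΨ0 : Ψ 0 = 0 := by simp [hΨ]
  obtain ⟨s, hs0, hs⟩ : ∃ s > 0, Ψ s < 0 := by
    have h1 := hder.hasDerivWithinAt (s := Set.Ioi 0)
    have h2 := (hasDerivWithinAt_iff_tendsto_slope' (by simp)).1 h1
    have h3 := (h2.eventually (eventually_lt_nhds hneg)).and self_mem_nhdsWithin
    obtain ⟨s, h4, h5⟩ := h3.exists
    refine ⟨s, h5, ?_⟩
    rw [slope_def_field, hΨ0, sub_zero, sub_zero] at h4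
    have h5' : 0 < s := h5
    by_contra hcon
    exact absurd h4 (not_lt.2 (div_nonneg (not_lt.1 hcon) h5'.le))
  refine ⟨-Ψ s, by linarith, fun a b hab => ?_⟩
  set m : (ℕ × ℕ) → ℝ≥0∞ := fun k => ENNReal.ofReal ((u ^ s) ^ k.1) * ENNReal.ofReal ((v ^ s) ^ k.2)
    with hm
  set t : ℝ := Real.exp (-(a * largeDev r)) with ht
  have hts : 0 < t ^ s := Real.rpow_pos_of_pos (Real.exp_pos _) _
  rw [pValueLaw, Measure.map_apply (measurable_testPValue half) measurableSet_Ioi]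
  have hsub : (fun z : (ℕ × ℕ) × I => testPValue half z.1 z.2) ⁻¹' Set.Ioi (2 * t) ⊆
      {k | ENNReal.ofReal (t ^ s) ≤ m k} ×ˢ Set.univ := by
    rintro ⟨⟨A, B⟩, ξ⟩ h
    refine ⟨?_, trivial⟩
    simp only [Set.mem_preimage, Set.mem_Ioi] at h
    have h1 := h.trans_le (testPValue_half_le_pow r hr.le A B ξ)
    have h2 : t ≤ u ^ A * v ^ B := by linarith
    simp only [hm, Set.mem_ofPred_eq]
    rw [← ENNReal.ofReal_mul (by positivity)]
    refine ENNReal.ofReal_le_ofReal ?_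
    have h3 := Real.rpow_le_rpow (Real.exp_pos _).le h2 hs0.le
    rwa [Real.mul_rpow (by positivity) (by positivity), ← Real.rpow_natCast, ← Real.rpow_natCast,
      ← Real.rpow_mul hu0.le, ← Real.rpow_mul hv0.le, mul_comm (A : ℝ), mul_comm (B : ℝ),
      Real.rpow_mul hu0.le, Real.rpow_mul hv0.le, Real.rpow_natCast, Real.rpow_natCast] at h3
  refine (measure_mono hsub).trans ?_
  rw [Measure.prod_prod, measure_univ, mul_one]
  have hmarkov := mul_meas_ge_le_lintegral (μ := (poissonMeasure a).prod (poissonMeasure b))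
    (f := m) (measurable_of_countable _) (ENNReal.ofReal (t ^ s))
  have hint : ∫⁻ k, m k ∂((poissonMeasure a).prod (poissonMeasure b)) =
      ENNReal.ofReal (Real.exp (a * (u ^ s - 1)) * Real.exp (b * (v ^ s - 1))) := by
    rw [lintegral_prod_mul (f := fun k : ℕ => ENNReal.ofReal ((u ^ s) ^ k))
      (g := fun k : ℕ => ENNReal.ofReal ((v ^ s) ^ k)) (measurable_of_countable _).aemeasurable
      (measurable_of_countable _).aemeasurable, lintegral_pow_poissonMeasure _ _ (by positivity),
      lintegral_pow_poissonMeasure _ _ (by positivity), ENNReal.ofReal_mul (by positivity)]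
  rw [hint] at hmarkov
  rw [← ENNReal.mul_le_mul_iff_right (a := ENNReal.ofReal (t ^ s)) (by simpa using hts) (by simp)]
  refine hmarkov.trans ?_
  rw [← ENNReal.ofReal_mul hts.le]
  refine ENNReal.ofReal_le_ofReal ?_
  rw [ht, ← Real.exp_mul, ← Real.exp_add, ← Real.exp_add, Real.exp_le_exp]
  -- Since v^s ≤ 1, a second mean larger than r' a only improves the bound.
  have hvs : v ^ s ≤ 1 := Real.rpow_le_one hv0.le hv1.le hs0.le
  have : (b : ℝ) * (v ^ s - 1) ≤ r' * a * (v ^ s - 1) :=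
    mul_le_mul_of_nonpos_right hab (by linarith)
  simp only [hΨ]
  linarith

/-! ### Integrals of the likelihood ratio -/

noncomputable section

/-- The likelihood ratio whose logarithm is the score. -/
def likRatio (α β p : ℝ) : ℝ := 1 + α * f₁ p + β * f₂ p

end

/-- For a non-negative derivative, continuity of the antiderivative up to the endpoints already
gives integrability, so singularities at 0 need no estimate. -/
theorem integral_Ioc_zero_one_of_hasDerivAt {F F' : ℝ → ℝ} (hcont : ContinuousOn F (Set.Icc 0 1))
    (hd : ∀ x ∈ Set.Ioo (0 : ℝ) 1, HasDerivAt F (F' x) x)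
    (hpos : ∀ x ∈ Set.Ioo (0 : ℝ) 1, 0 ≤ F' x) :
    IntegrableOn F' (Set.Ioc 0 1) ∧ ∫ x in Set.Ioc 0 1, F' x = F 1 - F 0 := by
  have h1 := intervalIntegral.integrableOn_deriv_of_nonneg hcont hd hpos
  refine ⟨h1, ?_⟩
  rw [← intervalIntegral.integral_of_le zero_le_one]
  exact intervalIntegral.integral_eq_sub_of_hasDerivAt_of_le zero_le_one hcont hd
    ((intervalIntegrable_iff_integrableOn_Ioc_of_le zero_le_one).2 h1)

theorem integral_inv_mul_sq_two_sub_log :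
    IntegrableOn (fun p => 1 / (p * (2 - Real.log p) ^ 2)) (Set.Ioc 0 1) ∧
      ∫ p in Set.Ioc 0 1, 1 / (p * (2 - Real.log p) ^ 2) = 1 / 2 := by
  have hne : ∀ p ∈ Set.Ioc (0 : ℝ) 1, 0 < 2 - Real.log p := fun p hp => by
    linarith [Real.log_nonpos hp.1.le hp.2]
  -- The limit at 0 is 0, whereas the formula itself would give 1/2 there because `Real.log 0 = 0`.
  set F : ℝ → ℝ := Function.update (fun p => (2 - Real.log p)⁻¹) 0 0 with hF
  have hev : ∀ x : ℝ, x ≠ 0 → F =ᶠ[𝓝 x] fun p => (2 - Real.log p)⁻¹ := fun x hx => by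
    filter_upwards [isOpen_ne.mem_nhds hx] with p hp
    exact Function.update_of_ne hp _ _
  have hd : ∀ x ∈ Set.Ioc (0 : ℝ) 1, HasDerivAt F (1 / (x * (2 - Real.log x) ^ 2)) x := by
    intro x hx
    refine HasDerivAt.congr_of_eventuallyEq ?_ (hev x hx.1.ne')
    have h1 := ((Real.hasDerivAt_log hx.1.ne').const_sub 2).inv (hne x hx).ne'
    refine h1.congr_deriv ?_
    have := hx.1.ne'
    have := (hne x hx).ne'
    field_simp
  have hcont : ContinuousOn F (Set.Icc 0 1) := by
    intro x hx
    rcases hx.1.eq_or_lt with rfl | h0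
    · rw [hF, continuousWithinAt_update_same]
      have h1 : Tendsto (fun p => 2 - Real.log p) (𝓝[>] 0) atTop := by
        have := Real.tendsto_log_nhdsGT_zero
        exact tendsto_atTop_add_const_left _ 2 (tendsto_neg_atBot_atTop.comp this)
      refine (tendsto_inv_atTop_zero.comp h1).mono_left (nhdsWithin_mono _ ?_)
      rintro p ⟨hp, hp0⟩
      exact lt_of_le_of_ne hp.1 (Ne.symm hp0)
    · exact (hd x ⟨h0, hx.2⟩).continuousAt.continuousWithinAt
  have h := integral_Ioc_zero_one_of_hasDerivAt hcont
    (fun x hx => hd x ⟨hx.1, hx.2.le⟩) (fun x hx => by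
      have := hx.1
      positivity)
  refine ⟨h.1, h.2.trans ?_⟩
  simp [hF]

theorem integral_inv_sqrt :
    IntegrableOn (fun p => 1 / √p) (Set.Ioc 0 1) ∧ ∫ p in Set.Ioc 0 1, 1 / √p = 2 := by
  have h := integral_Ioc_zero_one_of_hasDerivAt (F := fun p => 2 * √p) (F' := fun p => 1 / √p)
    (by fun_prop) (fun x hx => by
      refine ((Real.hasDerivAt_sqrt hx.1.ne').const_mul 2).congr_deriv ?_
      have := (Real.sqrt_pos.2 hx.1).ne'
      field_simp) (fun x hx => by positivity)
  simpa using h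

/-- This integral is the second-order term in `inv_likRatio_le`: β√p truncates the non-integrable
1/p at the price of a factor log(1/β). -/
theorem integral_inv_add_mul_sqrt {β : ℝ} (hβ : 0 < β) :
    IntegrableOn (fun p => 1 / (p + β * √p)) (Set.Ioc 0 1) ∧
      ∫ p in Set.Ioc 0 1, 1 / (p + β * √p) = 2 * Real.log ((1 + β) / β) := by
  have hpos : ∀ x : ℝ, √x + β ≠ 0 := fun x => by positivity
  have h := integral_Ioc_zero_one_of_hasDerivAt (F := fun p => 2 * Real.log (√p + β))
    (F' := fun p => 1 / (p + β * √p))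
    (ContinuousOn.mul continuousOn_const
      (ContinuousOn.log (by fun_prop) fun x _ => hpos x)) (fun x hx => by
      refine ((((Real.hasDerivAt_sqrt hx.1.ne').add_const β).log (hpos x)).const_mul 2).congr_deriv
        ?_
      have h0 := Real.sqrt_pos.2 hx.1
      have h1 : x = √x * √x := (Real.mul_self_sqrt hx.1.le).symm
      have h2 : x + β * √x = √x * (√x + β) := by nlinarith
      rw [h2]
      field_simp) (fun x hx => by
      have := hx.1
      positivity)
  refine ⟨h.1, h.2.trans ?_⟩
  rw [Real.sqrt_one, Real.sqrt_zero, zero_add, Real.log_div (by positivity) hβ.ne']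
  ring

/-- f₁ and f₂ are centred under the uniform law, so the score behaves like a log-likelihood ratio.
-/
theorem integral_likRatio (α β : ℝ) :
    IntegrableOn (likRatio α β) (Set.Ioc 0 1) ∧ ∫ p in Set.Ioc 0 1, likRatio α β p = 1 := by
  obtain ⟨h1, h2⟩ := integral_inv_mul_sq_two_sub_log
  obtain ⟨h3, h4⟩ := integral_inv_sqrt
  have hc : ∀ a : ℝ, IntegrableOn (fun _ : ℝ => a) (Set.Ioc (0 : ℝ) 1) := fun a =>
    integrableOn_const (by simp)
  have h5 : IntegrableOn (fun p => α * f₁ p) (Set.Ioc 0 1) := (h1.sub (hc (1 / 2))).const_mul α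
  have h6 : IntegrableOn (fun p => β * f₂ p) (Set.Ioc 0 1) := (h3.sub (hc 2)).const_mul β
  refine ⟨((hc 1).add h5).add h6, ?_⟩
  have e : likRatio α β = fun p => 1 + α * f₁ p + β * f₂ p := rfl
  have h7 : IntegrableOn (fun p => 1 + α * f₁ p) (Set.Ioc 0 1) := (hc 1).add h5
  simp only [e]
  rw [integral_add h7 h6, integral_add (hc 1) h5, integral_const_mul, integral_const_mul]
  have e1 : ∫ p in Set.Ioc (0 : ℝ) 1, f₁ p = 0 := by
    have : (fun p => f₁ p) = fun p => 1 / (p * (2 - Real.log p) ^ 2) - 1 / 2 := rfl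
    rw [this, integral_sub h1 (hc _), h2]
    simp
  have e2 : ∫ p in Set.Ioc (0 : ℝ) 1, f₂ p = 0 := by
    have : (fun p => f₂ p) = fun p => 1 / √p - 2 := rfl
    rw [this, integral_sub h3 (hc _), h4]
    simp
  rw [e1, e2]
  simp

theorem measurable_likRatio (α β : ℝ) : Measurable (likRatio α β) := by
  unfold likRatio f₁ f₂
  fun_prop

/-! ### Pointwise bounds and inverse moments of the likelihood ratio. -/

/-- A lower bound of the likelihood ratio which keeps the part of `f₂`. -/
theorem le_likRatio {α β p : ℝ} (hα : 0 ≤ α) (hp : 0 < p) :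
    1 - α / 2 - 2 * β + β / √p ≤ likRatio α β p := by
  have h : 0 ≤ α * (1 / (p * (2 - Real.log p) ^ 2)) := by positivity
  rw [likRatio, f₁, f₂, show β * (1 / √p - 2) = β / √p - 2 * β by ring]
  linarith

/-- A lower bound of the likelihood ratio which keeps the part of `f₁`. -/
theorem le_likRatio' {α β p : ℝ} (hβ : 0 ≤ β) :
    1 - α / 2 - 2 * β + α / (p * (2 - Real.log p) ^ 2) ≤ likRatio α β p := by
  have h : 0 ≤ β * (1 / √p) := by positivity
  rw [likRatio, f₁, f₂, show α * (1 / (p * (2 - Real.log p) ^ 2) - 1 / 2) =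
    α / (p * (2 - Real.log p) ^ 2) - α / 2 by ring]
  linarith

theorem half_le_likRatio {α β p : ℝ} (hα : 0 ≤ α) (hα' : α ≤ 1 / 10) (hβ : 0 ≤ β)
    (hβ' : β ≤ 1 / 10) (hp : 0 < p) : 1 / 2 ≤ likRatio α β p := by
  have h1 := le_likRatio (β := β) hα hp
  have h2 : 0 ≤ β / √p := by positivity
  linarith

/-- With a = 2 - log q ≥ 2 and t = log(q/p), the claim is a + t ≤ a exp(t/2). The constant 2 in the
definition of f₁ is what makes this hold up to q = 1. -/
theorem mul_sq_two_sub_log_le {p q : ℝ} (hp : 0 < p) (hpq : p ≤ q) (hq : q ≤ 1) :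
    p * (2 - Real.log p) ^ 2 ≤ q * (2 - Real.log q) ^ 2 := by
  have hq0 : 0 < q := hp.trans_le hpq
  set a := 2 - Real.log q with ha
  set t := Real.log q - Real.log p with ht
  have ha2 : 2 ≤ a := by linarith [Real.log_nonpos hq0.le hq]
  have ht0 : 0 ≤ t := by linarith [Real.log_le_log hp hpq]
  have h1 : 2 - Real.log p = a + t := by rw [ha, ht]; ring
  have h2 : a + t ≤ a * Real.exp (t / 2) := by
    have := Real.add_one_le_exp (t / 2)
    nlinarith
  have h3 : Real.exp (t / 2) ^ 2 = q / p := by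
    rw [← Real.exp_nat_mul, show ((2 : ℕ) : ℝ) * (t / 2) = t by push_cast; ring, ht, Real.exp_sub,
      Real.exp_log hq0, Real.exp_log hp]
  rw [h1]
  calc p * (a + t) ^ 2 ≤ p * (a * Real.exp (t / 2)) ^ 2 := by gcongr
    _ = q * a ^ 2 := by rw [mul_pow, h3]; field_simp

theorem antitoneOn_likRatio {α β : ℝ} (hα : 0 ≤ α) (hβ : 0 ≤ β) :
    AntitoneOn (likRatio α β) (Set.Ioc 0 1) := by
  intro p hp q hq hpq
  have h1 : f₁ q ≤ f₁ p := by
    have h := mul_sq_two_sub_log_le hp.1 hpq hq.2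
    have h0 : 0 < p * (2 - Real.log p) ^ 2 := by
      have : 0 < 2 - Real.log p := by linarith [Real.log_nonpos hp.1.le hp.2]
      have := hp.1
      positivity
    exact sub_le_sub_right (one_div_le_one_div_of_le h0 h) _
  have h2 : f₂ q ≤ f₂ p :=
    sub_le_sub_right (one_div_le_one_div_of_le (Real.sqrt_pos.2 hp.1) (Real.sqrt_le_sqrt hpq)) _
  have h3 := mul_le_mul_of_nonneg_left h1 hα
  have h4 := mul_le_mul_of_nonneg_left h2 hβ
  simp only [likRatio]
  linarith

/-- Since f₁ ≥ -1/2, discarding its positive part costs at most α. What remains is 1/(1 + y) = 1 - y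
+ y²/(1 + y) with y = β f₂: the linear term is centred, and with q = p^(-1/2) the bounds y² ≤ β²q²
and 1 + βq ≤ 2(1 + y) give an integrable quadratic term. -/
theorem inv_likRatio_le {α β p : ℝ} (hα : 0 ≤ α) (hα' : α ≤ 1 / 10) (hβ : 0 < β)
    (hβ' : β ≤ 1 / 10) (hp : p ∈ Set.Ioc (0 : ℝ) 1) :
    (likRatio α β p)⁻¹ ≤ 1 + α - β * f₂ p + 2 * β ^ 2 * (1 / (p + β * √p)) := by
  set q : ℝ := 1 / √p with hq
  have hs : 0 < √p := Real.sqrt_pos.2 hp.1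
  have hq1 : 1 ≤ q := by
    rw [hq, le_div_iff₀ hs, one_mul]
    exact Real.sqrt_le_one.2 hp.2
  have hf2 : f₂ p = q - 2 := rfl
  have hL := le_likRatio (β := β) hα hp.1
  rw [show β / √p = β * q by rw [hq]; ring] at hL
  have hpq : 1 / (p + β * √p) = q ^ 2 / (1 + β * q) := by
    have h1 : p = √p * √p := (Real.mul_self_sqrt hp.1.le).symm
    have h2 : p + β * √p = √p * (√p + β) := by nlinarith
    rw [h2, hq]
    field_simp
  have hβq : 0 < β * q := by positivity
  set y := β * (q - 2) with hy
  have hy1 : 9 / 10 ≤ 1 + y := by nlinarith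
  have hstep1 : (likRatio α β p)⁻¹ ≤ (1 + y - α / 2)⁻¹ :=
    inv_anti₀ (by linarith) (by linarith)
  have hstep2 : (1 + y - α / 2)⁻¹ ≤ (1 + y)⁻¹ + α := by
    have hpos1 : 0 < 1 + y - α / 2 := by linarith
    have hpos2 : 0 < 1 + y := by linarith
    rw [inv_le_iff_one_le_mul₀ hpos1, add_mul, inv_mul_eq_div, sub_div, div_self hpos2.ne']
    have h3 : α / 2 / (1 + y) ≤ α * (5 / 9) := by
      rw [div_le_iff₀ hpos2]; nlinarith
    nlinarith
  have hstep3 : (1 + y)⁻¹ ≤ 1 - y + 2 * β ^ 2 * (q ^ 2 / (1 + β * q)) := by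
    have hpos2 : 0 < 1 + y := by linarith
    have h4 : (1 + y)⁻¹ = 1 - y + y ^ 2 / (1 + y) := by field_simp; ring
    have h5 : y ^ 2 / (1 + y) ≤ 2 * β ^ 2 * (q ^ 2 / (1 + β * q)) := by
      rw [← mul_div_assoc, div_le_div_iff₀ hpos2 (by linarith)]
      have h6 : y ^ 2 ≤ β ^ 2 * q ^ 2 := by
        rw [hy, mul_pow]
        have : (q - 2) ^ 2 ≤ q ^ 2 := by nlinarith
        exact mul_le_mul_of_nonneg_left this (by positivity)
      have h7 : 1 + β * q ≤ 2 * (1 + y) := by nlinarith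
      have h8 : 0 ≤ β ^ 2 * q ^ 2 := by positivity
      nlinarith [mul_le_mul h6 h7 (by linarith) h8]
    linarith
  rw [hf2, hpq]
  linarith

theorem lintegral_inv_likRatio_le {α β : ℝ} (hα : 0 ≤ α) (hα' : α ≤ 1 / 10) (hβ : 0 < β)
    (hβ' : β ≤ 1 / 10) :
    ∫⁻ p in Set.Ioc (0 : ℝ) 1, ENNReal.ofReal (likRatio α β p)⁻¹ ≤
      ENNReal.ofReal (1 + (α + 4 * β ^ 2 * Real.log ((1 + β) / β))) := by
  obtain ⟨h3, h4⟩ := integral_inv_sqrt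
  obtain ⟨h5, h6⟩ := integral_inv_add_mul_sqrt hβ
  have hc : ∀ a : ℝ, IntegrableOn (fun _ : ℝ => a) (Set.Ioc (0 : ℝ) 1) := fun a =>
    integrableOn_const (by simp)
  set g : ℝ → ℝ := fun p => 1 + α - β * f₂ p + 2 * β ^ 2 * (1 / (p + β * √p)) with hg
  have i1 : IntegrableOn (fun p => β * f₂ p) (Set.Ioc 0 1) := (h3.sub (hc 2)).const_mul β
  have i2 : IntegrableOn (fun p => 2 * β ^ 2 * (1 / (p + β * √p))) (Set.Ioc 0 1) :=
    h5.const_mul _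
  have hgi : IntegrableOn g (Set.Ioc 0 1) := ((hc (1 + α)).sub i1).add i2
  have hint : ∫ p in Set.Ioc 0 1, g p = 1 + (α + 4 * β ^ 2 * Real.log ((1 + β) / β)) := by
    have e2 : ∫ p in Set.Ioc (0 : ℝ) 1, f₂ p = 0 := by
      have : (fun p => f₂ p) = fun p => 1 / √p - 2 := rfl
      rw [this, integral_sub h3 (hc _), h4]
      simp
    have i3 : IntegrableOn (fun p => 1 + α - β * f₂ p) (Set.Ioc 0 1) := (hc (1 + α)).sub i1
    simp only [hg]
    rw [integral_add i3 i2, integral_sub (hc _) i1, integral_const_mul,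
      integral_const_mul, e2, h6]
    simp
    ring
  rw [← hint, ofReal_integral_eq_lintegral_ofReal hgi]
  · refine setLIntegral_mono_ae' measurableSet_Ioc (ae_of_all _ fun p hp => ?_)
    exact ENNReal.ofReal_le_ofReal (inv_likRatio_le hα hα' hβ hβ' hp)
  · refine (ae_restrict_iff' measurableSet_Ioc).2 (ae_of_all _ fun p hp => ?_)
    have h := half_le_likRatio hα hα' hβ.le hβ' hp.1
    exact (inv_nonneg.2 (by linarith)).trans (inv_likRatio_le hα hα' hβ hβ' hp)

/-- 1 / `likRatio` is increasing and bounded, so the stochastic comparison with the uniform law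
transfers the null bound to arbitrary means. -/
theorem lintegral_inv_likRatio_pValueLaw_le {α β : ℝ} (hα : 0 ≤ α) (hα' : α ≤ 1 / 10) (hβ : 0 < β)
    (hβ' : β ≤ 1 / 10) (a b : ℝ≥0) (hab : 0 < a + b) :
    ∫⁻ p, ENNReal.ofReal (likRatio α β p)⁻¹ ∂(pValueLaw half a b) ≤
      ENNReal.ofReal (Real.exp (α + 4 * β ^ 2 * Real.log ((1 + β) / β))) := by
  refine (lintegral_pValueLaw_half_le a b hab _ (measurable_likRatio α β).inv 2 ?_ ?_).trans
    ((lintegral_inv_likRatio_le hα hα' hβ hβ').trans (ENNReal.ofReal_le_ofReal ?_))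
  · intro p hp
    have h := half_le_likRatio hα hα' hβ.le hβ' hp.1
    exact (inv_anti₀ (by norm_num) h).trans (by norm_num)
  · intro p hp q hq hpq
    exact inv_anti₀ (by linarith [half_le_likRatio hα hα' hβ.le hβ' hq.1])
      (antitoneOn_likRatio hα hβ.le hp hq hpq)
  · rw [add_comm]; exact Real.add_one_le_exp _

/-- The gain in the exponential moment when small p-values are likely. -/
theorem lintegral_inv_likRatio_le_of_small {α β : ℝ} (hα : 0 ≤ α) (hα' : α ≤ 1 / 10) (hβ : 0 < β)
    (hβ' : β ≤ 1 / 10) (P : Measure ℝ) [IsProbabilityMeasure P]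
    (hP : ∀ᵐ p ∂P, p ∈ Set.Ioc (0 : ℝ) 1) {p₀ q : ℝ} (hp₀ : 0 < p₀)
    (hq : q ≤ P.real (Set.Iic p₀)) :
    ∫⁻ p, ENNReal.ofReal (likRatio α β p)⁻¹ ∂P ≤
      ENNReal.ofReal (Real.exp (α + 4 * β - q * min 1 (β / √p₀) / 2)) := by
  set w := min 1 (β / √p₀) with hw
  have hw0 : 0 ≤ w := le_min zero_le_one (by positivity)
  have hw1 : w ≤ 1 := min_le_left _ _
  set D := 1 - α / 2 - 2 * β with hD
  have hD0 : 3 / 4 ≤ D := by linarith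
  -- For p ≤ p₀ the f₂ part raises the likelihood ratio to at least D(1 + w), and 1/(1 + w) ≤ 1 -
  -- w/2 because w ≤ 1. Elsewhere D is a lower bound.
  set g : ℝ → ℝ := fun p => D⁻¹ * (1 - (Set.Iic p₀).indicator (fun _ => w / 2) p) with hg
  have hind : Integrable ((Set.Iic p₀).indicator (fun _ => w / 2)) P :=
    (integrable_const _).indicator measurableSet_Iic
  have hgi : Integrable g P := ((integrable_const _).sub hind).const_mul _
  have hle : ∀ p ∈ Set.Ioc (0 : ℝ) 1, (likRatio α β p)⁻¹ ≤ g p := by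
    intro p hp
    have h1 := le_likRatio (β := β) hα hp.1
    have hs : 0 < √p := Real.sqrt_pos.2 hp.1
    have hb : 0 ≤ β / √p := by positivity
    simp only [hg]
    by_cases h : p ∈ Set.Iic p₀
    · rw [Set.indicator_of_mem h]
      have h2 : w ≤ β / √p := (min_le_right _ _).trans
        (div_le_div_of_nonneg_left hβ.le hs (Real.sqrt_le_sqrt h))
      have h3 : D * (1 + w) ≤ likRatio α β p := by nlinarith
      refine (inv_anti₀ (by nlinarith) h3).trans ?_
      rw [mul_inv]
      refine mul_le_mul_of_nonneg_left ?_ (by positivity)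
      rw [inv_le_iff_one_le_mul₀ (by linarith)]
      nlinarith
    · rw [Set.indicator_of_notMem h, sub_zero, mul_one]
      exact inv_anti₀ (by linarith) (by linarith)
  have hint : ∫ p, g p ∂P = D⁻¹ * (1 - P.real (Set.Iic p₀) * (w / 2)) := by
    simp only [hg]
    rw [integral_const_mul, integral_sub (integrable_const _) hind,
      integral_indicator measurableSet_Iic]
    simp
  have hexp : D⁻¹ * (1 - P.real (Set.Iic p₀) * (w / 2)) ≤
      Real.exp (α + 4 * β - q * w / 2) := by
    rw [sub_eq_add_neg (α + 4 * β), Real.exp_add]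
    have hP1 : P.real (Set.Iic p₀) ≤ 1 := measureReal_le_one
    refine mul_le_mul ?_ ?_ ?_ (Real.exp_pos _).le
    · rw [inv_le_iff_one_le_mul₀ (by linarith)]
      have := Real.add_one_le_exp (α + 4 * β)
      nlinarith
    · have h1 := Real.add_one_le_exp (-(q * w / 2))
      nlinarith
    · nlinarith [measureReal_nonneg (μ := P) (s := Set.Iic p₀)]
  refine le_trans ?_ (ENNReal.ofReal_le_ofReal hexp)
  rw [← hint, ofReal_integral_eq_lintegral_ofReal hgi]
  · refine lintegral_mono_ae ?_
    filter_upwards [hP] with p hp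
    exact ENNReal.ofReal_le_ofReal (hle p hp)
  · filter_upwards [hP] with p hp
    refine le_trans (inv_nonneg.2 ?_) (hle p hp)
    linarith [half_le_likRatio hα hα' hβ.le hβ' hp.1]

/-- Chernoff's bound for a sum of functions of independent variables. -/
theorem measure_pi_le_sum_le {ι : Type*} [Fintype ι] (Q : ι → Measure ℝ)
    [∀ i, IsProbabilityMeasure (Q i)] (f : ℝ → ℝ) (hf : Measurable f) (e : ι → ℝ) (S : Finset ι)
    (h : ∀ i ∈ S, ∫⁻ p, ENNReal.ofReal (Real.exp (f p)) ∂(Q i) ≤ ENNReal.ofReal (Real.exp (e i)))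
    (y : ℝ) :
    Measure.pi Q {p | y ≤ ∑ i ∈ S, f (p i)} ≤
      ENNReal.ofReal (Real.exp (∑ i ∈ S, e i - y)) := by
  classical
  set g : ι → ℝ → ℝ≥0∞ := fun i p => if i ∈ S then ENNReal.ofReal (Real.exp (f p)) else 1 with hg
  have hgm : ∀ i, Measurable (g i) := fun i => by
    simp only [hg]
    split_ifs
    · exact (Real.measurable_exp.comp hf).ennreal_ofReal
    · exact measurable_const
  have hprod : ∀ p : ι → ℝ, ∏ i, g i (p i) =
      ENNReal.ofReal (Real.exp (∑ i ∈ S, f (p i))) := fun p => by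
    rw [Real.exp_sum, ENNReal.ofReal_prod_of_nonneg fun i _ => (Real.exp_pos _).le,
      Finset.prod_ite_mem, Finset.univ_inter]
  have hbound : ∫⁻ p, ∏ i, g i (p i) ∂(Measure.pi Q) ≤
      ENNReal.ofReal (Real.exp (∑ i ∈ S, e i)) := by
    rw [lintegral_pi_prod Q g hgm, Real.exp_sum,
      ENNReal.ofReal_prod_of_nonneg fun i _ => (Real.exp_pos _).le, ← Finset.univ_inter S,
      ← Finset.prod_ite_mem]
    refine Finset.prod_le_prod' fun i _ => ?_
    simp only [hg]
    split_ifs with hi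
    · exact h i hi
    · simp
  have hm : Measurable fun p : ι → ℝ => ∏ i, g i (p i) :=
    Finset.measurable_prod _ fun i _ => (hgm i).comp (measurable_pi_apply i)
  have hmarkov := mul_meas_ge_le_lintegral (μ := Measure.pi Q) hm (ENNReal.ofReal (Real.exp y))
  have hsub : {p : ι → ℝ | y ≤ ∑ i ∈ S, f (p i)} ⊆
      {p | ENNReal.ofReal (Real.exp y) ≤ ∏ i, g i (p i)} := fun p hp => by
    simp only [Set.mem_ofPred_eq] at *
    rw [hprod]
    exact ENNReal.ofReal_le_ofReal (Real.exp_le_exp.2 hp)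
  refine (measure_mono hsub).trans ?_
  rw [← ENNReal.mul_le_mul_iff_right (a := ENNReal.ofReal (Real.exp y))
    (by simpa using Real.exp_pos y) (by simp)]
  refine (hmarkov.trans hbound).trans ?_
  rw [← ENNReal.ofReal_mul (Real.exp_pos _).le, ← Real.exp_add]
  refine ENNReal.ofReal_le_ofReal (Real.exp_le_exp.2 ?_)
  linarith

/-! ### The algorithm -/

theorem argmax_mem {S : Finset ℕ} (hS : S.Nonempty) (f : ℕ → ℝ) : argmax S f ∈ S := by
  obtain ⟨k, hk, hmax⟩ := S.exists_max_image f hS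
  exact (Nat.sInf_mem (s := {k | k ∈ S ∧ ∀ l ∈ S, f l ≤ f k}) ⟨k, hk, hmax⟩).1

section Windows

variable {h d : ℕ → ℕ}

theorem le_window (hh : StrictMonoOn h (Set.Ici 1)) {i : ℕ} (hi : 1 ≤ i) (h1 : 1 ≤ h 1) :
    i ≤ h i := by
  induction i, hi using Nat.le_induction with
  | base => exact h1
  | succ n hn ih =>
    have := hh (Set.mem_Ici.2 hn) (Set.mem_Ici.2 (by omega)) (Nat.lt_add_one n)
    omega

/-- `le_window` bounds the admissible scales; without a bound the supremum of naturals would default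
to 0. -/
theorem le_maxScale (hh : StrictMonoOn h (Set.Ici 1)) (h1 : 1 ≤ h 1) {i g : ℕ} (hi : 1 ≤ i)
    (hg : h i + d i ≤ g) : i ≤ maxScale h d g := by
  refine le_csSup ⟨g, ?_⟩ ⟨hi, hg⟩
  rintro j ⟨hj, hjg⟩
  have := le_window hh hj h1
  omega

theorem window_spec {i k T : ℕ} (hdi : 1 ≤ d i) (hhi : 1 ≤ h i)
    (hk : k ∈ Finset.Icc 1 (numWindows d i T)) :
    winLeft h d i k < winMid d i k ∧ winMid d i k < winRight h d i k T ∧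
      winRight h d i k T ≤ T ∧ winMid d i k - winLeft h d i k ≤ h i ∧
      winRight h d i k T - winMid d i k ≤ h i := by
  obtain ⟨hk1, hk2⟩ := Finset.mem_Icc.1 hk
  have h1 : k * d i ≤ T - 1 := (Nat.le_div_iff_mul_le hdi).1 hk2
  have h2 : 1 ≤ k * d i := Nat.mul_pos hk1 hdi
  simp only [winLeft, winMid, winRight]
  omega

/-- If the first call reports nothing there are no further calls, and if it reports something the
set is non-empty. Only the windows of the full dataset matter. -/
theorem slDetect_nonempty_iff (hd : ∀ i, 1 ≤ i → 1 ≤ d i) (hh : ∀ i, 1 ≤ i → 1 ≤ h i)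
    (pl : ℕ → ℕ → ℕ → ℝ) (c : ℝ) (T : ℕ) :
    (slDetect h d pl c T).Nonempty ↔ ∃ i, 1 ≤ i ∧ i ≤ maxScale h d T ∧
      ∃ k ∈ Finset.Icc 1 (numWindows d i T),
        c ≤ pl (winLeft h d i k) (winMid d i k) (winRight h d i k T) := by
  classical
  have hfirst : (slDetect h d pl c T).Nonempty ↔ 0 < (slEstimate h d pl c 1 1 T).1 := by
    constructor
    · rintro ⟨τ, hτ, i₀, b, e, hcall, heq⟩
      by_contra h0
      have key : ∀ i₀ b e, Called (slEstimate h d pl c) T i₀ b e → i₀ = 1 ∧ b = 1 ∧ e = T := by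
        intro i₀ b e hc
        induction hc with
        | start => exact ⟨rfl, rfl, rfl⟩
        | left hc hpos ih =>
          obtain ⟨rfl, rfl, rfl⟩ := ih
          exact absurd hpos h0
        | right hc hpos ih =>
          obtain ⟨rfl, rfl, rfl⟩ := ih
          exact absurd hpos h0
      obtain ⟨rfl, rfl, rfl⟩ := key _ _ _ hcall
      omega
    · intro hpos
      exact ⟨_, hpos, 1, 1, T, Called.start, rfl⟩
  rw [hfirst]
  simp only [slEstimate, Nat.add_sub_cancel]
  split_ifs with H
  · refine iff_of_true ?_ H
    obtain ⟨hi, -, k, hk, -⟩ := Nat.find_spec H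
    -- The reported point lies in the open window (s, u), so it is positive and cannot be confused
    -- with the default output 0.
    refine Nat.pos_of_ne_zero fun h0 => ?_
    have hj := argmax_mem ⟨k, hk⟩
      (fun k => pl (winLeft h d (Nat.find H) k) (winMid d (Nat.find H) k)
        (winRight h d (Nat.find H) k T))
    have hw := window_spec (hd _ hi) (hh _ hi) hj
    have hmem := argmax_mem ⟨_, Finset.mem_Ioo.2 ⟨hw.1, hw.2.1⟩⟩ (fun t => pl
      (winLeft h d (Nat.find H) (argmax (Finset.Icc 1 (numWindows d (Nat.find H) T))
        (fun k => pl (winLeft h d (Nat.find H) k) (winMid d (Nat.find H) k)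
          (winRight h d (Nat.find H) k T)))) t
      (winRight h d (Nat.find H) (argmax (Finset.Icc 1 (numWindows d (Nat.find H) T))
        (fun k => pl (winLeft h d (Nat.find H) k) (winMid d (Nat.find H) k)
          (winRight h d (Nat.find H) k T))) T))
    have := (Finset.mem_Ioo.1 hmem).1
    omega
  · exact iff_of_false (lt_irrefl 0) H

end Windows

/-! ### Type I error -/

theorem measurable_score (lam1 lam2 : ℝ) (N : ℕ) : Measurable (score lam1 lam2 N) :=
  Real.measurable_log.comp
    (measurable_likRatio (lam1 * Real.log N / N) (lam2 / √(N * Real.log N)))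

theorem score_eq (lam1 lam2 : ℝ) (N : ℕ) (p : ℝ) : score lam1 lam2 N p =
    Real.log (likRatio (lam1 * Real.log N / N) (lam2 / √(N * Real.log N)) p) := rfl

theorem eq_of_forall_notMem_changePoints {N T : ℕ} (μ : Fin N → ℕ → ℝ≥0) (n : Fin N) {v w : ℕ}
    (hv : 1 ≤ v) (hvw : v ≤ w) (hw : w ≤ T) (h : ∀ t, v ≤ t → t < w → t ∉ changePoints T μ) :
    μ n v = μ n w := by
  induction w, hvw using Nat.le_induction with
  | base => rfl
  | succ w hvw ih =>
    rw [ih (by omega) fun t h1 h2 => h t h1 (by omega)]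
    by_contra hne
    exact h w hvw (Nat.lt_succ_self w) ⟨by omega, hw, n, hne⟩

theorem coe_successProb {s t u : ℕ} (hst : s < t) (htu : t < u) :
    ((successProb s t u : I) : ℝ) = ((t : ℝ) - s) / ((u : ℝ) - s) := by
  have h1 : (s : ℝ) < t := by exact_mod_cast hst
  have h2 : (t : ℝ) < u := by exact_mod_cast htu
  rw [successProb, Set.projIcc_of_mem]
  exact ⟨div_nonneg (by linarith) (by linarith), (div_le_one (by linarith)).2 (by linarith)⟩

/-- The exponential of the total score has mean one under the null, so Markov's inequality needs no
tilting parameter; the penalty enters as an extra factor. -/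
theorem penalizedScore_null_le {N T : ℕ} {lam1 lam2 : ℝ}
    (hα : 0 ≤ lam1 * Real.log N / N) (hα' : lam1 * Real.log N / N ≤ 1 / 10)
    (hβ : 0 ≤ lam2 / √(N * Real.log N)) (hβ' : lam2 / √(N * Real.log N) ≤ 1 / 10)
    (ν : Measure (Randomizers N))
    (hν : ∀ w, ν.map (fun ξ n => ξ n w) = Measure.pi fun _ : Fin N => (volume : Measure I))
    (μ : Fin N → ℕ → ℝ≥0) (hμ : changePoints T μ = ∅) (c : ℝ) {s t u : ℕ} (hst : s < t)
    (htu : t < u) (hu : u ≤ T) :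
    dataLaw N T ν μ
      {ω | c ≤ penalizedScore lam1 lam2 N T (fun n => pValue ω.1 ω.2 n s t u) s t u} ≤
      ENNReal.ofReal (Real.exp (-c - Real.log
        ((T : ℝ) / 4 * (1 / ((t : ℝ) - s) + 1 / ((u : ℝ) - t))))) := by
  set pen := Real.log ((T : ℝ) / 4 * (1 / ((t : ℝ) - s) + 1 / ((u : ℝ) - t))) with hpen
  have hmap := map_pValue_dataLaw ν μ (hν (s, t, u)) hst.le htu.le hu
  have hmeas : Measurable fun (ω : Data N T × Randomizers N) n => pValue ω.1 ω.2 n s t u :=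
    measurable_pi_lambda _ fun n => measurable_pValue n hst.le htu.le
  have hconst : ∀ n, ∀ v ∈ Set.Icc 1 T, μ n v = μ n T := fun n v hv =>
    eq_of_forall_notMem_changePoints μ n hv.1 hv.2 le_rfl fun t _ _ => by simp [hμ]
  have hsum : ∀ n x y, y ≤ T → ∑ v ∈ Finset.Ioc x y, μ n v = (y - x : ℕ) * μ n T := by
    intro n x y hy
    rw [Finset.sum_congr rfl fun v hv => hconst n v ⟨by
      have := Finset.mem_Ioc.1 hv; omega, by have := Finset.mem_Ioc.1 hv; omega⟩]
    simp
  have hsub : {ω : Data N T × Randomizers N |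
      c ≤ penalizedScore lam1 lam2 N T (fun n => pValue ω.1 ω.2 n s t u) s t u} ⊆
      (fun ω n => pValue ω.1 ω.2 n s t u) ⁻¹'
        {p | c + pen ≤ ∑ n, score lam1 lam2 N (p n)} := fun ω hω => by
    simp only [Set.mem_ofPred_eq, penalizedScore, Set.mem_preimage] at *
    linarith
  refine (measure_mono hsub).trans ((Measure.le_map_apply hmeas.aemeasurable _).trans ?_)
  rw [hmap]
  refine (measure_pi_le_sum_le _ (score lam1 lam2 N) (measurable_score _ _ _) (fun _ => 0)
    Finset.univ ?_ _).trans (ENNReal.ofReal_le_ofReal (Real.exp_le_exp.2 (by simp; linarith)))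
  intro n _
  rw [lintegral_pValueLaw_null (F := fun p => ENNReal.ofReal (Real.exp (score lam1 lam2 N p)))
    _ _ _ ?hθ (Real.measurable_exp.comp (measurable_score _ _ _)).ennreal_ofReal]
  case hθ =>
    have h1 : (s : ℝ) < t := by exact_mod_cast hst
    have h2 : (t : ℝ) < u := by exact_mod_cast htu
    rw [coe_successProb hst htu, hsum n s t (htu.le.trans hu), hsum n t u hu]
    simp only [NNReal.coe_mul, NNReal.coe_natCast]
    rw [Nat.cast_sub hst.le, Nat.cast_sub htu.le]
    have : (u : ℝ) - s ≠ 0 := by linarith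
    field_simp
    ring
  · obtain ⟨h1, h2⟩ := integral_likRatio (lam1 * Real.log N / N) (lam2 / √(N * Real.log N))
    have hpos : ∀ p ∈ Set.Ioc (0 : ℝ) 1,
        0 < likRatio (lam1 * Real.log N / N) (lam2 / √(N * Real.log N)) p := fun p hp =>
      lt_of_lt_of_le (by norm_num) (half_le_likRatio hα hα' hβ hβ' hp.1)
    rw [Real.exp_zero, ← congrArg ENNReal.ofReal h2, ofReal_integral_eq_lintegral_ofReal h1]
    · refine le_of_eq (setLIntegral_congr_fun measurableSet_Ioc fun p hp => ?_)
      rw [score_eq, Real.exp_log (hpos p hp)]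
    · exact (ae_restrict_iff' measurableSet_Ioc).2 (ae_of_all _ fun p hp => (hpos p hp).le)

/-- The penalty gives a window of half-length h_i a probability proportional to h_i / T, which
cancels the T in the number T / d_i of windows at its scale. -/
theorem typeI_error_le {N T : ℕ} {lam1 lam2 : ℝ}
    (hα : 0 ≤ lam1 * Real.log N / N) (hα' : lam1 * Real.log N / N ≤ 1 / 10)
    (hβ : 0 ≤ lam2 / √(N * Real.log N)) (hβ' : lam2 / √(N * Real.log N) ≤ 1 / 10)
    (ν : Measure (Randomizers N))
    (hν : ∀ w, ν.map (fun ξ n => ξ n w) = Measure.pi fun _ : Fin N => (volume : Measure I))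
    {h d : ℕ → ℕ} (hd : ∀ i, 1 ≤ i → 1 ≤ d i) (hdh : ∀ i, 1 ≤ i → d i ≤ h i)
    (μ : Fin N → ℕ → ℝ≥0) (hμ : changePoints T μ = ∅) (c : ℝ) :
    dataLaw N T ν μ {ω | (estimatedChangePoints h d lam1 lam2 c ω).Nonempty} ≤
      ENNReal.ofReal (2 * Real.exp (logWindowSum h d T - c)) := by
  have hh : ∀ i, 1 ≤ i → 1 ≤ h i := fun i hi => (hd i hi).trans (hdh i hi)
  set E : ℕ → ℕ → Set (Data N T × Randomizers N) := fun i k =>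
    {ω | c ≤ penalizedScore lam1 lam2 N T (fun n => pValue ω.1 ω.2 n (winLeft h d i k)
      (winMid d i k) (winRight h d i k T)) (winLeft h d i k) (winMid d i k)
      (winRight h d i k T)} with hE
  have hsub : {ω : Data N T × Randomizers N |
      (estimatedChangePoints h d lam1 lam2 c ω).Nonempty} ⊆
      ⋃ i ∈ Finset.Icc 1 (maxScale h d T), ⋃ k ∈ Finset.Icc 1 (numWindows d i T), E i k := by
    intro ω hω
    obtain ⟨i, hi, hiT, k, hk, hc⟩ := (slDetect_nonempty_iff hd hh _ _ _).1 hω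
    simp only [Set.mem_iUnion]
    exact ⟨i, Finset.mem_Icc.2 ⟨hi, hiT⟩, k, hk, hc⟩
  have hone : ∀ i ∈ Finset.Icc 1 (maxScale h d T), ∀ k ∈ Finset.Icc 1 (numWindows d i T),
      dataLaw N T ν μ (E i k) ≤ ENNReal.ofReal (Real.exp (-c) * (2 * h i / T)) := by
    intro i hi k hk
    have hi1 := (Finset.mem_Icc.1 hi).1
    obtain ⟨hst, htu, hu, h1, h2⟩ := window_spec (hd i hi1) (hh i hi1) hk
    refine (penalizedScore_null_le hα hα' hβ hβ' ν hν μ hμ c hst htu hu).trans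
      (ENNReal.ofReal_le_ofReal ?_)
    set s := winLeft h d i k
    set t := winMid d i k
    set u := winRight h d i k T
    have hT : (0 : ℝ) < T := by exact_mod_cast (by omega : 0 < T)
    have hhi : (0 : ℝ) < h i := by exact_mod_cast hh i hi1
    have e1 : (0 : ℝ) < (t : ℝ) - s := by
      rw [sub_pos]; exact_mod_cast hst
    have e2 : (0 : ℝ) < (u : ℝ) - t := by
      rw [sub_pos]; exact_mod_cast htu
    have e3 : (t : ℝ) - s ≤ h i := by
      rw [← Nat.cast_sub hst.le]; exact_mod_cast h1
    have e4 : (u : ℝ) - t ≤ h i := by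
      rw [← Nat.cast_sub htu.le]; exact_mod_cast h2
    have e5 := one_div_le_one_div_of_le e1 e3
    have e6 := one_div_le_one_div_of_le e2 e4
    rw [Real.exp_sub, Real.exp_log (by positivity), div_eq_mul_inv]
    refine mul_le_mul_of_nonneg_left ?_ (Real.exp_pos _).le
    -- Windows clipped at the ends of the data have shorter sides and hence a larger penalty.
    have e7 : (T : ℝ) / 4 * (1 / h i + 1 / h i) ≤
        (T : ℝ) / 4 * (1 / ((t : ℝ) - s) + 1 / ((u : ℝ) - t)) := by gcongr
    refine (inv_anti₀ (by positivity) e7).trans (le_of_eq ?_)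
    field_simp
    ring
  have hcount : ∀ i ∈ Finset.Icc 1 (maxScale h d T),
      ∑ k ∈ Finset.Icc 1 (numWindows d i T), Real.exp (-c) * (2 * h i / T) ≤
        2 * Real.exp (-c) * ((h i : ℝ) / d i) := by
    intro i hi
    have hi1 := (Finset.mem_Icc.1 hi).1
    have hdi : (0 : ℝ) < d i := by exact_mod_cast hd i hi1
    rw [Finset.sum_const, Nat.card_Icc, nsmul_eq_mul, Nat.add_sub_cancel]
    rcases Nat.eq_zero_or_pos T with rfl | hT
    · simp only [CharP.cast_eq_zero, div_zero, mul_zero]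
      positivity
    have hT' : (0 : ℝ) < T := by exact_mod_cast hT
    have h1 : (numWindows d i T : ℝ) ≤ T / d i := by
      refine (Nat.cast_div_le (m := T - 1) (n := d i)).trans ?_
      gcongr
      omega
    calc (numWindows d i T : ℝ) * (Real.exp (-c) * (2 * h i / T))
        ≤ T / d i * (Real.exp (-c) * (2 * h i / T)) := by gcongr
      _ = _ := by field_simp
  calc dataLaw N T ν μ {ω | (estimatedChangePoints h d lam1 lam2 c ω).Nonempty}
      ≤ ∑ i ∈ Finset.Icc 1 (maxScale h d T), ∑ k ∈ Finset.Icc 1 (numWindows d i T),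
          dataLaw N T ν μ (E i k) :=
        (measure_mono hsub).trans ((measure_biUnion_finset_le _ _).trans
          (Finset.sum_le_sum fun i _ => measure_biUnion_finset_le _ _))
    _ ≤ ∑ i ∈ Finset.Icc 1 (maxScale h d T), ∑ k ∈ Finset.Icc 1 (numWindows d i T),
          ENNReal.ofReal (Real.exp (-c) * (2 * h i / T)) :=
        Finset.sum_le_sum fun i hi => Finset.sum_le_sum fun k hk => hone i hi k hk
    _ = ENNReal.ofReal (∑ i ∈ Finset.Icc 1 (maxScale h d T),
          ∑ k ∈ Finset.Icc 1 (numWindows d i T), Real.exp (-c) * (2 * h i / T)) := by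
        rw [ENNReal.ofReal_sum_of_nonneg fun i _ => Finset.sum_nonneg fun k _ => by positivity]
        refine Finset.sum_congr rfl fun i _ => ?_
        rw [ENNReal.ofReal_sum_of_nonneg fun k _ => by positivity]
    _ ≤ _ := by
        refine ENNReal.ofReal_le_ofReal ((Finset.sum_le_sum hcount).trans ?_)
        rw [← Finset.mul_sum, Real.exp_sub, div_eq_mul_inv, ← Real.exp_neg, mul_assoc,
          mul_comm (Real.exp (-c))]
        -- Only x ≤ exp(log x) is used, which also covers an empty sum over scales.
        refine mul_le_mul_of_nonneg_left (mul_le_mul_of_nonneg_right (Real.le_exp_log _)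
          (Real.exp_pos _).le) two_pos.le

/-! ### Reduction of the type II error to one window -/

/-- The change sits at distance x ≤ δ to the right of the window centre, so the right half mixes
both means. For a decrease the diluted ratio is at least E g / (g + δ(E - 1)), which `hr'` compares
with r'. For an increase it is at least E - δ(E - 1)/g, which is no smaller because δ ≤ g. -/
theorem shifted_window_means {m₁ m₂ x g δ E r' : ℝ} (hm₁ : 0 < m₁) (hm₂ : 0 < m₂) (hx : 0 ≤ x)
    (hxδ : x ≤ δ) (hδg : δ ≤ g) (hg : 0 < g) (hE : 1 ≤ E) (hr' : r' * (g + δ * (E - 1)) ≤ E * g) :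
    (E * m₁ ≤ m₂ → r' * (g * m₁) ≤ x * m₁ + (g - x) * m₂) ∧
      (E * m₂ ≤ m₁ → r' * (x * m₁ + (g - x) * m₂) ≤ g * m₁) := by
  have hδ : 0 ≤ δ := hx.trans hxδ
  have hE1 : 0 ≤ E - 1 := by linarith
  constructor
  · intro h
    have h1 : r' * g ≤ E * g - δ * (E - 1) := by
      have h2 : 0 < g + δ * (E - 1) := by positivity
      have h3 : E * g * g ≤ (E * g - δ * (E - 1)) * (g + δ * (E - 1)) := by
        have : 0 ≤ δ * (E - 1) ^ 2 * (g - δ) := mul_nonneg (by positivity) (by linarith)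
        nlinarith
      have h4 : r' * g * (g + δ * (E - 1)) ≤ (E * g - δ * (E - 1)) * (g + δ * (E - 1)) := by
        nlinarith
      exact le_of_mul_le_mul_right h4 h2
    have h5 : (g - x) * (E * m₁) ≤ (g - x) * m₂ := mul_le_mul_of_nonneg_left h (by linarith)
    have h6 : x * (E - 1) ≤ δ * (E - 1) := mul_le_mul_of_nonneg_right hxδ hE1
    have h7 := mul_le_mul_of_nonneg_right h1 hm₁.le
    have h8 := mul_le_mul_of_nonneg_right h6 hm₁.le
    nlinarith
  · intro h
    rcases le_total r' 0 with h0 | h0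
    · have h1 : 0 ≤ x * m₁ + (g - x) * m₂ :=
        add_nonneg (by positivity) (mul_nonneg (by linarith) hm₂.le)
      have h2 : 0 ≤ g * m₁ := by positivity
      nlinarith
    have hE0 : 0 < E := by linarith
    have h5 : (g - x) * (E * m₂) ≤ (g - x) * m₁ := mul_le_mul_of_nonneg_left h (by linarith)
    have h6 : x * (E - 1) ≤ δ * (E - 1) := mul_le_mul_of_nonneg_right hxδ hE1
    have h7 : E * (x * m₁ + (g - x) * m₂) ≤ (g + δ * (E - 1)) * m₁ := by
      have := mul_le_mul_of_nonneg_right h6 hm₁.le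
      nlinarith
    have h8 := mul_le_mul_of_nonneg_left h7 h0
    have h9 := mul_le_mul_of_nonneg_right hr' hm₁.le
    have h10 : E * (r' * (x * m₁ + (g - x) * m₂)) ≤ E * (g * m₁) := by nlinarith
    exact le_of_mul_le_mul_left h10 hE0

theorem ratio_of_le_abs_log {a b Δ : ℝ} (ha : 0 < a) (hb : 0 < b) (h : Δ ≤ |Real.log (b / a)|) :
    Real.exp Δ * a ≤ b ∨ Real.exp Δ * b ≤ a := by
  rcases le_abs'.1 h with h | h
  · right
    have h1 : Δ ≤ Real.log (a / b) := by
      rw [← inv_div, Real.log_inv]; linarith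
    have h2 := (Real.le_log_iff_exp_le (by positivity)).1 h1
    rwa [le_div_iff₀ hb] at h2
  · left
    have h2 := (Real.le_log_iff_exp_le (by positivity)).1 h
    rwa [le_div_iff₀ ha] at h2

/-- The centre is the last multiple of d_i not after τ. As h_i + d_i is at most the distance to the
neighbouring change-points, the window is unclipped, symmetric, and contains no other change, so a
failure to detect forces a small total score in it. The scale does not depend on the configuration
of means, which is what makes the later bounds uniform. -/
theorem typeII_error_le {N T : ℕ} (lam1 lam2 : ℝ) (ν : Measure (Randomizers N))
    (hν : ∀ w, ν.map (fun ξ n => ξ n w) = Measure.pi fun _ : Fin N => (volume : Measure I))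
    {h d : ℕ → ℕ} (hh : StrictMonoOn h (Set.Ici 1)) (hd : ∀ i, 1 ≤ i → 1 ≤ d i)
    (hdh : ∀ i, 1 ≤ i → d i ≤ h i) {μ₀ Δ hmin r' : ℝ} (hμ₀ : 0 < μ₀) (hΔ : 0 < Δ)
    {V i : ℕ} (hi : 1 ≤ i) (hi' : (h i : ℝ) + d i ≤ hmin)
    (hr' : r' * (h i + d i * (Real.exp Δ - 1)) ≤ Real.exp Δ * h i)
    (μ : Fin N → ℕ → ℝ≥0) (hμ : μ ∈ Lam₁ N T μ₀ Δ V hmin) (c : ℝ) :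
    ∃ (Q : Finset (Fin N)) (a b : Fin N → ℝ≥0), Q.card = V ∧ (∀ n, 0 < a n + b n) ∧
      (∀ n ∈ Q, h i * μ₀ ≤ a n ∧ r' * a n ≤ b n) ∧
      dataLaw N T ν μ {ω | estimatedChangePoints h d lam1 lam2 c ω = ∅} ≤
        Measure.pi (fun n => pValueLaw half (a n) (b n))
          {p | ∑ n, score lam1 lam2 N (p n) ≤ c + Real.log T} := by
  classical
  obtain ⟨hΛ, a₀, τ, b₀, hτ, ha₀, hb₀, haτ, hτb, huniq, hmin', hV⟩ := hμ
  have hh1 : ∀ i, 1 ≤ i → 1 ≤ h i := fun i hi => (hd i hi).trans (hdh i hi)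
  have hdi := hd i hi
  have hdhi := hdh i hi
  have hb₀T : b₀ ≤ T := by
    rcases hb₀ with rfl | hb
    · exact le_rfl
    · have := hb.2.1; omega
  have hτ1 : h i + d i ≤ τ - a₀ := by
    have h1 := (hi'.trans hmin').trans (min_le_right _ _)
    rw [← Nat.cast_sub haτ.le] at h1
    exact_mod_cast h1
  have hτ2 : h i + d i ≤ b₀ - τ := by
    have h1 := (hi'.trans hmin').trans (min_le_left _ _)
    rw [← Nat.cast_sub hτb.le] at h1
    exact_mod_cast h1
  set k := τ / d i with hk
  set t := k * d i with ht
  have htτ : t ≤ τ := Nat.div_mul_le_self _ _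
  have hτt : τ < t + d i := by
    have := Nat.lt_div_mul_add (a := τ) hdi
    omega
  have hk1 : 1 ≤ k := (Nat.one_le_div_iff hdi).2 (by omega)
  have hkK : k ∈ Finset.Icc 1 (numWindows d i T) := by
    refine Finset.mem_Icc.2 ⟨hk1, (Nat.le_div_iff_mul_le hdi).2 ?_⟩
    omega
  have hmax : i ≤ maxScale h d T := le_maxScale hh (hh1 1 le_rfl) hi (by omega)
  set s := t - h i with hs
  set u := t + h i with hu
  have hsL : winLeft h d i k = s := rfl
  have huR : winRight h d i k T = u := by
    simp only [winRight]; omega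
  have hhi := hh1 i hi
  have hst : s < t := by omega
  have htu : t < u := by omega
  have huT : u ≤ T := by omega
  -- means in the window
  have hpos : ∀ n, ∀ v ∈ Finset.Icc 1 T, 0 < (μ n v : ℝ) := fun n v hv =>
    hμ₀.trans_le (hΛ n v hv)
  have hleft : ∀ n v, a₀ < v → v ≤ τ → μ n v = μ n τ := fun n v h1 h2 =>
    eq_of_forall_notMem_changePoints (T := T) μ n (by omega) h2 (by omega)
      fun t h3 h4 h5 => by have := huniq t h5 (by omega) (by omega); omega
  have hright : ∀ n v, τ < v → v ≤ b₀ → μ n v = μ n (τ + 1) := fun n v h1 h2 =>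
    (eq_of_forall_notMem_changePoints (T := T) μ n (by omega) h1 (by omega)
      fun t h3 h4 h5 => by have := huniq t h5 (by omega) (by omega); omega).symm
  set A : Fin N → ℝ≥0 := fun n => ∑ v ∈ Finset.Ioc s t, μ n v with hA
  set B : Fin N → ℝ≥0 := fun n => ∑ v ∈ Finset.Ioc t u, μ n v with hB
  have hAe : ∀ n, (A n : ℝ) = h i * μ n τ := by
    intro n
    simp only [hA]
    rw [Finset.sum_congr rfl fun v hv => hleft n v (by have := Finset.mem_Ioc.1 hv; omega)
      (by have := Finset.mem_Ioc.1 hv; omega)]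
    rw [Finset.sum_const, Nat.card_Ioc, show t - s = h i by omega]
    simp
  have hBe : ∀ n, (B n : ℝ) = ((τ : ℝ) - t) * μ n τ + (h i - ((τ : ℝ) - t)) * μ n (τ + 1) := by
    intro n
    simp only [hB]
    rw [← Finset.sum_Ioc_consecutive _ htτ (show τ ≤ u by omega),
      Finset.sum_congr rfl fun v hv => hleft n v (by have := Finset.mem_Ioc.1 hv; omega)
      (by have := Finset.mem_Ioc.1 hv; omega),
      Finset.sum_congr (s₁ := Finset.Ioc τ u) rfl fun v hv => hright n v
        (by have := Finset.mem_Ioc.1 hv; omega) (by have := Finset.mem_Ioc.1 hv; omega)]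
    rw [Finset.sum_const, Finset.sum_const, Nat.card_Ioc, Nat.card_Ioc]
    simp only [nsmul_eq_mul, NNReal.coe_add, NNReal.coe_mul, NNReal.coe_natCast]
    rw [Nat.cast_sub htτ, Nat.cast_sub (show τ ≤ u by omega), hu, Nat.cast_add]
    ring
  have hx0 : (0 : ℝ) ≤ (τ : ℝ) - t := by rw [sub_nonneg]; exact_mod_cast htτ
  have hxd : (τ : ℝ) - t ≤ d i := by
    have : (τ : ℝ) ≤ t + d i := by exact_mod_cast hτt.le
    linarith
  have hdh' : (d i : ℝ) ≤ h i := by exact_mod_cast hdh i hi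
  have hh0 : (0 : ℝ) < h i := by exact_mod_cast hhi
  have hm1 : ∀ n, μ₀ ≤ μ n τ := fun n => hΛ n τ (Finset.mem_Icc.2 ⟨by omega, by omega⟩)
  have hm2 : ∀ n, μ₀ ≤ μ n (τ + 1) := fun n => hΛ n _ (Finset.mem_Icc.2 ⟨by omega, by omega⟩)
  have hAge : ∀ n, h i * μ₀ ≤ A n := fun n => by
    rw [hAe]; exact mul_le_mul_of_nonneg_left (hm1 n) hh0.le
  have hBge : ∀ n, h i * μ₀ ≤ B n := fun n => by
    rw [hBe]
    have h1 := mul_le_mul_of_nonneg_left (hm1 n) hx0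
    have h2 := mul_le_mul_of_nonneg_left (hm2 n)
      (show 0 ≤ (h i : ℝ) - ((τ : ℝ) - t) by linarith)
    linarith
  -- the changing sequences
  set Q₀ : Finset (Fin N) := Finset.univ.filter fun n =>
    Δ ≤ |Real.log ((μ n (τ + 1) : ℝ) / (μ n τ : ℝ))| with hQ₀
  have hQ₀card : V ≤ Q₀.card := by
    refine hV.trans (le_of_eq ?_)
    rw [numChanges, ← Set.ncard_coe_finset]
    congr 1
    ext n
    simp [hQ₀]
  obtain ⟨Q, hQ, hQcard⟩ := Finset.exists_subset_card_eq hQ₀card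
  have hratio : ∀ n ∈ Q, r' * A n ≤ B n ∨ r' * B n ≤ A n := by
    intro n hn
    have h1 := (Finset.mem_filter.1 (hQ hn)).2
    have h2 := shifted_window_means (hμ₀.trans_le (hm1 n)) (hμ₀.trans_le (hm2 n)) hx0 hxd hdh' hh0
      (Real.one_le_exp hΔ.le) hr'
    rw [hAe, hBe]
    rcases ratio_of_le_abs_log (hμ₀.trans_le (hm1 n)) (hμ₀.trans_le (hm2 n)) h1 with h3 | h3
    · exact Or.inl (h2.1 h3)
    · exact Or.inr (h2.2 h3)
  -- The halves are relabelled sequence by sequence so that `b` is the larger mean; the law of the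
  -- p-value does not notice.
  refine ⟨Q, fun n => if r' * A n ≤ B n then A n else B n,
    fun n => if r' * A n ≤ B n then B n else A n, hQcard, ?_, ?_, ?_⟩
  · intro n
    have h1 : 0 < A n := by
      have : (0 : ℝ) < A n := lt_of_lt_of_le (by positivity) (hAge n)
      exact_mod_cast this
    dsimp only
    split_ifs
    · exact add_pos_of_pos_of_nonneg h1 zero_le
    · exact add_pos_of_nonneg_of_pos zero_le h1
  · intro n hn
    dsimp only
    split_ifs with h1
    · exact ⟨hAge n, h1⟩
    · exact ⟨hBge n, (hratio n hn).resolve_left h1⟩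
  · have hlaw : (fun n => pValueLaw half (if r' * A n ≤ B n then A n else B n)
        (if r' * A n ≤ B n then B n else A n)) = fun n => pValueLaw half (A n) (B n) := by
      ext1 n
      split_ifs
      · rfl
      · exact pValueLaw_half_comm _ _
    have hθ : successProb s t u = half := by
      apply Subtype.ext
      rw [coe_successProb hst htu, coe_half]
      have h1 : (t : ℝ) - s = h i := by
        rw [← Nat.cast_sub hst.le]; congr 1; omega
      have h2 : (u : ℝ) - s = 2 * h i := by
        rw [← Nat.cast_sub (hst.trans htu).le, show u - s = 2 * h i by omega]; push_cast; ring
      rw [h1, h2]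
      field_simp
    rw [hlaw, ← hθ, ← map_pValue_dataLaw ν μ (hν (s, t, u)) hst.le htu.le huT]
    have hmeas : Measurable fun (ω : Data N T × Randomizers N) n => pValue ω.1 ω.2 n s t u :=
      measurable_pi_lambda _ fun n => measurable_pValue n hst.le htu.le
    refine le_trans (measure_mono ?_) (Measure.le_map_apply hmeas.aemeasurable _)
    intro ω hω
    simp only [Set.mem_preimage, Set.mem_ofPred_eq] at *
    by_contra hcon
    rw [not_le] at hcon
    refine Set.nonempty_iff_ne_empty.1 ((slDetect_nonempty_iff hd hh1 _ _ _).2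
      ⟨i, hi, hmax, k, hkK, ?_⟩) hω
    rw [hsL, huR, show winMid d i k = t from rfl, penalizedScore]
    have hT : (1 : ℝ) ≤ T := by exact_mod_cast (by omega : 1 ≤ T)
    have h1 : (t : ℝ) - s = h i := by
      rw [← Nat.cast_sub hst.le]; congr 1; omega
    have h2 : (u : ℝ) - t = h i := by
      rw [← Nat.cast_sub htu.le]; congr 1; omega
    -- Both sides have length h_i ≥ 1, so the argument of the logarithm is at most T / 2.
    have h3 : Real.log ((T : ℝ) / 4 * (1 / ((t : ℝ) - s) + 1 / ((u : ℝ) - t))) ≤ Real.log T := by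
      rw [h1, h2]
      refine Real.log_le_log (by positivity) ?_
      have h4 : (1 : ℝ) ≤ h i := by exact_mod_cast hhi
      have h5 : 1 / (h i : ℝ) ≤ 1 := by rw [div_le_one hh0]; exact h4
      nlinarith
    linarith

/-! ### Lower deviations of the total score -/

noncomputable section

/-- The excess of the exponential moment of minus the score under the null hypothesis. -/
def nullExcess (α β : ℝ) : ℝ := α + 4 * β ^ 2 * Real.log ((1 + β) / β)

end

theorem nullExcess_nonneg {α β : ℝ} (hα : 0 ≤ α) (hβ : 0 < β) : 0 ≤ nullExcess α β := by
  have : 0 ≤ Real.log ((1 + β) / β) := Real.log_nonneg (by rw [le_div_iff₀ hβ]; linarith)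
  unfold nullExcess
  positivity

/-- The weights of `f₁` and `f₂` in the score are small. -/
structure SmallWeights (lam1 lam2 : ℝ) (N : ℕ) : Prop where
  pos₁ : 0 < lam1 * Real.log N / N
  le₁ : lam1 * Real.log N / N ≤ 1 / 10
  pos₂ : 0 < lam2 / √(N * Real.log N)
  le₂ : lam2 / √(N * Real.log N) ≤ 1 / 10

section

variable {lam1 lam2 : ℝ} {N : ℕ}

theorem lintegral_exp_neg_score (hS : SmallWeights lam1 lam2 N) (P : Measure ℝ)
    (hP : ∀ᵐ p ∂P, p ∈ Set.Ioc (0 : ℝ) 1) :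
    ∫⁻ p, ENNReal.ofReal (Real.exp (-score lam1 lam2 N p)) ∂P =
      ∫⁻ p, ENNReal.ofReal
        (likRatio (lam1 * Real.log N / N) (lam2 / √(N * Real.log N)) p)⁻¹ ∂P := by
  refine lintegral_congr_ae ?_
  filter_upwards [hP] with p hp
  have h := half_le_likRatio hS.pos₁.le hS.le₁ hS.pos₂.le hS.le₂ hp.1
  rw [score_eq, Real.exp_neg, Real.exp_log (by linarith)]

theorem neg_one_le_score (hS : SmallWeights lam1 lam2 N) {p : ℝ} (hp : 0 < p) : -1 ≤ score lam1 lam2 N p := by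
  have h := half_le_likRatio hS.pos₁.le hS.le₁ hS.pos₂.le hS.le₂ hp
  have h1 := Real.log_le_log (by norm_num) h
  rw [score_eq]
  have h2 : Real.log (1 / 2 : ℝ) = -Real.log 2 := by rw [one_div, Real.log_inv]
  linarith [Real.log_two_lt_d9]

/-- Exponential Markov bound in which the members of `Q` contribute -g and all others at most the
null excess. Suited to many weak signals. -/
theorem pi_sum_score_le_of_gain (hS : SmallWeights lam1 lam2 N) (Q : Finset (Fin N)) (a b : Fin N → ℝ≥0) (hab : ∀ n, 0 < a n + b n)
    (g : ℝ) (hg : ∀ n ∈ Q, ∫⁻ p, ENNReal.ofReal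
        (likRatio (lam1 * Real.log N / N) (lam2 / √(N * Real.log N)) p)⁻¹
          ∂(pValueLaw half (a n) (b n)) ≤ ENNReal.ofReal (Real.exp (-g))) (y : ℝ) :
    Measure.pi (fun n => pValueLaw half (a n) (b n)) {p | ∑ n, score lam1 lam2 N (p n) ≤ y} ≤
      ENNReal.ofReal (Real.exp (y + N * nullExcess (lam1 * Real.log N / N)
        (lam2 / √(N * Real.log N)) - Q.card * g)) := by
  classical
  set κ := nullExcess (lam1 * Real.log N / N) (lam2 / √(N * Real.log N)) with hκ
  have hκ0 : 0 ≤ κ := nullExcess_nonneg hS.pos₁.le hS.pos₂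
  have h := measure_pi_le_sum_le (fun n => pValueLaw half (a n) (b n))
    (fun p => -score lam1 lam2 N p) (measurable_score _ _ _).neg
    (fun n => κ + if n ∈ Q then -g - κ else 0) Finset.univ (fun n _ => by
      rw [lintegral_exp_neg_score hS _
        (ae_pValueLaw_mem_Ioc half (by norm_num) (by norm_num) _ _)]
      split_ifs with hn
      · rw [show κ + (-g - κ) = -g by ring]
        exact hg n hn
      · rw [add_zero]
        exact lintegral_inv_likRatio_pValueLaw_le hS.pos₁.le hS.le₁ hS.pos₂ hS.le₂ _ _ (hab n)) (-y)
  have hset : {p : Fin N → ℝ | ∑ n, score lam1 lam2 N (p n) ≤ y} =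
      {p | -y ≤ ∑ n, -score lam1 lam2 N (p n)} := by
    ext p
    simp [Finset.sum_neg_distrib]
  rw [hset]
  refine h.trans (ENNReal.ofReal_le_ofReal (Real.exp_le_exp.2 ?_))
  rw [Finset.sum_add_distrib, Finset.sum_ite_mem, Finset.univ_inter]
  simp only [Finset.sum_const, Finset.card_univ, Fintype.card_fin, nsmul_eq_mul]
  have : 0 ≤ (Q.card : ℝ) * κ := by positivity
  linarith

/-- Two bad events suffice: a proportion η of `Q` has p-values above p₀ (Markov applied to their
number), or the sequences outside `Q` sum to at most -x₀ (Chernoff). Suited to few strong signals.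
-/
theorem pi_sum_score_le_of_large (hS : SmallWeights lam1 lam2 N) (Q : Finset (Fin N)) (hQ : Q.Nonempty) (a b : Fin N → ℝ≥0)
    (hab : ∀ n, 0 < a n + b n) {p₀ ℓ₀ q η x₀ y : ℝ} (hη : 0 < η) (hℓ₀ : 0 ≤ ℓ₀)
    (hq : ∀ n ∈ Q, pValueLaw half (a n) (b n) (Set.Ioi p₀) ≤ ENNReal.ofReal q)
    (hscore : ∀ p ∈ Set.Ioc (0 : ℝ) 1, p ≤ p₀ → ℓ₀ ≤ score lam1 lam2 N p)
    (hy : y + x₀ ≤ (1 - η) * Q.card * ℓ₀ - η * Q.card) :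
    Measure.pi (fun n => pValueLaw half (a n) (b n)) {p | ∑ n, score lam1 lam2 N (p n) ≤ y} ≤
      ENNReal.ofReal (q / η) + ENNReal.ofReal (Real.exp (N * nullExcess (lam1 * Real.log N / N)
        (lam2 / √(N * Real.log N)) - x₀)) := by
  classical
  set P := Measure.pi (fun n => pValueLaw half (a n) (b n)) with hP
  set κ := nullExcess (lam1 * Real.log N / N) (lam2 / √(N * Real.log N)) with hκ
  have hκ0 : 0 ≤ κ := nullExcess_nonneg hS.pos₁.le hS.pos₂
  have hV : 0 < (Q.card : ℝ) := by exact_mod_cast hQ.card_pos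
  set F : (Fin N → ℝ) → ℝ≥0∞ := fun p => ∑ n ∈ Q, (Set.Ioi p₀).indicator 1 (p n) with hF
  have hFm : Measurable F := Finset.measurable_sum _ fun n _ =>
    (measurable_one.indicator measurableSet_Ioi).comp (measurable_pi_apply n)
  have hae : ∀ᵐ p ∂P, ∀ n, p n ∈ Set.Ioc (0 : ℝ) 1 := by
    rw [ae_all_iff]
    intro n
    exact (measurePreserving_eval (fun n => pValueLaw half (a n) (b n)) n).quasiMeasurePreserving.ae
      (ae_pValueLaw_mem_Ioc half (by norm_num) (by norm_num) _ _)
  have hsub : {p : Fin N → ℝ | ∑ n, score lam1 lam2 N (p n) ≤ y} ≤ᵐ[P]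
      ({p | ENNReal.ofReal (η * Q.card) ≤ F p} ∪
        {p | x₀ ≤ ∑ n ∈ Qᶜ, -score lam1 lam2 N (p n)} : Set (Fin N → ℝ)) := by
    filter_upwards [hae] with p hp hle
    by_contra hcon
    have hle' : ∑ n, score lam1 lam2 N (p n) ≤ y := hle
    have h1 : F p < ENNReal.ofReal (η * Q.card) := not_le.1 fun h => hcon (Or.inl h)
    have h2 : ∑ n ∈ Qᶜ, -score lam1 lam2 N (p n) < x₀ := not_le.1 fun h => hcon (Or.inr h)
    set K := Q.filter fun n => p₀ < p n with hK
    have hFK : F p = ENNReal.ofReal (K.card : ℝ) := by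
      rw [ENNReal.ofReal_natCast, hK, Finset.card_filter, Nat.cast_sum]
      refine Finset.sum_congr rfl fun n _ => ?_
      by_cases hn : p₀ < p n <;> simp [hn]
    rw [hFK, ENNReal.ofReal_lt_ofReal_iff (by positivity)] at h1
    -- A member of `Q` with a large p-value still scores at least -1, so it loses at most ℓ₀ + 1.
    have h3 : ∑ n ∈ Q, (ℓ₀ - (if p₀ < p n then ℓ₀ + 1 else 0)) ≤
        ∑ n ∈ Q, score lam1 lam2 N (p n) := by
      refine Finset.sum_le_sum fun n _ => ?_
      split_ifs with hn
      · have := neg_one_le_score hS (hp n).1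
        linarith
      · simpa using hscore (p n) (hp n) (not_lt.1 hn)
    rw [Finset.sum_sub_distrib, ← Finset.sum_filter, ← hK] at h3
    simp only [Finset.sum_const, nsmul_eq_mul] at h3
    have h4 := Finset.sum_add_sum_compl Q fun n => score lam1 lam2 N (p n)
    rw [Finset.sum_neg_distrib] at h2
    have h5 : (K.card : ℝ) * (ℓ₀ + 1) ≤ η * Q.card * (ℓ₀ + 1) :=
      mul_le_mul_of_nonneg_right h1.le (by linarith)
    nlinarith
  refine (measure_mono_ae hsub).trans ((measure_union_le _ _).trans (add_le_add ?_ ?_))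
  · have hm := mul_meas_ge_le_lintegral (μ := P) hFm (ENNReal.ofReal (η * Q.card))
    have hint : ∫⁻ p, F p ∂P ≤ ENNReal.ofReal (q * Q.card) := by
      simp only [hF]
      rw [lintegral_finsetSum (f := fun n (p : Fin N → ℝ) => (Set.Ioi p₀).indicator 1 (p n)) _
        fun n _ => (measurable_one.indicator measurableSet_Ioi).comp (measurable_pi_apply n)]
      calc _ ≤ ∑ n ∈ Q, ENNReal.ofReal q := by
            refine Finset.sum_le_sum fun n hn => ?_
            rw [(measurePreserving_eval (fun n => pValueLaw half (a n) (b n)) n).lintegral_comp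
              (f := (Set.Ioi p₀).indicator 1) (measurable_one.indicator measurableSet_Ioi),
              lintegral_indicator_one measurableSet_Ioi]
            exact hq n hn
        _ = ENNReal.ofReal (q * Q.card) := by
            rw [Finset.sum_const, nsmul_eq_mul, mul_comm q, ENNReal.ofReal_mul (by positivity),
              ENNReal.ofReal_natCast]
    rw [← ENNReal.mul_le_mul_iff_right (a := ENNReal.ofReal (η * Q.card))
      (by simp only [ne_eq, ENNReal.ofReal_eq_zero, not_le]; positivity) (by simp)]
    refine (hm.trans hint).trans (le_of_eq ?_)
    rw [← ENNReal.ofReal_mul (by positivity)]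
    congr 1
    field_simp
  · refine (measure_pi_le_sum_le (fun n => pValueLaw half (a n) (b n))
      (fun p => -score lam1 lam2 N p) (measurable_score _ _ _).neg (fun _ => κ) Qᶜ (fun n _ => by
        rw [lintegral_exp_neg_score hS _
          (ae_pValueLaw_mem_Ioc half (by norm_num) (by norm_num) _ _)]
        exact lintegral_inv_likRatio_pValueLaw_le hS.pos₁.le hS.le₁ hS.pos₂ hS.le₂ _ _ (hab n)) x₀).trans
      (ENNReal.ofReal_le_ofReal (Real.exp_le_exp.2 ?_))
    rw [Finset.sum_const, nsmul_eq_mul]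
    have : ((Qᶜ).card : ℝ) ≤ N := by
      have := Finset.card_le_univ Qᶜ
      rw [Fintype.card_fin] at this
      exact_mod_cast this
    nlinarith

/-- By monotonicity it is enough to treat p = 2 exp(-x), where the f₁ part alone gives log α + x -
log 2 - 2 log(2 - log p). The hypothesis `hη` absorbs everything except x. -/
theorem le_score_of_le_small (hS : SmallWeights lam1 lam2 N) {η x p : ℝ} (hx : 1 ≤ x)
    (hη : -Real.log (lam1 * Real.log N / N) + 1 + 2 * Real.log (2 + x) ≤ η * x)
    (hp : p ∈ Set.Ioc (0 : ℝ) 1) (hpx : p ≤ 2 * Real.exp (-x)) :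
    (1 - η) * x ≤ score lam1 lam2 N p := by
  set α := lam1 * Real.log N / N with hαd
  set β := lam2 / √(N * Real.log N) with hβd
  have hα := hS.pos₁
  have hα' := hS.le₁
  have hβ := hS.pos₂
  have hβ' := hS.le₂
  rw [← hαd] at hα hα'
  rw [← hβd] at hβ hβ'
  have hl2 := Real.log_two_lt_d9
  have hl2' := Real.log_two_gt_d9
  set p₁ := 2 * Real.exp (-x) with hp₁
  have hlog : Real.log p₁ = Real.log 2 - x := by
    rw [hp₁, Real.log_mul two_ne_zero (Real.exp_pos _).ne', Real.log_exp]; ring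
  have hp₁0 : 0 < p₁ := by positivity
  have hp₁1 : p₁ ≤ 1 := by
    rw [← Real.log_nonpos_iff hp₁0.le, hlog]
    linarith
  have h1 := antitoneOn_likRatio hα.le hβ.le hp ⟨hp₁0, hp₁1⟩ hpx
  have h2 := le_likRatio' (α := α) (p := p₁) hβ.le
  have hs : 0 < 2 - Real.log p₁ := by rw [hlog]; linarith
  have h3 : α / (p₁ * (2 - Real.log p₁) ^ 2) ≤ likRatio α β p := by linarith
  have h4 := Real.log_le_log (by positivity) h3
  rw [score_eq]
  refine le_trans ?_ h4
  rw [Real.log_div hα.ne' (by positivity), Real.log_mul hp₁0.ne' (by positivity), Real.log_pow,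
    hlog]
  have h5 : Real.log (2 - (Real.log 2 - x)) ≤ Real.log (2 + x) :=
    Real.log_le_log (by linarith) (by linarith)
  push_cast
  linarith

end

/-! ### Asymptotics of the parameters -/

/-- log y ≤ y - 1 applied to both logarithms of `largeDev_eq`: the linear bounds cancel, and the
first inequality is strict. -/
theorem largeDev_pos {r : ℝ} (hr : 1 < r) : 0 < largeDev r := by
  have hr0 : 0 < r := by linarith
  have h1 : Real.log ((1 + r) / 2) < (1 + r) / 2 - 1 :=
    Real.log_lt_sub_one_of_pos (by positivity) (by linarith)
  have h2 : Real.log ((1 + r) / (2 * r)) ≤ (1 + r) / (2 * r) - 1 :=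
    Real.log_le_sub_one_of_pos (by positivity)
  have h3 := mul_le_mul_of_nonneg_left h2 hr0.le
  have h4 : r * ((1 + r) / (2 * r) - 1) = (1 + r) / 2 - r := by field_simp
  rw [largeDev_eq]
  linarith

/-- The largest scale that fits works: the next one does not fit, so x < h_(i+1) + d_(i+1) ≤ (1 +
δ/2)² h_i. -/
theorem exists_scale {h d : ℕ → ℕ} (hh : StrictMonoOn h (Set.Ici 1)) (hh1 : 1 ≤ h 1)
    (hratio : Tendsto (fun i => (h (i + 1) : ℝ) / (h i : ℝ)) atTop (𝓝 1))
    (hdo : (fun i => (d i : ℝ)) =o[atTop] fun i => (h i : ℝ)) {δ : ℝ} (hδ : 0 < δ) (hδ1 : δ < 1) :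
    ∀ᶠ x : ℝ in atTop, ∃ i, 1 ≤ i ∧ (h i : ℝ) + d i ≤ x ∧ (1 - δ) * x ≤ h i ∧
      (d i : ℝ) ≤ δ * h i := by
  have h1 : ∀ᶠ i in atTop, (h (i + 1) : ℝ) ≤ (1 + δ / 2) * h i ∧ (d i : ℝ) ≤ δ / 2 * h i := by
    filter_upwards [hratio.eventually (ge_mem_nhds (show (1 : ℝ) < 1 + δ / 2 by linarith)),
      hdo.bound (half_pos hδ), eventually_ge_atTop 1] with i hi hi2 hi1
    have hpos : (0 : ℝ) < h i := by
      have := le_window hh hi1 hh1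
      exact_mod_cast (by omega : 0 < h i)
    refine ⟨by rwa [div_le_iff₀ hpos] at hi, ?_⟩
    simpa using hi2
  obtain ⟨I₀, hI₀⟩ := eventually_atTop.1 (h1.and (eventually_ge_atTop 1))
  have hI1 : 1 ≤ I₀ := (hI₀ I₀ le_rfl).2
  filter_upwards [eventually_ge_atTop ((h I₀ : ℝ) + d I₀)] with x hx
  set S : Set ℕ := {i | I₀ ≤ i ∧ (h i : ℝ) + d i ≤ x} with hS
  have hne : S.Nonempty := ⟨I₀, le_rfl, hx⟩
  have hbdd : BddAbove S := by
    refine ⟨⌈x⌉₊, fun i hi => ?_⟩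
    have h2 := le_window hh (hI1.trans hi.1) hh1
    have h3 : (i : ℝ) ≤ x := by
      have : (i : ℝ) ≤ h i := by exact_mod_cast h2
      have := hi.2
      have : (0 : ℝ) ≤ d i := by positivity
      linarith
    exact_mod_cast h3.trans (Nat.le_ceil x)
  obtain ⟨hm1, hm2⟩ := Nat.sSup_mem hne hbdd
  set i := sSup S with hi
  obtain ⟨⟨h2, h3⟩, -⟩ := hI₀ i hm1
  obtain ⟨⟨-, h5⟩, -⟩ := hI₀ (i + 1) (by omega)
  have h6 : x < (h (i + 1) : ℝ) + d (i + 1) := by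
    by_contra hcon
    have := le_csSup hbdd (show i + 1 ∈ S from ⟨by omega, not_lt.1 hcon⟩)
    omega
  have hpos : (0 : ℝ) ≤ h i := by positivity
  refine ⟨i, hI1.trans hm1, hm2, ?_, by nlinarith⟩
  have h7 : x ≤ (1 + δ / 2) * ((1 + δ / 2) * h i) := by nlinarith
  have h8 : (1 - δ) * x ≤ (1 - δ) * ((1 + δ / 2) * ((1 + δ / 2) * h i)) :=
    mul_le_mul_of_nonneg_left h7 (by linarith)
  have h9 : (1 - δ) * ((1 + δ / 2) * (1 + δ / 2)) ≤ 1 := by nlinarith [sq_nonneg δ, mul_pos hδ hδ]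
  nlinarith

section Regime

variable {ζ : ℝ} {N T : ℕ → ℕ}

theorem tendsto_log_natCast {N : ℕ → ℕ} (hN : Tendsto N atTop atTop) :
    Tendsto (fun m => Real.log (N m)) atTop atTop :=
  Real.tendsto_log_atTop.comp (tendsto_natCast_atTop_atTop.comp hN)

/-- The comparison of the scales `log N`, `log T` and `log log T`. -/
theorem eventually_regime (hζ0 : 0 < ζ) (hζ1 : ζ ≤ 1) (hN : Tendsto N atTop atTop)
    (hT : Tendsto T atTop atTop)
    (hNT : (fun m => Real.log (T m)) ~[atTop] fun m => (N m : ℝ) ^ ζ) (K : ℝ) :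
    ∀ᶠ m in atTop, K ≤ Real.log (N m) ∧ K ≤ Real.log (Real.log (T m)) ∧
      (N m : ℝ) ^ ζ / 2 ≤ Real.log (T m) ∧ Real.log (T m) ≤ 2 * (N m : ℝ) ^ ζ ∧
      K * Real.log (N m) ≤ Real.log (T m) ∧ Real.log (Real.log (T m)) ≤ 2 * Real.log (N m) := by
  have hlN := tendsto_log_natCast hN
  have hlT := tendsto_log_natCast hT
  have hllT : Tendsto (fun m => Real.log (Real.log (T m))) atTop atTop :=
    Real.tendsto_log_atTop.comp hlT
  have hNr : Tendsto (fun m => (N m : ℝ)) atTop atTop := tendsto_natCast_atTop_atTop.comp hN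
  have hbound := hNT.isLittleO.bound (show (0 : ℝ) < 1 / 2 by norm_num)
  have hlo := ((isLittleO_log_rpow_atTop hζ0).comp_tendsto hNr).bound
    (show (0 : ℝ) < 1 / (2 * (|K| + 1)) by positivity)
  filter_upwards [hlN.eventually_ge_atTop (max K 1), hllT.eventually_ge_atTop K,
    hlT.eventually_gt_atTop 0, hbound, hlo] with m h1 h2 h3 h4 h5
  have hN0 : (0 : ℝ) < N m := by
    rcases Nat.eq_zero_or_pos (N m) with h0 | h0
    · rw [h0, Nat.cast_zero, Real.log_zero] at h1
      have := le_max_right K 1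
      linarith
    · exact_mod_cast h0
  have hl1 : 1 ≤ Real.log (N m) := (le_max_right _ _).trans h1
  have hpow : 0 < (N m : ℝ) ^ ζ := Real.rpow_pos_of_pos hN0 _
  simp only [Pi.sub_apply, Real.norm_eq_abs, abs_of_pos hpow] at h4
  have h4' := abs_le.1 h4
  simp only [Function.comp, Real.norm_eq_abs, abs_of_pos hpow,
    abs_of_pos (show 0 < Real.log (N m) by linarith)] at h5
  have hup : Real.log (T m) ≤ 2 * (N m : ℝ) ^ ζ := by linarith [h4'.2]
  have hlow : (N m : ℝ) ^ ζ / 2 ≤ Real.log (T m) := by linarith [h4'.1]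
  refine ⟨(le_max_left _ _).trans h1, h2, hlow, hup, ?_, ?_⟩
  · have h6 : (|K| + 1) * Real.log (N m) ≤ (N m : ℝ) ^ ζ / 2 := by
      rw [div_mul_eq_mul_div, one_mul, le_div_iff₀ (by positivity)] at h5
      linarith
    have h7 := le_abs_self K
    nlinarith
  · have h6 := Real.log_le_log h3 hup
    rw [Real.log_mul two_ne_zero hpow.ne', Real.log_rpow hN0] at h6
    have := Real.log_two_lt_d9
    nlinarith

theorem weight_sq (lam2 : ℝ) (N : ℕ) (h : 0 ≤ (N : ℝ) * Real.log N) :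
    (lam2 / √(N * Real.log N)) ^ 2 = lam2 ^ 2 / (N * Real.log N) := by
  rw [div_pow, Real.sq_sqrt h]

theorem lambda2_sq (T : ℕ) (h : 0 ≤ Real.log T / Real.log (Real.log T)) :
    lambda2 T ^ 2 = Real.log T / Real.log (Real.log T) := by
  rw [lambda2, Real.sq_sqrt h]

/-- Bounds of the weight of `f₂` in the score. -/
theorem eventually_weight_bounds (hζ0 : 0 < ζ) (hζ1 : ζ ≤ 1) (hN : Tendsto N atTop atTop)
    (hT : Tendsto T atTop atTop)
    (hNT : (fun m => Real.log (T m)) ~[atTop] fun m => (N m : ℝ) ^ ζ) {η : ℝ} (hη : 0 < η) :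
    ∀ᶠ m in atTop,
      Real.exp (-((1 - ζ) / 2 + η) * Real.log (N m)) ≤
          lambda2 (T m) / √(N m * Real.log (N m)) ∧
        lambda2 (T m) / √(N m * Real.log (N m)) ≤
          Real.exp (-((1 - ζ) / 2) * Real.log (N m)) := by
  have hlN := tendsto_log_natCast hN
  -- Absorbs the factors log N and log log T ≤ 2 log N into a small power of N.
  have hexp : ∀ᶠ x : ℝ in atTop, 4 * x ^ 2 ≤ Real.exp (2 * η * x) := by
    have h1 := (isLittleO_pow_exp_pos_mul_atTop 2 (show 0 < 2 * η by positivity)).bound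
      (show (0 : ℝ) < 1 / 4 by norm_num)
    filter_upwards [h1] with x hx
    simp only [Real.norm_eq_abs, Real.abs_exp, abs_pow, sq_abs] at hx
    linarith
  filter_upwards [eventually_regime hζ0 hζ1 hN hT hNT 2, hlN.eventually hexp]
    with m ⟨h1, h2, h3, h4, h5, h6⟩ h7
  set n : ℝ := (N m : ℝ)
  set l := Real.log n with hl
  set t := Real.log (T m) with ht
  set M := Real.log t with hM
  have hn0 : 0 < n := by
    rcases (Nat.cast_nonneg (α := ℝ) (N m)).eq_or_lt with h0 | h0
    · rw [hl, show n = 0 from h0.symm, Real.log_zero] at h1; linarith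
    · exact h0
  have hl0 : 0 < l := by linarith
  have ht0 : 0 < t := by nlinarith
  have hM0 : 0 < M := by linarith
  have hsq : (lambda2 (T m) / √(n * l)) ^ 2 = t / M / (n * l) := by
    rw [weight_sq _ _ (by positivity), lambda2_sq _ (by positivity)]
  have hb0 : 0 ≤ lambda2 (T m) / √(n * l) := by
    unfold lambda2; positivity
  have hne : n = Real.exp l := (Real.exp_log hn0).symm
  have hnζ : n ^ ζ = Real.exp (ζ * l) := by rw [Real.rpow_def_of_pos hn0, mul_comm]
  rw [hnζ] at h3 h4
  constructor
  · rw [← pow_le_pow_iff_left₀ (Real.exp_pos _).le hb0 two_ne_zero, hsq, ← Real.exp_nat_mul,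
      le_div_iff₀ (by positivity), le_div_iff₀ hM0]
    calc Real.exp ((2 : ℕ) * (-((1 - ζ) / 2 + η) * l)) * (n * l) * M
        ≤ Real.exp ((2 : ℕ) * (-((1 - ζ) / 2 + η) * l)) * (n * l) * (2 * l) := by gcongr
      _ = Real.exp ((2 : ℕ) * (-((1 - ζ) / 2 + η) * l)) * n * (4 * l ^ 2) / 2 := by ring
      _ ≤ Real.exp ((2 : ℕ) * (-((1 - ζ) / 2 + η) * l)) * n * Real.exp (2 * η * l) / 2 := by gcongr
      _ = Real.exp (ζ * l) / 2 := by
          rw [hne, ← Real.exp_add, ← Real.exp_add]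
          congr 2
          push_cast
          ring
      _ ≤ t := h3
  · rw [← pow_le_pow_iff_left₀ hb0 (Real.exp_pos _).le two_ne_zero, hsq, ← Real.exp_nat_mul,
      div_le_iff₀ (by positivity), div_le_iff₀ hM0]
    have e1 : Real.exp ((2 : ℕ) * (-((1 - ζ) / 2) * l)) * n = Real.exp (ζ * l) := by
      rw [hne, ← Real.exp_add]
      congr 1
      push_cast
      ring
    calc t ≤ 2 * Real.exp (ζ * l) := h4
      _ ≤ Real.exp (ζ * l) * (l * M) := by
          have : 2 ≤ l * M := by nlinarith
          nlinarith [Real.exp_pos (ζ * l)]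
      _ = _ := by rw [← e1]; ring

theorem eventually_smallWeights (hζ0 : 0 < ζ) (hζ1 : ζ ≤ 1) (hN : Tendsto N atTop atTop)
    (hT : Tendsto T atTop atTop)
    (hNT : (fun m => Real.log (T m)) ~[atTop] fun m => (N m : ℝ) ^ ζ) {lam1 : ℝ} (h1 : 0 < lam1) :
    ∀ᶠ m in atTop, SmallWeights lam1 (lambda2 (T m)) (N m) := by
  have hNr : Tendsto (fun m => (N m : ℝ)) atTop atTop := tendsto_natCast_atTop_atTop.comp hN
  have hlo := (Real.isLittleO_log_id_atTop.comp_tendsto hNr).bound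
    (show (0 : ℝ) < 1 / (10 * lam1) by positivity)
  filter_upwards [eventually_regime hζ0 hζ1 hN hT hNT 20, hlo, hNr.eventually_ge_atTop 1]
    with m ⟨a1, a2, a3, a4, a5, a6⟩ h2 hn1
  have hl0 : 0 < Real.log (N m) := by linarith
  have hn0 : (0 : ℝ) < N m := by linarith
  have ht0 : 0 < Real.log (T m) := by nlinarith
  have hM0 : 0 < Real.log (Real.log (T m)) := by linarith
  have hb0 : 0 < lambda2 (T m) / √(N m * Real.log (N m)) := by
    unfold lambda2; positivity
  simp only [Function.comp, id, Real.norm_eq_abs, abs_of_pos hl0, abs_of_pos hn0] at h2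
  refine ⟨by positivity, ?_, hb0, ?_⟩
  · rw [div_le_iff₀ hn0]
    rw [div_mul_eq_mul_div, one_mul, le_div_iff₀ (by positivity)] at h2
    linarith
  · rw [← pow_le_pow_iff_left₀ hb0.le (by norm_num) two_ne_zero, weight_sq _ _ (by positivity),
      lambda2_sq _ (by positivity), div_le_iff₀ (by positivity), div_le_iff₀ hM0]
    have h3 : (N m : ℝ) ^ ζ ≤ N m := by
      simpa using Real.rpow_le_rpow_of_exponent_le hn1 hζ1
    have h4 : 400 ≤ Real.log (N m) * Real.log (Real.log (T m)) := by nlinarith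
    nlinarith

/-- The total excess over all sequences is negligible. -/
theorem eventually_nullExcess_le (hζ0 : 0 < ζ) (hζ1 : ζ ≤ 1) (hN : Tendsto N atTop atTop)
    (hT : Tendsto T atTop atTop)
    (hNT : (fun m => Real.log (T m)) ~[atTop] fun m => (N m : ℝ) ^ ζ) {lam1 : ℝ} (h1 : 0 < lam1)
    {η : ℝ} (hη : 0 < η) :
    ∀ᶠ m in atTop, N m * nullExcess (lam1 * Real.log (N m) / N m)
      (lambda2 (T m) / √(N m * Real.log (N m))) ≤ η * Real.log (T m) := by
  filter_upwards [eventually_regime hζ0 hζ1 hN hT hNT (max 1 (max (2 * lam1 / η) (16 / η))),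
    eventually_smallWeights hζ0 hζ1 hN hT hNT h1] with m ⟨a1, a2, a3, a4, a5, a6⟩ hS
  have k1 : 1 ≤ max 1 (max (2 * lam1 / η) (16 / η)) := le_max_left _ _
  have k2 : 2 * lam1 / η ≤ max 1 (max (2 * lam1 / η) (16 / η)) :=
    (le_max_left _ _).trans (le_max_right _ _)
  have k3 : 16 / η ≤ max 1 (max (2 * lam1 / η) (16 / η)) :=
    (le_max_right _ _).trans (le_max_right _ _)
  have hb0 := hS.pos₂
  have hb1 := hS.le₂
  have hl1 : 1 ≤ Real.log (N m) := k1.trans a1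
  have hn0 : (0 : ℝ) < N m := by
    rcases (Nat.cast_nonneg (α := ℝ) (N m)).eq_or_lt with h0 | h0
    · rw [← h0, Real.log_zero] at hl1; linarith
    · exact h0
  have hM1 : 1 ≤ Real.log (Real.log (T m)) := k1.trans a2
  have ht0 : 0 < Real.log (T m) := by nlinarith
  have hMt : Real.log (Real.log (T m)) ≤ Real.log (T m) := Real.log_le_self ht0.le
  set n : ℝ := (N m : ℝ)
  set l := Real.log n with hl
  set t := Real.log (T m) with ht
  set M := Real.log t with hM
  have hsq : (lambda2 (T m) / √(n * l)) ^ 2 = t / M / (n * l) := by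
    rw [weight_sq _ _ (by positivity), lambda2_sq _ (by positivity)]
  set β := lambda2 (T m) / √(n * l) with hβ
  have hln : l ≤ n := Real.log_le_self hn0.le
  -- A crude bound is enough, since only log(1/β) enters.
  have hβn : 1 / n ≤ β := by
    rw [← pow_le_pow_iff_left₀ (by positivity) hb0.le two_ne_zero, hsq, le_div_iff₀ (by positivity),
      le_div_iff₀ (by linarith)]
    have : (1 / n) ^ 2 * (n * l) = l / n := by field_simp
    rw [this]
    have : l / n ≤ 1 := (div_le_one hn0).2 hln
    nlinarith
  have hlog : Real.log ((1 + β) / β) ≤ 2 * l := by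
    have h2 : (1 + β) / β ≤ 2 * n := by
      rw [div_le_iff₀ hb0]
      have : 1 ≤ n * β := by rwa [div_le_iff₀ hn0, mul_comm] at hβn
      nlinarith
    have h3 := Real.log_le_log (by positivity) h2
    rw [Real.log_mul two_ne_zero hn0.ne'] at h3
    have := Real.log_two_lt_d9
    linarith
  have e1 : n * nullExcess (lam1 * l / n) β =
      lam1 * l + 4 * (t / M / l) * Real.log ((1 + β) / β) := by
    rw [nullExcess, hsq]
    field_simp
  rw [e1]
  have e2 : lam1 * l ≤ η / 2 * t := by
    have h2 := (mul_le_mul_of_nonneg_right k2 (by linarith : 0 ≤ l)).trans a5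
    rw [div_mul_eq_mul_div, div_le_iff₀ hη] at h2
    linarith
  -- The log N from log(1/β) cancels the one in β², and the log log T in λ₂² makes the term
  -- negligible.
  have e3 : 4 * (t / M / l) * Real.log ((1 + β) / β) ≤ η / 2 * t := by
    calc 4 * (t / M / l) * Real.log ((1 + β) / β) ≤ 4 * (t / M / l) * (2 * l) := by gcongr
      _ = 8 / M * t := by field_simp; ring
      _ ≤ η / 2 * t := by
          refine mul_le_mul_of_nonneg_right ?_ ht0.le
          rw [div_le_iff₀ (by linarith)]
          have h2 := k3.trans a2
          rw [div_le_iff₀ hη] at h2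
          linarith
  linarith

end Regime

/-! ### Large deviations of Poisson variables -/

/-- The Stirling sequence decreases, so its logarithm is bounded by that of its first term e / √2.
-/
theorem log_factorial_le {n : ℕ} (hn : n ≠ 0) :
    Real.log n.factorial ≤ n * Real.log n - n + Real.log (2 * n) / 2 + 1 := by
  obtain ⟨k, rfl⟩ := Nat.exists_eq_succ_of_ne_zero hn
  have h1 := Stirling.log_stirlingSeq'_antitone (Nat.zero_le k)
  simp only [Function.comp] at h1
  rw [Stirling.log_stirlingSeq_formula, Nat.succ_eq_add_one 0, zero_add,
    Stirling.stirlingSeq_one] at h1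
  have h2 : Real.log (Real.exp 1 / √2) ≤ 1 := by
    rw [Real.log_div (Real.exp_pos 1).ne' (by positivity), Real.log_exp]
    have : 0 ≤ Real.log √2 := Real.log_nonneg (by rw [Real.one_le_sqrt]; norm_num)
    linarith
  have hpos : (0 : ℝ) < (k.succ : ℕ) := by positivity
  rw [Real.log_div hpos.ne' (Real.exp_pos 1).ne', Real.log_exp] at h1
  linarith

/-- A single atom already carries the large deviation rate: by Stirling its log-probability divided
by L is bounded below by an expression converging to minus the rate, all corrections being of order
log L / L. -/
theorem eventually_poissonMeasure_singleton_ge {Λ k : ℝ} (hΛ : 0 < Λ) (hk : 0 < k) (f : ℝ → ℕ)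
    (hf : Tendsto (fun L => (f L : ℝ) / L) atTop (𝓝 k)) {η : ℝ} (hη : 0 < η) :
    ∀ᶠ L : ℝ in atTop, ∀ a : ℝ≥0, (a : ℝ) = Λ * L →
      Real.exp (-(Λ - k + k * Real.log (k / Λ) + η) * L) ≤ (poissonMeasure a).real {f L} := by
  have hlim : Tendsto (fun L => -Λ + (f L : ℝ) / L * (Real.log (Λ / ((f L : ℝ) / L)) + 1) -
      (Real.log (2 * ((f L : ℝ) / L)) / L + Real.log L / L) / 2 - 1 / L) atTop
      (𝓝 (-Λ + k * (Real.log (Λ / k) + 1) - (0 + 0) / 2 - 0)) := by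
    have h1 : Tendsto (fun L => Real.log (Λ / ((f L : ℝ) / L))) atTop (𝓝 (Real.log (Λ / k))) :=
      (tendsto_const_nhds.div hf hk.ne').log (div_pos hΛ hk).ne'
    have h2 : Tendsto (fun L => Real.log (2 * ((f L : ℝ) / L)) / L) atTop (𝓝 0) :=
      ((hf.const_mul 2).log (by positivity)).div_atTop tendsto_id
    have h3 : Tendsto (fun L : ℝ => Real.log L / L) atTop (𝓝 0) :=
      Real.isLittleO_log_id_atTop.tendsto_div_nhds_zero
    have h4 : Tendsto (fun L : ℝ => 1 / L) atTop (𝓝 0) :=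
      tendsto_const_nhds.div_atTop tendsto_id
    exact ((tendsto_const_nhds.add (hf.mul (h1.add_const 1))).sub ((h2.add h3).div_const 2)).sub h4
  have hlt : -(Λ - k + k * Real.log (k / Λ) + η) <
      -Λ + k * (Real.log (Λ / k) + 1) - (0 + 0) / 2 - 0 := by
    rw [← inv_div, Real.log_inv]
    linarith
  filter_upwards [hlim.eventually (lt_mem_nhds hlt), eventually_gt_atTop 0,
    hf.eventually (lt_mem_nhds hk)] with L hL hL0 hfL a ha
  have hf0 : (0 : ℝ) < f L := by
    have := (div_pos_iff_of_pos_right hL0).1 hfL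
    exact this
  have hfne : f L ≠ 0 := by
    rintro h; rw [h, Nat.cast_zero] at hf0; exact lt_irrefl _ hf0
  have ha0 : (0 : ℝ) < a := by rw [ha]; positivity
  have e0 : Real.log (Real.exp (-(a : ℝ)) * (a : ℝ) ^ f L / (f L).factorial) =
      -(a : ℝ) + f L * Real.log a - Real.log (f L).factorial := by
    rw [Real.log_div (by positivity) (by positivity),
      Real.log_mul (Real.exp_pos _).ne' (by positivity), Real.log_exp, Real.log_pow]
  rw [poissonMeasure_real_singleton, ← Real.log_le_log_iff (Real.exp_pos _) (by positivity),
    Real.log_exp, e0, ha]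
  have h1 := log_factorial_le hfne
  have e1 : Real.log (Λ / ((f L : ℝ) / L)) = Real.log (Λ * L) - Real.log (f L) := by
    rw [← Real.log_div (by positivity) hf0.ne']
    congr 1
    field_simp
  have e2 : Real.log (2 * ((f L : ℝ) / L)) = Real.log (2 * f L) - Real.log L := by
    rw [← Real.log_div (by positivity) hL0.ne']
    congr 1
    ring
  rw [e1, e2] at hL
  have h2 := mul_le_mul_of_nonneg_right hL.le hL0.le
  refine h2.trans ?_
  have e3 : (-Λ + (f L : ℝ) / L * (Real.log (Λ * L) - Real.log (f L) + 1) -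
      ((Real.log (2 * f L) - Real.log L) / L + Real.log L / L) / 2 - 1 / L) * L =
      -(Λ * L) + f L * (Real.log (Λ * L) - Real.log (f L) + 1) - Real.log (2 * f L) / 2 - 1 := by
    field_simp
    ring
  rw [e3]
  linarith

/-- A larger Poisson variable is a smaller one plus an independent one; this coupling yields the two
monotonicity lemmas below. -/
theorem poissonMeasure_add_apply (a c : ℝ≥0) (S : Set ℕ) :
    poissonMeasure (a + c) S =
      ((poissonMeasure a).prod (poissonMeasure c)) {x | x.1 + x.2 ∈ S} := by
  rw [← poissonMeasure_conv_poissonMeasure, Measure.conv,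
    Measure.map_apply (by fun_prop) (MeasurableSet.of_discrete)]
  rfl

theorem poissonMeasure_Iic_anti {a b : ℝ≥0} (hab : a ≤ b) (k : ℕ) :
    poissonMeasure b (Set.Iic k) ≤ poissonMeasure a (Set.Iic k) := by
  obtain ⟨c, rfl⟩ := exists_add_of_le hab
  rw [poissonMeasure_add_apply]
  calc _ ≤ ((poissonMeasure a).prod (poissonMeasure c)) (Set.Iic k ×ˢ Set.univ) := by
        refine measure_mono fun x hx => ⟨?_, trivial⟩
        simp only [Set.mem_ofPred_eq, Set.mem_Iic] at *
        omega
    _ = _ := by rw [Measure.prod_prod, measure_univ, mul_one]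

theorem poissonMeasure_Ici_mono {a b : ℝ≥0} (hab : a ≤ b) (k : ℕ) :
    poissonMeasure a (Set.Ici k) ≤ poissonMeasure b (Set.Ici k) := by
  obtain ⟨c, rfl⟩ := exists_add_of_le hab
  rw [poissonMeasure_add_apply]
  calc _ = ((poissonMeasure a).prod (poissonMeasure c)) (Set.Ici k ×ˢ Set.univ) := by
        rw [Measure.prod_prod, measure_univ, mul_one]
    _ ≤ _ := by
        refine measure_mono fun x hx => ?_
        have := hx.1
        simp only [Set.mem_ofPred_eq, Set.mem_Ici] at *
        omega

/-! ### Probability of small p-values under a change -/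

/-- Small p-values are likely enough for a gain of order `exp (s L)` in the exponential moment
of a score with a weight of order `exp (-γ L)`. -/
def LikelySmall (γ s L : ℝ) (P : Measure ℝ) : Prop :=
  ∃ p₀ q : ℝ, 0 < p₀ ∧ 0 ≤ q ∧ q ≤ P.real (Set.Iic p₀) ∧
    Real.exp (s * L) ≤ q * min 1 (Real.exp (-γ * L) / √p₀)

theorem LikelySmall.mono {γ s s' L : ℝ} {P : Measure ℝ} (h : LikelySmall γ s L P) (hs : s' ≤ s)
    (hL : 0 ≤ L) : LikelySmall γ s' L P := by
  obtain ⟨p₀, q, h1, h2, h3, h4⟩ := h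
  exact ⟨p₀, q, h1, h2, h3, (Real.exp_le_exp.2 (mul_le_mul_of_nonneg_right hs hL)).trans h4⟩

/-- The exponent of the probability that the two counts are `kA L` and `kB L`. -/
noncomputable def tiltCost (Λ r kA kB : ℝ) : ℝ :=
  (Λ - kA + kA * Real.log (kA / Λ)) + (r * Λ - kB + kB * Real.log (kB / (r * Λ)))

/-- The exponent of the p-value when the two counts are `kA L` and `kB L`. -/
noncomputable def tiltGain (z kA kB : ℝ) : ℝ :=
  -(kA * Real.log ((1 + z) / 2) + kB * Real.log ((1 + z) / (2 * z)))

/-- Force the counts to at most kA L and at least kB L. This has probability about exp(-L ·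
`tiltCost`) and makes the p-value at most 2 exp(-L · `tiltGain`), so the weight ratio contributes
min(0, `tiltGain`/2 - γ) to the exponent. Monotonicity in the means covers every a ≤ ΛL and b ≥ rΛL.
-/
theorem eventually_likelySmall_of_tilt {γ s₀ Λ r z kA kB : ℝ} (hΛ : 0 < Λ) (hr : 0 < r)
    (hz : 1 ≤ z) (hkA : 0 < kA) (hkB : 0 < kB)
    (hgap : s₀ < -tiltCost Λ r kA kB + min 0 (tiltGain z kA kB / 2 - γ)) :
    ∃ η > 0, ∀ᶠ L : ℝ in atTop, ∀ a b : ℝ≥0, (a : ℝ) ≤ Λ * L → r * Λ * L ≤ b →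
      LikelySmall γ (s₀ + η) L (pValueLaw half a b) := by
  set X := tiltGain z kA kB with hX
  set e := min 0 (X / 2 - γ) with he
  set g := -tiltCost Λ r kA kB + e - s₀ with hg
  have hg0 : 0 < g := by linarith
  refine ⟨g / 2, by positivity, ?_⟩
  have hA := eventually_poissonMeasure_singleton_ge hΛ hkA (fun L => ⌊kA * L⌋₊)
    (by simpa using tendsto_nat_floor_mul_div_atTop hkA.le)
    (show 0 < g / 8 by positivity)
  have hB := eventually_poissonMeasure_singleton_ge (mul_pos hr hΛ) hkB (fun L => ⌈kB * L⌉₊)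
    (by simpa using tendsto_nat_ceil_mul_div_atTop hkB.le)
    (show 0 < g / 8 by positivity)
  have hsq : ∀ᶠ L : ℝ in atTop, √2 ≤ Real.exp (g / 8 * L) :=
    (Real.tendsto_exp_atTop.comp (tendsto_id.const_mul_atTop (by positivity))).eventually_ge_atTop _
  filter_upwards [hA, hB, hsq, eventually_gt_atTop 0] with L hA hB hsq hL0 a b ha hb
  set A := ⌊kA * L⌋₊
  set B := ⌈kB * L⌉₊
  set qA := Real.exp (-(Λ - kA + kA * Real.log (kA / Λ) + g / 8) * L) with hqA
  set qB := Real.exp (-(r * Λ - kB + kB * Real.log (kB / (r * Λ)) + g / 8) * L) with hqB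
  set a' : ℝ≥0 := ⟨Λ * L, by positivity⟩ with ha'
  set b' : ℝ≥0 := ⟨r * Λ * L, by positivity⟩ with hb'
  have hPA : ENNReal.ofReal qA ≤ poissonMeasure a (Set.Iic A) := by
    have h1 := hA a' rfl
    calc ENNReal.ofReal qA ≤ poissonMeasure a' {A} := by
          rw [← ofReal_measureReal]; exact ENNReal.ofReal_le_ofReal h1
      _ ≤ poissonMeasure a' (Set.Iic A) := measure_mono (by simp)
      _ ≤ _ := poissonMeasure_Iic_anti (by exact_mod_cast ha) A
  have hPB : ENNReal.ofReal qB ≤ poissonMeasure b (Set.Ici B) := by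
    have h1 := hB b' rfl
    calc ENNReal.ofReal qB ≤ poissonMeasure b' {B} := by
          rw [← ofReal_measureReal]; exact ENNReal.ofReal_le_ofReal h1
      _ ≤ poissonMeasure b' (Set.Ici B) := measure_mono (by simp)
      _ ≤ _ := poissonMeasure_Ici_mono (by exact_mod_cast hb) B
  have hz0 : 0 < z := by linarith
  have hp : ((1 + z) / 2) ^ A * ((1 + z) / (2 * z)) ^ B ≤ Real.exp (-(X * L)) := by
    rw [← Real.log_le_iff_le_exp (by positivity), Real.log_mul (by positivity) (by positivity),
      Real.log_pow, Real.log_pow]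
    have l1 : 0 ≤ Real.log ((1 + z) / 2) := Real.log_nonneg (by linarith)
    have l2 : Real.log ((1 + z) / (2 * z)) ≤ 0 :=
      Real.log_nonpos (by positivity) (by rw [div_le_one (by positivity)]; linarith)
    have h1 : (A : ℝ) ≤ kA * L := Nat.floor_le (by positivity)
    have h2 : kB * L ≤ B := Nat.le_ceil _
    have h3 := mul_le_mul_of_nonneg_right h1 l1
    have h4 := mul_le_mul_of_nonpos_right h2 l2
    rw [hX, tiltGain]
    linarith
  refine ⟨2 * Real.exp (-(X * L)), qA * qB, by positivity, by positivity, ?_, ?_⟩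
  · rw [← ENNReal.ofReal_le_ofReal_iff measureReal_nonneg, ofReal_measureReal,
      ENNReal.ofReal_mul (Real.exp_pos _).le]
    refine (mul_le_mul' hPA hPB).trans ((pValueLaw_half_Iic_ge a b z hz A B).trans
      (measure_mono (Set.Iic_subset_Iic.2 ?_)))
    exact mul_le_mul_of_nonneg_left hp two_pos.le
  · have hs : √(2 * Real.exp (-(X * L))) = √2 * Real.exp (-(X * L) / 2) := by
      rw [Real.sqrt_mul two_pos.le, ← Real.exp_half]
    have hmin : Real.exp (e * L - g / 8 * L) ≤
        min 1 (Real.exp (-γ * L) / √(2 * Real.exp (-(X * L)))) := by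
      have he0 : e ≤ 0 := min_le_left _ _
      have he1 : e ≤ X / 2 - γ := min_le_right _ _
      refine le_min ?_ ?_
      · rw [Real.exp_le_one_iff]
        nlinarith
      · rw [hs, le_div_iff₀ (by positivity)]
        calc Real.exp (e * L - g / 8 * L) * (√2 * Real.exp (-(X * L) / 2))
            ≤ Real.exp (e * L - g / 8 * L) * (Real.exp (g / 8 * L) * Real.exp (-(X * L) / 2)) := by
              gcongr
          _ = Real.exp (e * L - X * L / 2) := by
              rw [← Real.exp_add, ← Real.exp_add]; congr 1; ring
          _ ≤ _ := by
              rw [Real.exp_le_exp]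
              nlinarith
    -- Of the gap g, each of the two atom probabilities and the constant √2 uses g/8, which leaves
    -- more than g/2.
    calc Real.exp ((s₀ + g / 2) * L) ≤ qA * qB * Real.exp (e * L - g / 8 * L) := by
          rw [hqA, hqB, ← Real.exp_add, ← Real.exp_add, Real.exp_le_exp, tiltCost.eq_1] at *
          rw [show g / 2 = g - g / 2 by ring]
          nlinarith
      _ ≤ _ := by gcongr

/-! ### The optimal tilt -/

theorem one_add_lt_two_mul_powerMean {r ω : ℝ} (hr : 1 < r) (hω : 1 < ω) :
    1 + r < 2 * powerMean r ω := by
  have hr0 : 0 < r := by linarith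
  have h1 := (strictConvexOn_rpow hω).2 (show (1 : ℝ) ∈ Set.Ici (0 : ℝ) by simp)
    (show r ∈ Set.Ici (0 : ℝ) from hr0.le) hr.ne (show (0 : ℝ) < 1 / 2 by norm_num)
    (show (0 : ℝ) < 1 / 2 by norm_num) (by norm_num)
  simp only [smul_eq_mul, Real.one_rpow] at h1
  have h2 : ((1 + r) / 2) ^ ω < (1 + r ^ ω) / 2 := by
    have e1 : (1 + r) / 2 = 1 / 2 * 1 + 1 / 2 * r := by ring
    rw [e1]
    linarith
  have h3 := Real.rpow_lt_rpow (by positivity) h2 (show 0 < 1 / ω by positivity)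
  rw [← Real.rpow_mul (by positivity), mul_one_div_cancel (by linarith), Real.rpow_one] at h3
  rw [powerMean]
  linarith

theorem powerMean_one (r : ℝ) : powerMean r 1 = (1 + r) / 2 := by
  simp [powerMean]

theorem continuousOn_powerMean {r : ℝ} (hr : 0 < r) :
    ContinuousOn (powerMean r) (Set.Ioi 0) := by
  unfold powerMean
  refine ContinuousOn.rpow ?_ ?_ ?_
  · exact ((continuousOn_const.add (Continuous.continuousOn
      (Real.continuous_const_rpow hr.ne')))).div_const _
  · exact continuousOn_const.div continuousOn_id fun x hx => (ne_of_gt hx)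
  · intro x _
    exact Or.inl (by positivity)

/-- The supremum is attained or approached inside a compact interval: the quotient is continuous
also at the excluded left end, because that end exceeds 1 and the denominator is positive there. -/
theorem le_rho {r β ζ : ℝ} (hr : 1 < r) (h0 : 0 < β) (h1 : β < 1 - ζ) {ω : ℝ}
    (hω : ω ∈ Set.Ioc ((1 - ζ) / β) 2) :
    (β - ω⁻¹ * (1 - ζ)) / (2 * powerMean r ω - 1 - r) ≤ rho r β ζ := by
  have hω0 : 1 < (1 - ζ) / β := (one_lt_div h0).2 h1
  refine le_csSup ?_ ⟨ω, hω, rfl⟩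
  have hcont : ContinuousOn (fun ω : ℝ => (β - ω⁻¹ * (1 - ζ)) / (2 * powerMean r ω - 1 - r))
      (Set.Icc ((1 - ζ) / β) 2) := by
    refine ContinuousOn.div ?_ ?_ ?_
    · refine continuousOn_const.sub (ContinuousOn.mul ?_ continuousOn_const)
      exact continuousOn_inv₀.mono fun x hx => by
        have := hx.1
        exact (show x ≠ 0 by linarith)
    · refine ((continuousOn_const.mul ((continuousOn_powerMean (by linarith)).mono ?_)).sub
        continuousOn_const).sub continuousOn_const
      intro x hx
      have := hx.1
      exact (show 0 < x by linarith)
    · intro x hx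
      have := one_add_lt_two_mul_powerMean hr (hω0.trans_le hx.1)
      linarith
  exact (isCompact_Icc.bddAbove_image hcont).mono (Set.image_mono Set.Ioc_subset_Icc_self)

theorem rho_pos {r β ζ : ℝ} (hr : 1 < r) (h0 : (1 - ζ) / 2 < β) (h1 : β < 1 - ζ) :
    0 < rho r β ζ := by
  have hβ : 0 < β := by linarith
  refine lt_of_lt_of_le ?_ (le_rho hr hβ h1 (ω := 2) ⟨by rw [div_lt_iff₀ hβ]; linarith, le_rfl⟩)
  have := one_add_lt_two_mul_powerMean hr one_lt_two
  exact div_pos (by linarith) (by linarith)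

/-- Extends the inequality behind ρ to all of [1, 2]: for ω ≤ (1 - ζ)/β the left side is not
positive. The full interval is needed because `exists_tilt` does not control where its ω lies. -/
theorem lt_mul_powerMean {r β ζ Λ : ℝ} (hr : 1 < r) (h0 : (1 - ζ) / 2 < β)
    (h1 : β < 1 - ζ) (hΛ : rho r β ζ < Λ) {ω : ℝ} (hω1 : 1 ≤ ω) (hω2 : ω ≤ 2) :
    β - ω⁻¹ * (1 - ζ) < Λ * (2 * powerMean r ω - 1 - r) := by
  have hβ : 0 < β := by linarith
  have hΛ0 : 0 < Λ := (rho_pos hr h0 h1).trans hΛ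
  rcases hω1.eq_or_lt with rfl | hω1
  · rw [powerMean_one]
    have : 2 * ((1 + r) / 2) - 1 - r = 0 := by ring
    rw [this]
    simp; linarith
  have hpos : 0 < 2 * powerMean r ω - 1 - r := by
    linarith [one_add_lt_two_mul_powerMean hr hω1]
  rcases lt_or_ge ((1 - ζ) / β) ω with h | h
  · have h2 := (le_rho hr hβ h1 ⟨h, hω2⟩).trans_lt hΛ
    rwa [div_lt_iff₀ hpos] at h2
  · have h2 : β - ω⁻¹ * (1 - ζ) ≤ 0 := by
      rw [le_div_iff₀ hβ] at h
      rw [sub_nonpos, inv_mul_eq_div, le_div_iff₀ (by linarith)]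
      linarith
    exact h2.trans_lt (mul_pos hΛ0 hpos)

/-- The factor by which the optimal tilt scales the smaller mean. -/
noncomputable def tiltFactor (r ω : ℝ) : ℝ := ((1 + r ^ ω) / 2) ^ (-(1 - ω⁻¹))

theorem tiltFactor_pos {r : ℝ} (hr : 0 < r) (ω : ℝ) : 0 < tiltFactor r ω := by
  unfold tiltFactor
  positivity

theorem tiltGain_tiltFactor {r Λ ω : ℝ} :
    tiltGain (r ^ ω) (tiltFactor r ω * Λ) (tiltFactor r ω * r ^ ω * Λ) =
      Λ * (tiltFactor r ω * largeDev (r ^ ω)) := by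
  rw [largeDev_eq, tiltGain]
  ring

/-- For z = r^ω these counts are the stationary point of `tiltCost` - (1 - 1/ω) `tiltGain`, and the
value there is -Λ(2 g_r(ω) - 1 - r). The key identity is that the two factors sum to 2 g_r(ω). -/
theorem tiltCost_tiltFactor {r Λ ω : ℝ} (hr : 0 < r) (hΛ : 0 < Λ) (hω : 0 < ω) :
    tiltCost Λ r (tiltFactor r ω * Λ) (tiltFactor r ω * r ^ ω * Λ) =
      (1 - ω⁻¹) * (Λ * (tiltFactor r ω * largeDev (r ^ ω))) -
        Λ * (2 * powerMean r ω - 1 - r) := by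
  have hz : 0 < r ^ ω := Real.rpow_pos_of_pos hr _
  have hκ := tiltFactor_pos hr ω
  have hpm : tiltFactor r ω * (1 + r ^ ω) = 2 * powerMean r ω := by
    have h1 : powerMean r ω = tiltFactor r ω * ((1 + r ^ ω) / 2) := by
      rw [powerMean, tiltFactor]
      nth_rewrite 3 [← Real.rpow_one ((1 + r ^ ω) / 2)]
      rw [← Real.rpow_add (by positivity)]
      congr 1
      rw [one_div]; ring
    rw [h1]; ring
  have hlκ : Real.log (tiltFactor r ω) = -(1 - ω⁻¹) * Real.log ((1 + r ^ ω) / 2) := by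
    rw [tiltFactor, Real.log_rpow (by positivity)]
  have h2 : Real.log ((1 + r ^ ω) / (2 * r ^ ω)) =
      Real.log ((1 + r ^ ω) / 2) - ω * Real.log r := by
    rw [← Real.log_rpow hr, ← Real.log_div (by positivity) hz.ne']
    congr 1
    field_simp
  have h3 : Real.log (tiltFactor r ω * Λ / Λ) = Real.log (tiltFactor r ω) := by
    rw [mul_div_cancel_right₀ _ hΛ.ne']
  have h4 : Real.log (tiltFactor r ω * r ^ ω * Λ / (r * Λ)) =
      Real.log (tiltFactor r ω) + (ω - 1) * Real.log r := by
    rw [mul_div_mul_right _ _ hΛ.ne', Real.log_div (by positivity) hr.ne',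
      Real.log_mul hκ.ne' hz.ne', Real.log_rpow hr]
    ring
  have h5 : (ω - 1) * Real.log r = (1 - ω⁻¹) * (ω * Real.log r) := by
    field_simp
  rw [tiltCost, h3, h4, h5, largeDev_eq, h2, hlκ]
  linear_combination (-Λ) * hpm

theorem continuousOn_tiltFactor_mul_largeDev {r : ℝ} (hr : 0 < r) :
    ContinuousOn (fun ω => tiltFactor r ω * largeDev (r ^ ω)) (Set.Icc 1 2) := by
  have hz : Continuous fun ω : ℝ => r ^ ω := Real.continuous_const_rpow hr.ne'
  have hpos : ∀ ω : ℝ, 0 < r ^ ω := fun ω => Real.rpow_pos_of_pos hr ω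
  refine ContinuousOn.mul ?_ (Continuous.continuousOn ?_)
  · unfold tiltFactor
    refine ContinuousOn.rpow (Continuous.continuousOn (by fun_prop)) ?_ fun x _ => Or.inl
      (by have := hpos x; positivity)
    refine (continuousOn_const.sub (continuousOn_inv₀.mono fun x hx => ?_)).neg
    have := hx.1
    exact (show x ≠ 0 by linarith)
  · unfold largeDev
    refine (hz.mul (Continuous.log (Continuous.div (by fun_prop) (by fun_prop) ?_) ?_)).add
      (Continuous.log (Continuous.div (by fun_prop) (by fun_prop) ?_) ?_)
    all_goals
      intro x
      have := hpos x
    · exact (add_pos this one_pos).ne'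
    · exact (div_pos (by linarith) (add_pos this one_pos)).ne'
    · exact (add_pos this one_pos).ne'
    · exact (div_pos two_pos (add_pos this one_pos)).ne'

/-- The gain beyond 1 - ζ is useless because the weight ratio is capped at 1, and below 1 - ζ it is
worth half of itself. Hence the multiplier 1 - 1/ω is 1/2 when the cap is out of reach, 0 when the
untilted gain exceeds it, and otherwise tuned so that the gain hits the cap exactly. -/
theorem exists_tilt {r β ζ Λ : ℝ} (hr : 1 < r) (h0 : (1 - ζ) / 2 < β)
    (h1 : β < 1 - ζ) (hΛ : rho r β ζ < Λ) :
    ∃ z kA kB : ℝ, 1 ≤ z ∧ 0 < kA ∧ 0 < kB ∧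
      ζ - 1 + β < -tiltCost Λ r kA kB + min 0 (tiltGain z kA kB / 2 - (1 - ζ) / 2) := by
  have hr0 : 0 < r := by linarith
  have hΛ0 : 0 < Λ := (rho_pos hr h0 h1).trans hΛ
  set J : ℝ → ℝ := fun ω => tiltFactor r ω * largeDev (r ^ ω) with hJ
  suffices h : ∃ ω : ℝ, 1 ≤ ω ∧ ω ≤ 2 ∧
      ζ - 1 + β < Λ * (2 * powerMean r ω - 1 - r) - (1 - ω⁻¹) * (Λ * J ω) +
        min 0 (Λ * J ω / 2 - (1 - ζ) / 2) by
    obtain ⟨ω, hω1, hω2, hω⟩ := h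
    have hz : 0 < r ^ ω := Real.rpow_pos_of_pos hr0 _
    have hκ := tiltFactor_pos hr0 ω
    refine ⟨r ^ ω, tiltFactor r ω * Λ, tiltFactor r ω * r ^ ω * Λ,
      Real.one_le_rpow hr.le (by linarith), by positivity, by positivity, ?_⟩
    rw [tiltCost_tiltFactor hr0 hΛ0 (by linarith), tiltGain_tiltFactor]
    linarith
  rcases le_or_gt (Λ * J 2) (1 - ζ) with h2 | h2
  -- At ω = 2 the cost and the benefit of the gain cancel.
  · refine ⟨2, one_le_two, le_rfl, ?_⟩
    have h3 := lt_mul_powerMean hr h0 h1 hΛ one_le_two le_rfl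
    rw [min_eq_right (by linarith)]
    norm_num at h3 ⊢
    linarith
  rcases le_or_gt (Λ * J 1) (1 - ζ) with h3 | h3
  · have hivt := intermediate_value_Icc (one_le_two : (1 : ℝ) ≤ 2)
      ((continuousOn_tiltFactor_mul_largeDev hr0).const_mul Λ)
    obtain ⟨ω, hω, hωe⟩ := hivt ⟨h3, h2.le⟩
    have hωe' : Λ * J ω = 1 - ζ := hωe
    refine ⟨ω, hω.1, hω.2, ?_⟩
    have h4 := lt_mul_powerMean hr h0 h1 hΛ hω.1 hω.2
    rw [hωe', sub_self, min_self]
    linarith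
  -- At ω = 1 there is no tilt and no cost; the claim is β < 1 - ζ.
  · refine ⟨1, le_rfl, one_le_two, ?_⟩
    rw [min_eq_left (by linarith), powerMean_one]
    simp
    linarith

/-! ### Small p-values above the detection boundary -/

/-- A tilt chosen for Λ' handles all a between (r/r')Λ'L and Λ'L, because b ≥ r' a ≥ rΛ'L. Finitely
many such geometric cells cover a bounded range of means with a common η. -/
theorem eventually_likelySmall_of_le {r r' β ζ Λ : ℝ} (hr : 1 < r) (hr' : r < r')
    (h0 : (1 - ζ) / 2 < β) (h1 : β < 1 - ζ) (hΛ : rho r β ζ < Λ) (K : ℕ) :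
    ∃ η > 0, ∀ᶠ L : ℝ in atTop, ∀ a b : ℝ≥0, Λ * L ≤ a → a ≤ Λ * (r' / r) ^ K * L → r' * a ≤ b →
      LikelySmall ((1 - ζ) / 2) (ζ - 1 + β + η) L (pValueLaw half a b) := by
  have hr0 : 0 < r := by linarith
  have hΛ0 : 0 < Λ := (rho_pos hr h0 h1).trans hΛ
  have hg : 1 < r' / r := (one_lt_div hr0).2 hr'
  induction K with
  | zero =>
    obtain ⟨z, kA, kB, hz, hkA, hkB, hgap⟩ := exists_tilt hr h0 h1 hΛ
    obtain ⟨η, hη, hev⟩ := eventually_likelySmall_of_tilt hΛ0 hr0 hz hkA hkB hgap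
    refine ⟨η, hη, ?_⟩
    filter_upwards [hev, eventually_ge_atTop 0] with L hL hL0 a b ha ha' hb
    rw [pow_zero, mul_one] at ha'
    refine hL a b ha' (le_trans ?_ hb)
    calc r * Λ * L = r * (Λ * L) := by ring
      _ ≤ r' * a := mul_le_mul hr'.le ha (by positivity) (by linarith)
  | succ K ih =>
    obtain ⟨η₁, hη₁, hev₁⟩ := ih
    have hΛ' : rho r β ζ < Λ * (r' / r) ^ (K + 1) :=
      hΛ.trans_le (le_mul_of_one_le_right hΛ0.le (one_le_pow₀ hg.le))
    obtain ⟨z, kA, kB, hz, hkA, hkB, hgap⟩ := exists_tilt hr h0 h1 hΛ'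
    obtain ⟨η₂, hη₂, hev₂⟩ :=
      eventually_likelySmall_of_tilt (by positivity) hr0 hz hkA hkB hgap
    refine ⟨min η₁ η₂, lt_min hη₁ hη₂, ?_⟩
    filter_upwards [hev₁, hev₂, eventually_ge_atTop 0] with L hL₁ hL₂ hL0 a b ha ha' hb
    rcases le_total (a : ℝ) (Λ * (r' / r) ^ K * L) with h | h
    · exact (hL₁ a b ha h hb).mono (by linarith [min_le_left η₁ η₂]) hL0
    · refine (hL₂ a b ha' (le_trans ?_ hb)).mono (by linarith [min_le_right η₁ η₂]) hL0
      calc r * (Λ * (r' / r) ^ (K + 1)) * L = r' * (Λ * (r' / r) ^ K * L) := by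
            rw [pow_succ]; field_simp
        _ ≤ r' * a := by
            have : 0 < r' := by linarith
            gcongr

/-- For means this large a typical p-value is already of order exp(-(1 - ζ)L), where the weight
ratio is of constant order. A constant beats the target because its exponent is negative. -/
theorem eventually_likelySmall_of_ge {r r' β ζ : ℝ} (hr : 1 < r) (hr' : r < r') (h1 : β < 1 - ζ)
    (hζ : ζ < 1) :
    ∃ η > 0, ∀ᶠ L : ℝ in atTop, ∀ a b : ℝ≥0, (1 - ζ) / largeDev r * L ≤ a → r' * a ≤ b →
      LikelySmall ((1 - ζ) / 2) (ζ - 1 + β + η) L (pValueLaw half a b) := by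
  obtain ⟨κ, hκ, hP⟩ := exists_pValueLaw_half_Ioi_le hr hr'
  have hI := largeDev_pos hr
  refine ⟨(1 - ζ - β) / 2, by linarith, ?_⟩
  have e1 : ∀ᶠ L : ℝ in atTop, Real.exp (-(κ * ((1 - ζ) / largeDev r) * L)) ≤ 1 / 2 := by
    have hpos : 0 < κ * ((1 - ζ) / largeDev r) := mul_pos hκ (div_pos (by linarith) hI)
    exact (Real.tendsto_exp_neg_atTop_nhds_zero.comp
      (tendsto_id.const_mul_atTop hpos)).eventually (ge_mem_nhds (by norm_num))
  have e2 : ∀ᶠ L : ℝ in atTop, Real.exp (-((1 - ζ - β) / 2 * L)) ≤ 1 / 4 :=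
    (Real.tendsto_exp_neg_atTop_nhds_zero.comp
      (tendsto_id.const_mul_atTop (by linarith))).eventually (ge_mem_nhds (by norm_num))
  filter_upwards [e1, e2, eventually_ge_atTop 0] with L h2 h3 hL0 a b ha hb
  set p₀ := 2 * Real.exp (-((1 - ζ) * L)) with hp₀
  have hle : 2 * Real.exp (-(a * largeDev r)) ≤ p₀ := by
    rw [hp₀]
    have h4 := mul_le_mul_of_nonneg_right ha hI.le
    have h5 : (1 - ζ) / largeDev r * L * largeDev r = (1 - ζ) * L := by field_simp
    rw [h5] at h4
    gcongr
  have htail : (pValueLaw half a b).real (Set.Ioi p₀) ≤ 1 / 2 := by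
    rw [measureReal_def]
    refine ENNReal.toReal_le_of_le_ofReal (by norm_num) ?_
    refine (measure_mono (Set.Ioi_subset_Ioi hle)).trans ((hP a b hb).trans
      (ENNReal.ofReal_le_ofReal (le_trans ?_ h2)))
    rw [Real.exp_le_exp, neg_le_neg_iff, mul_assoc]
    exact mul_le_mul_of_nonneg_left ha hκ.le
  have hsq : √p₀ = √2 * Real.exp (-((1 - ζ) / 2) * L) := by
    rw [hp₀, Real.sqrt_mul two_pos.le, ← Real.exp_half]
    congr 2
    ring
  refine ⟨p₀, 1 / 2, by positivity, by norm_num, ?_, ?_⟩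
  · have := probReal_add_probReal_compl (μ := pValueLaw half a b) (measurableSet_Ioi (a := p₀))
    rw [Set.compl_Ioi] at this
    linarith
  · have hmin : 1 / 2 ≤ min 1 (Real.exp (-((1 - ζ) / 2) * L) / √p₀) := by
      refine le_min (by norm_num) ?_
      rw [hsq, div_mul_cancel_right₀ (Real.exp_pos _).ne', one_div]
      refine inv_anti₀ (by positivity) ?_
      rw [Real.sqrt_le_left two_pos.le]
      norm_num
    calc Real.exp ((ζ - 1 + β + (1 - ζ - β) / 2) * L) = Real.exp (-((1 - ζ - β) / 2 * L)) := by
          congr 1; ring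
      _ ≤ 1 / 2 * (1 / 2) := h3.trans (by norm_num)
      _ ≤ _ := by gcongr

theorem eventually_likelySmall {r r' β ζ Λ : ℝ} (hr : 1 < r) (hr' : r < r')
    (h0 : (1 - ζ) / 2 < β) (h1 : β < 1 - ζ) (hΛ : rho r β ζ < Λ) :
    ∃ η > 0, ∀ᶠ L : ℝ in atTop, ∀ a b : ℝ≥0, Λ * L ≤ a → r' * a ≤ b →
      LikelySmall ((1 - ζ) / 2) (ζ - 1 + β + η) L (pValueLaw half a b) := by
  have hr0 : 0 < r := by linarith
  have hΛ0 : 0 < Λ := (rho_pos hr h0 h1).trans hΛ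
  obtain ⟨K, hK⟩ := pow_unbounded_of_one_lt ((1 - ζ) / largeDev r / Λ) ((one_lt_div hr0).2 hr')
  rw [div_lt_iff₀ hΛ0, mul_comm] at hK
  obtain ⟨η₁, hη₁, hev₁⟩ := eventually_likelySmall_of_le hr hr' h0 h1 hΛ K
  obtain ⟨η₂, hη₂, hev₂⟩ := eventually_likelySmall_of_ge hr hr' h1 (by linarith)
  refine ⟨min η₁ η₂, lt_min hη₁ hη₂, ?_⟩
  filter_upwards [hev₁, hev₂, eventually_ge_atTop 0] with L hL₁ hL₂ hL0 a b ha hb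
  rcases le_total (a : ℝ) (Λ * (r' / r) ^ K * L) with h | h
  · exact (hL₁ a b ha h hb).mono (by linarith [min_le_left η₁ η₂]) hL0
  · refine (hL₂ a b (le_trans ?_ h) hb).mono (by linarith [min_le_right η₁ η₂]) hL0
    gcongr

/-- The spare η in the exponent pays for a weight as small as exp(-(γ + η)L) instead of exp(-γL). -/
theorem LikelySmall.lintegral_inv_likRatio_le {γ s η L α β : ℝ} {a b : ℝ≥0}
    (h : LikelySmall γ (s + η) L (pValueLaw half a b)) (hη : 0 ≤ η) (hL : 0 ≤ L)
    (hα : 0 ≤ α) (hα' : α ≤ 1 / 10) (hβ : Real.exp (-(γ + η) * L) ≤ β) (hβ' : β ≤ 1 / 10) :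
    ∫⁻ p, ENNReal.ofReal (likRatio α β p)⁻¹ ∂pValueLaw half a b ≤
      ENNReal.ofReal (Real.exp (-(Real.exp (s * L) / 2 - α - 4 * β))) := by
  obtain ⟨p₀, q, hp₀, hq, hqP, hexp⟩ := h
  have hβ0 : 0 < β := (Real.exp_pos _).trans_le hβ
  refine (lintegral_inv_likRatio_le_of_small hα hα' hβ0 hβ' _
    (ae_pValueLaw_mem_Ioc half (by norm_num) (by norm_num) _ _) hp₀ hqP).trans (ENNReal.ofReal_le_ofReal (Real.exp_le_exp.2 ?_))
  have hη1 : Real.exp (-η * L) ≤ 1 := by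
    rw [Real.exp_le_one_iff]
    nlinarith
  have hmin : Real.exp (-η * L) * min 1 (Real.exp (-γ * L) / √p₀) ≤ min 1 (β / √p₀) := by
    refine le_min (mul_le_one₀ hη1 (by positivity) (min_le_left _ _)) ?_
    calc Real.exp (-η * L) * min 1 (Real.exp (-γ * L) / √p₀)
        ≤ Real.exp (-η * L) * (Real.exp (-γ * L) / √p₀) := by gcongr; exact min_le_right _ _
      _ = Real.exp (-(γ + η) * L) / √p₀ := by
          rw [← mul_div_assoc, ← Real.exp_add]; congr 2; ring
      _ ≤ _ := by gcongr
  have h2 : Real.exp (s * L) ≤ q * min 1 (β / √p₀) := by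
    calc Real.exp (s * L) = Real.exp (-η * L) * Real.exp ((s + η) * L) := by
          rw [← Real.exp_add]; congr 1; ring
      _ ≤ Real.exp (-η * L) * (q * min 1 (Real.exp (-γ * L) / √p₀)) := by gcongr
      _ = q * (Real.exp (-η * L) * min 1 (Real.exp (-γ * L) / √p₀)) := by ring
      _ ≤ _ := by gcongr
  linarith

/-! ### Vanishing errors -/

/-- A scale that fits between change-points and whose windows, when shifted by a spacing, retain
most of the change. -/
theorem exists_detecting_scale {h d : ℕ → ℕ} (hh : StrictMonoOn h (Set.Ici 1)) (hh1 : 1 ≤ h 1)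
    (hratio : Tendsto (fun i => (h (i + 1) : ℝ) / (h i : ℝ)) atTop (𝓝 1))
    (hdo : (fun i => (d i : ℝ)) =o[atTop] fun i => (h i : ℝ)) {r E η : ℝ} (hr : 1 < r)
    (hrE : r < E) (hη : 0 < η) (hη1 : η < 1) :
    ∃ r' > r, ∀ᶠ x : ℝ in atTop, ∃ i, 1 ≤ i ∧ (h i : ℝ) + d i ≤ x ∧ (1 - η) * x ≤ h i ∧
      r' * (h i + d i * (E - 1)) ≤ E * h i := by
  obtain ⟨r', hr', hrE'⟩ := exists_between hrE
  refine ⟨r', hr', ?_⟩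
  have hr0 : 0 < r' := by linarith
  -- With d_i at most this multiple of h_i, h_i + d_i(E - 1) is at most E h_i / r', which is the
  -- required retention of the ratio.
  have hδ : 0 < (E / r' - 1) / (E - 1) :=
    div_pos (sub_pos.2 ((one_lt_div hr0).2 hrE')) (by linarith)
  filter_upwards [exists_scale hh hh1 hratio hdo (lt_min hη hδ) ((min_le_left _ _).trans_lt hη1),
    eventually_ge_atTop 0] with x ⟨i, hi1, hi2, hi3, hi4⟩ hx
  refine ⟨i, hi1, hi2, le_trans ?_ hi3, ?_⟩
  · have := min_le_left η ((E / r' - 1) / (E - 1))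
    gcongr
  · have h1 : (d i : ℝ) ≤ (E / r' - 1) / (E - 1) * h i :=
      hi4.trans (by gcongr; exact min_le_right _ _)
    have h2 : (d i : ℝ) * (E - 1) ≤ (E / r' - 1) * h i := by
      have := mul_le_mul_of_nonneg_right h1 (by linarith : 0 ≤ E - 1)
      have e : (E / r' - 1) / (E - 1) * h i * (E - 1) = (E / r' - 1) * h i := by
        have : E - 1 ≠ 0 := by linarith
        field_simp
      linarith
    calc r' * (h i + d i * (E - 1)) ≤ r' * (h i + (E / r' - 1) * h i) := by gcongr
      _ = E * h i := by field_simp; ring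

theorem eventually_typeI_le {ζ : ℝ} {N T : ℕ → ℕ} (hζ0 : 0 < ζ) (hζ1 : ζ ≤ 1)
    (hN : Tendsto N atTop atTop) (hT : Tendsto T atTop atTop)
    (hNT : (fun m => Real.log (T m)) ~[atTop] fun m => (N m : ℝ) ^ ζ)
    (ν : ∀ m, Measure (Randomizers (N m)))
    (hν : ∀ m w, (ν m).map (fun ξ n => ξ n w) =
      Measure.pi fun _ : Fin (N m) => (volume : Measure I)) (μ₀ : ℝ)
    {h d : ℕ → ℕ} (hd1 : ∀ i, 1 ≤ i → 1 ≤ d i) (hdh : ∀ i, 1 ≤ i → d i ≤ h i)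
    {c : ℕ → ℝ} (hc : Tendsto (fun t => c t - logWindowSum h d t) atTop atTop)
    {lam1 : ℝ} (hlam1 : 0 < lam1) {e : ℝ} (he : 0 < e) :
    ∀ᶠ m in atTop, ∀ μ ∈ Lam₀ (N m) (T m) μ₀, dataLaw (N m) (T m) (ν m) μ
      {ω | (estimatedChangePoints h d lam1 (lambda2 (T m)) (c (T m)) ω).Nonempty} ≤
        ENNReal.ofReal e := by
  have hlim := (Real.tendsto_exp_neg_atTop_nhds_zero.comp (hc.comp hT)).eventually
    (ge_mem_nhds (half_pos he))
  filter_upwards [eventually_smallWeights hζ0 hζ1 hN hT hNT hlam1, hlim] with m hS hm μ hμ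
  refine (typeI_error_le hS.pos₁.le hS.le₁ hS.pos₂.le hS.le₂ (ν m) (hν m) hd1 hdh μ hμ.2 _).trans
    (ENNReal.ofReal_le_ofReal ?_)
  simp only [Function.comp, neg_sub] at hm
  linarith

theorem eventually_log_two_add_le {η : ℝ} (hη0 : 0 < η) :
    ∀ᶠ x : ℝ in atTop, 1 + 2 * Real.log (2 + x) ≤ η / 2 * x := by
  have h1 : Tendsto (fun x : ℝ => 1 / x + 2 * (Real.log (2 + x) / (2 + x) * ((2 + x) / x)))
      atTop (𝓝 (0 + 2 * (0 * 1))) := by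
    have k1 : Tendsto (fun x : ℝ => Real.log (2 + x) / (2 + x)) atTop (𝓝 0) :=
      (Real.isLittleO_log_id_atTop.tendsto_div_nhds_zero).comp
        (tendsto_atTop_add_const_left _ 2 tendsto_id)
    have k2 : Tendsto (fun x : ℝ => (2 + x) / x) atTop (𝓝 1) := by
      have : Tendsto (fun x : ℝ => 2 / x + 1) atTop (𝓝 (0 + 1)) :=
        (tendsto_const_nhds.div_atTop tendsto_id).add_const 1
      rw [zero_add] at this
      refine this.congr' ?_
      filter_upwards [eventually_gt_atTop 0] with x hx
      field_simp
    exact (tendsto_const_nhds.div_atTop tendsto_id).add ((k1.mul k2).const_mul 2)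
  rw [zero_mul, mul_zero, zero_add] at h1
  filter_upwards [h1.eventually (ge_mem_nhds (half_pos hη0)), eventually_gt_atTop 0] with x hx hx0
  have h2 := mul_le_mul_of_nonneg_right hx hx0.le
  refine le_trans (le_of_eq ?_) h2
  field_simp

/-- The product of V and the distance is of order log T ≈ N^ζ, so V = o(N^ζ / log N) forces the
distance to dominate log N. This is why the term -log α ≈ log N is negligible in each score. -/
theorem eventually_le_minDistance {ζ : ℝ} {N T : ℕ → ℕ} (hζ0 : 0 < ζ) (hζ1 : ζ ≤ 1)
    (hN : Tendsto N atTop atTop) (hT : Tendsto T atTop atTop)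
    (hNT : (fun m => Real.log (T m)) ~[atTop] fun m => (N m : ℝ) ^ ζ)
    {μ₀ r : ℝ} (hμ₀ : 0 < μ₀) (hr1 : 1 < r) {V : ℕ → ℕ} {hmin : ℕ → ℝ} {ε : ℝ} (hε : 0 < ε)
    (hV : (fun m => (V m : ℝ)) =o[atTop] (fun m => (N m : ℝ) ^ ζ / Real.log (N m)))
    (hhV : ∀ᶠ m in atTop, hmin m * V m * largeDev r * μ₀ = (1 + ε) * Real.log (T m))
    {K : ℝ} (hK : 0 < K) :
    ∀ᶠ m in atTop, 0 < (V m : ℝ) ∧ V m * K * Real.log (N m) ≤ Real.log (T m) ∧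
      K * Real.log (N m) ≤ hmin m := by
  have hI := largeDev_pos hr1
  set θ := 1 / (2 * (K * (1 + largeDev r * μ₀))) with hθ
  have hθ0 : 0 < θ := by positivity
  filter_upwards [hV.bound hθ0, hhV, eventually_regime hζ0 hζ1 hN hT hNT 1]
    with m h1 h2 ⟨a1, a2, a3, a4, a5, a6⟩
  have hT0 : 0 < Real.log (T m) := by linarith
  have hL0 : 0 < Real.log (N m) := by linarith
  have hV0 : 0 < (V m : ℝ) := by
    refine (Nat.cast_nonneg _).lt_of_ne fun h0 => ?_
    have : 0 < (1 + ε) * Real.log (T m) := by positivity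
    rw [← h0, mul_zero, zero_mul, zero_mul] at h2
    linarith
  have h3 : V m * K * Real.log (N m) * (1 + largeDev r * μ₀) ≤ Real.log (T m) := by
    have hp : 0 ≤ (N m : ℝ) ^ ζ / Real.log (N m) := by positivity
    rw [Real.norm_of_nonneg hV0.le, Real.norm_of_nonneg hp] at h1
    calc V m * K * Real.log (N m) * (1 + largeDev r * μ₀)
        ≤ θ * ((N m : ℝ) ^ ζ / Real.log (N m)) * K * Real.log (N m) * (1 + largeDev r * μ₀) := by
          gcongr
      _ = (N m : ℝ) ^ ζ / 2 := by
          rw [hθ]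
          have : 1 + largeDev r * μ₀ ≠ 0 := by positivity
          field_simp
      _ ≤ _ := a3
  have hX : 0 ≤ V m * K * Real.log (N m) := by positivity
  have hY : 0 < largeDev r * μ₀ := by positivity
  refine ⟨hV0, ?_, ?_⟩
  · nlinarith
  · have h4 : K * Real.log (N m) * (V m * largeDev r * μ₀) ≤ hmin m * (V m * largeDev r * μ₀) := by
      calc K * Real.log (N m) * (V m * largeDev r * μ₀)
          ≤ V m * K * Real.log (N m) * (1 + largeDev r * μ₀) := by linarith
        _ ≤ Real.log (T m) := h3
        _ ≤ (1 + ε) * Real.log (T m) := by nlinarith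
        _ = _ := by rw [← h2]; ring
    exact le_of_mul_le_mul_right h4 (by positivity)

-- Each of the V changing sequences scores nearly h_i μ₀ I_r, for a total of nearly (1 + ε) log T.
-- The surplus ε log T covers the threshold, the fluctuation of the other sequences and the losses
-- of order η.
set_option maxHeartbeats 1000000 in
theorem eventually_typeII_le_of_sparse {ζ : ℝ} {N T : ℕ → ℕ} (hζ0 : 0 < ζ) (hζ1 : ζ ≤ 1)
    (hN : Tendsto N atTop atTop) (hT : Tendsto T atTop atTop)
    (hNT : (fun m => Real.log (T m)) ~[atTop] fun m => (N m : ℝ) ^ ζ)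
    (ν : ∀ m, Measure (Randomizers (N m)))
    (hν : ∀ m w, (ν m).map (fun ξ n => ξ n w) =
      Measure.pi fun _ : Fin (N m) => (volume : Measure I))
    {μ₀ Δ r : ℝ} (hμ₀ : 0 < μ₀) (hΔ : 0 < Δ) (hr1 : 1 < r) (hrΔ : r < Real.exp Δ)
    {h d : ℕ → ℕ} (hh : StrictMonoOn h (Set.Ici 1)) (hd1 : ∀ i, 1 ≤ i → 1 ≤ d i)
    (hdh : ∀ i, 1 ≤ i → d i ≤ h i)
    (hratio : Tendsto (fun i => (h (i + 1) : ℝ) / (h i : ℝ)) atTop (𝓝 1))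
    (hdo : (fun i => (d i : ℝ)) =o[atTop] fun i => (h i : ℝ))
    {c : ℕ → ℝ} (hco : c =o[atTop] fun t : ℕ => Real.log t)
    {lam1 : ℝ} (hlam1 : 0 < lam1) {V : ℕ → ℕ} {hmin : ℕ → ℝ} {ε : ℝ} (hε : 0 < ε)
    (hV : (fun m => (V m : ℝ)) =o[atTop] (fun m => (N m : ℝ) ^ ζ / Real.log (N m)))
    (hhV : ∀ᶠ m in atTop, hmin m * V m * largeDev r * μ₀ = (1 + ε) * Real.log (T m))
    {e : ℝ} (he : 0 < e) :
    ∀ᶠ m in atTop, ∀ μ ∈ Lam₁ (N m) (T m) μ₀ Δ (V m) (hmin m), dataLaw (N m) (T m) (ν m) μ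
      {ω | estimatedChangePoints h d lam1 (lambda2 (T m)) (c (T m)) ω = ∅} ≤
        ENNReal.ofReal e := by
  have hI := largeDev_pos hr1
  -- Makes (1 - 3η)(1 + ε) = 1 + 5ε/8, where (1 - η)³ ≥ 1 - 3η bounds the combined loss from scale,
  -- score and proportion.
  obtain ⟨η, hη0, hη1, hηε⟩ : ∃ η : ℝ, 0 < η ∧ η < 1 / 8 ∧ η * (1 + ε) = ε / 8 :=
    ⟨ε / (8 * (1 + ε)), by positivity, by rw [div_lt_iff₀ (by positivity)]; linarith,
      by field_simp⟩
  obtain ⟨r', hr', hscale⟩ := exists_detecting_scale hh ((hd1 1 le_rfl).trans (hdh 1 le_rfl))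
    hratio hdo hr1 hrΔ hη0 (by linarith)
  obtain ⟨κ, hκ, hP⟩ := exists_pValueLaw_half_Ioi_le hr1 hr'
  have hlN := tendsto_log_natCast hN
  have hlT := tendsto_log_natCast hT
  have hVT := fun (K : ℝ) (hK : 0 < K) =>
    eventually_le_minDistance hζ0 hζ1 hN hT hNT hμ₀ hr1 hε hV hhV hK
  have hmin_top : Tendsto hmin atTop atTop := by
    refine tendsto_atTop_mono' _ ?_ hlN
    filter_upwards [hVT 1 one_pos] with m hm
    simpa using hm.2.2
  have hsmall : Tendsto (fun m => Real.exp (-(κ * μ₀ * (1 - η) * hmin m)) / η +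
      Real.exp (-(ε / 16 * Real.log (T m)))) atTop (𝓝 (0 / η + 0)) := by
    refine ((Real.tendsto_exp_neg_atTop_nhds_zero.comp (hmin_top.const_mul_atTop ?_)).div_const _).add
      (Real.tendsto_exp_neg_atTop_nhds_zero.comp (hlT.const_mul_atTop (by positivity)))
    have : 0 < 1 - η := by linarith
    positivity
  rw [zero_div, zero_add] at hsmall
  obtain ⟨X₀, hX₀⟩ := eventually_atTop.1 (eventually_log_two_add_le hη0)
  have hcT := hT.eventually (hco.bound (show 0 < ε / 8 by positivity))
  filter_upwards [eventually_smallWeights hζ0 hζ1 hN hT hNT hlam1,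
    eventually_regime hζ0 hζ1 hN hT hNT (max 1 (-Real.log lam1)),
    eventually_nullExcess_le hζ0 hζ1 hN hT hNT hlam1 (show 0 < ε / 16 by positivity),
    hVT (max (max (16 / ε) 1) (8 / (η * μ₀ * largeDev r))) (by positivity), hhV,
    hmin_top.eventually hscale, hmin_top.eventually_ge_atTop (max X₀ 1 / ((1 - η) * (μ₀ * largeDev r))),
    hsmall.eventually (ge_mem_nhds he), hcT]
    with m hS ⟨a1, a2, a3, a4, a5, a6⟩ hexc ⟨v1, v2, v3⟩ hV' ⟨i, hi, hi1, hi2, hi3⟩ hmX hsm hcm μ hμ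
  have hη2 : 0 < 1 - η := by linarith
  have hL1 : 1 ≤ Real.log (N m) := (le_max_left _ _).trans a1
  have hT0 : 0 < Real.log (T m) := by
    have := mul_le_mul_of_nonneg_right (le_max_left 1 (-Real.log lam1)) (by linarith : 0 ≤ Real.log (N m))
    linarith
  obtain ⟨Q, a, b, hQ, hab, hQab, hle⟩ := typeII_error_le lam1 (lambda2 (T m)) (ν m) (hν m) hh hd1
    hdh hμ₀ hΔ hi hi1 hi3 μ hμ (c (T m))
  refine hle.trans ?_
  set x := h i * μ₀ * largeDev r with hx
  have hxm : (1 - η) * (μ₀ * largeDev r) * hmin m ≤ x := by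
    calc (1 - η) * (μ₀ * largeDev r) * hmin m = (1 - η) * hmin m * μ₀ * largeDev r := by ring
      _ ≤ x := by rw [hx]; gcongr
  have hxX : max X₀ 1 ≤ x := by
    rw [div_le_iff₀ (by positivity)] at hmX
    linarith
  have hx1 : 1 ≤ x := (le_max_right _ _).trans hxX
  have hmpos : 0 < hmin m := by
    have : 0 < max (max (16 / ε) 1) (8 / (η * μ₀ * largeDev r)) * Real.log (N m) := by
      have : 0 < Real.log (N m) := by linarith
      positivity
    linarith
  have hVx : (1 - η) * ((1 + ε) * Real.log (T m)) ≤ V m * x := by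
    calc (1 - η) * ((1 + ε) * Real.log (T m)) = V m * ((1 - η) * (μ₀ * largeDev r) * hmin m) := by
          rw [← hV']; ring
      _ ≤ _ := by gcongr
  have hVs : V m ≤ ε / 16 * Real.log (T m) := by
    have h1 : V m * (16 / ε) ≤ Real.log (T m) := by
      refine le_trans ?_ v2
      calc (V m : ℝ) * (16 / ε) = V m * (16 / ε) * 1 := by ring
        _ ≤ _ := by
          gcongr
          exact (le_max_left _ _).trans (le_max_left _ _)
    rw [← mul_div_assoc, div_le_iff₀ hε] at h1
    linarith
  have hαlog : -Real.log (lam1 * Real.log (N m) / N m) ≤ 2 * Real.log (N m) := by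
    have hN0 : (0 : ℝ) < N m := by
      rcases (Nat.cast_nonneg (α := ℝ) (N m)).eq_or_lt with h0 | h0
      · rw [← h0, Real.log_zero] at hL1; linarith
      · exact h0
    rw [Real.log_div (by positivity) hN0.ne', Real.log_mul hlam1.ne' (by positivity)]
    have h1 : 0 ≤ Real.log (Real.log (N m)) := Real.log_nonneg hL1
    have h2 : -Real.log lam1 ≤ Real.log (N m) := (le_max_right _ _).trans a1
    linarith
  have hLx : 2 * Real.log (N m) ≤ η / 2 * x := by
    have h1 : 8 / (η * μ₀ * largeDev r) * Real.log (N m) ≤ hmin m :=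
      le_trans (by gcongr; exact le_max_right _ _) v3
    have h2 : 8 * Real.log (N m) ≤ η * (μ₀ * largeDev r * hmin m) := by
      rw [div_mul_eq_mul_div, div_le_iff₀ (by positivity)] at h1
      linarith
    have h3 : μ₀ * largeDev r * hmin m ≤ 2 * x := by
      have h4 : 1 / 2 * (μ₀ * largeDev r * hmin m) ≤ (1 - η) * (μ₀ * largeDev r * hmin m) :=
        mul_le_mul_of_nonneg_right (by linarith) (by positivity)
      linarith
    have h4 := mul_le_mul_of_nonneg_left h3 hη0.le
    linarith
  have hηx : -Real.log (lam1 * Real.log (N m) / N m) + 1 + 2 * Real.log (2 + x) ≤ η * x := by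
    have := hX₀ x ((le_max_left _ _).trans hxX)
    linarith
  have hcm' : c (T m) ≤ ε / 8 * Real.log (T m) := by
    simp only [Real.norm_eq_abs, abs_of_pos hT0] at hcm
    exact (le_abs_self _).trans hcm
  have hQne : Q.Nonempty := by
    rw [← Finset.card_pos, hQ]
    exact_mod_cast v1
  refine (pi_sum_score_le_of_large hS Q hQne a b hab (p₀ := 2 * Real.exp (-x))
    (ℓ₀ := (1 - η) * x) (q := Real.exp (-(κ * μ₀ * (1 - η) * hmin m))) (η := η)
    (x₀ := ε / 8 * Real.log (T m)) hη0 (by positivity) ?_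
    (fun p hp hpx => le_score_of_le_small hS hx1 hηx hp hpx) ?_).trans ?_
  · intro n hn
    obtain ⟨h1, h2⟩ := hQab n hn
    refine (measure_mono (Set.Ioi_subset_Ioi ?_)).trans ((hP _ _ h2).trans
      (ENNReal.ofReal_le_ofReal ?_))
    · rw [hx]
      gcongr
    · rw [Real.exp_le_exp, neg_le_neg_iff]
      calc κ * μ₀ * (1 - η) * hmin m = κ * ((1 - η) * hmin m * μ₀) := by ring
        _ ≤ κ * (h i * μ₀) := by gcongr
        _ ≤ _ := by gcongr
  · rw [hQ]
    have h1 : (1 - 3 * η) * ((1 + ε) * Real.log (T m)) ≤ (1 - η) * V m * ((1 - η) * x) := by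
      calc (1 - 3 * η) * ((1 + ε) * Real.log (T m))
          ≤ (1 - η) ^ 3 * ((1 + ε) * Real.log (T m)) := by
            refine mul_le_mul_of_nonneg_right ?_ (by positivity)
            nlinarith [mul_pos hη0 hη0]
        _ = (1 - η) ^ 2 * ((1 - η) * ((1 + ε) * Real.log (T m))) := by ring
        _ ≤ (1 - η) ^ 2 * (V m * x) := by gcongr
        _ = _ := by ring
    have h2 : (1 - 3 * η) * ((1 + ε) * Real.log (T m)) = (1 + 5 / 8 * ε) * Real.log (T m) := by
      linear_combination (-3 * Real.log (T m)) * hηε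
    have h3 : η * V m ≤ V m := by nlinarith
    have h4 : 0 < ε * Real.log (T m) := by positivity
    linarith
  · rw [← ENNReal.ofReal_add (by positivity) (Real.exp_pos _).le]
    refine ENNReal.ofReal_le_ofReal (le_trans ?_ hsm)
    gcongr
    linarith

/-- No single score is decisive. The gains of V ≈ N^(1-β) sequences, each of order N^(ζ-1+β+η/2),
add up to a power of N above log T. -/
theorem eventually_typeII_le_of_dense {ζ : ℝ} {N T : ℕ → ℕ} (hζ0 : 0 < ζ) (hζ1 : ζ ≤ 1)
    (hN : Tendsto N atTop atTop) (hT : Tendsto T atTop atTop)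
    (hNT : (fun m => Real.log (T m)) ~[atTop] fun m => (N m : ℝ) ^ ζ)
    (ν : ∀ m, Measure (Randomizers (N m)))
    (hν : ∀ m w, (ν m).map (fun ξ n => ξ n w) =
      Measure.pi fun _ : Fin (N m) => (volume : Measure I))
    {μ₀ Δ r : ℝ} (hμ₀ : 0 < μ₀) (hΔ : 0 < Δ) (hr1 : 1 < r) (hrΔ : r < Real.exp Δ)
    {h d : ℕ → ℕ} (hh : StrictMonoOn h (Set.Ici 1)) (hd1 : ∀ i, 1 ≤ i → 1 ≤ d i)
    (hdh : ∀ i, 1 ≤ i → d i ≤ h i)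
    (hratio : Tendsto (fun i => (h (i + 1) : ℝ) / (h i : ℝ)) atTop (𝓝 1))
    (hdo : (fun i => (d i : ℝ)) =o[atTop] fun i => (h i : ℝ))
    {c : ℕ → ℝ} (hco : c =o[atTop] fun t : ℕ => Real.log t)
    {lam1 : ℝ} (hlam1 : 0 < lam1) {V : ℕ → ℕ} {hmin : ℕ → ℝ} {ε : ℝ} (hε : 0 < ε)
    {β : ℝ} (h0 : (1 - ζ) / 2 < β) (h1 : β < 1 - ζ)
    (hV : (fun m => (V m : ℝ)) ~[atTop] fun m => (N m : ℝ) ^ (1 - β))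
    (hhV : ∀ᶠ m in atTop, hmin m * μ₀ = (1 + ε) * rho r β ζ * Real.log (N m))
    {e : ℝ} (he : 0 < e) :
    ∀ᶠ m in atTop, ∀ μ ∈ Lam₁ (N m) (T m) μ₀ Δ (V m) (hmin m), dataLaw (N m) (T m) (ν m) μ
      {ω | estimatedChangePoints h d lam1 (lambda2 (T m)) (c (T m)) ω = ∅} ≤
        ENNReal.ofReal e := by
  have hρ := rho_pos hr1 h0 h1
  -- Makes (1 - δ)(1 + ε) = 1 + ε/2, so the window means stay above the boundary after the scale is
  -- rounded down.
  obtain ⟨δ, hδ0, hδ1, hδε⟩ : ∃ δ : ℝ, 0 < δ ∧ δ < 1 ∧ δ * (1 + ε) = ε / 2 :=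
    ⟨ε / (2 * (1 + ε)), by positivity, by rw [div_lt_one (by positivity)]; linarith,
      by field_simp⟩
  obtain ⟨r', hr', hscale⟩ := exists_detecting_scale hh ((hd1 1 le_rfl).trans (hdh 1 le_rfl))
    hratio hdo hr1 hrΔ hδ0 hδ1
  obtain ⟨η, hη, hlikely⟩ := eventually_likelySmall (Λ := (1 + ε / 2) * rho r β ζ) hr1 hr' h0 h1
    (by nlinarith)
  have hlN := tendsto_log_natCast hN
  have hlT := tendsto_log_natCast hT
  have hmin_top : Tendsto hmin atTop atTop := by
    have h2 : Tendsto (fun m => (1 + ε) * rho r β ζ / μ₀ * Real.log (N m)) atTop atTop :=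
      hlN.const_mul_atTop (by positivity)
    refine h2.congr' ?_
    filter_upwards [hhV] with m hm
    rw [div_mul_eq_mul_div, ← hm, mul_div_cancel_right₀ _ hμ₀.ne']
  have hsmall := Real.tendsto_exp_neg_atTop_nhds_zero.comp (hlT.const_mul_atTop
    (show (0 : ℝ) < 1 / 2 by norm_num))
  have hbig : ∀ᶠ L : ℝ in atTop, 68 ≤ Real.exp (η / 2 * L) :=
    (Real.tendsto_exp_atTop.comp (tendsto_id.const_mul_atTop (by positivity))).eventually_ge_atTop _
  have hcT := hT.eventually (hco.bound one_pos)
  filter_upwards [eventually_smallWeights hζ0 hζ1 hN hT hNT hlam1,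
    eventually_regime hζ0 hζ1 hN hT hNT (max 1 lam1),
    eventually_nullExcess_le hζ0 hζ1 hN hT hNT hlam1 one_pos,
    eventually_weight_bounds hζ0 hζ1 hN hT hNT (half_pos hη), hhV,
    hV.isLittleO.bound (show (0 : ℝ) < 1 / 2 by norm_num),
    hmin_top.eventually hscale, hlN.eventually hlikely, hlN.eventually hbig,
    hsmall.eventually (ge_mem_nhds he), hcT]
    with m hS ⟨a1, a2, a3, a4, a5, a6⟩ hexc ⟨w1, w2⟩ hV' hVN ⟨i, hi, hi1, hi2, hi3⟩ hlik hbg hsm hcm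
      μ hμ
  have hL1 : 1 ≤ Real.log (N m) := (le_max_left _ _).trans a1
  have hlam : lam1 * Real.log (N m) ≤ Real.log (T m) :=
    le_trans (by gcongr; exact le_max_right _ _) a5
  have hT0 : 0 < Real.log (T m) := by
    have : 0 < lam1 * Real.log (N m) := by positivity
    linarith
  have hN0 : (0 : ℝ) < N m := by
    rcases (Nat.cast_nonneg (α := ℝ) (N m)).eq_or_lt with h0 | h0
    · rw [← h0, Real.log_zero] at hL1; linarith
    · exact h0
  obtain ⟨Q, a, b, hQ, hab, hQab, hle⟩ := typeII_error_le lam1 (lambda2 (T m)) (ν m) (hν m) hh hd1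
    hdh hμ₀ hΔ hi hi1 hi3 μ hμ (c (T m))
  refine hle.trans ?_
  set L := Real.log (N m) with hL
  set t := Real.log (T m) with ht
  set α := lam1 * L / N m with hα
  set w := lambda2 (T m) / √(N m * L) with hw
  have hpow : ∀ x : ℝ, (N m : ℝ) ^ x = Real.exp (x * L) := fun x => by
    rw [Real.rpow_def_of_pos hN0, mul_comm]
  rw [hpow] at a3 a4
  simp only [Pi.sub_apply, hpow, Real.norm_eq_abs, Real.abs_exp] at hVN
  have hVN' := abs_le.1 hVN
  have hVlow : Real.exp ((1 - β) * L) / 2 ≤ V m := by linarith [hVN'.1]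
  have hVup : (V m : ℝ) ≤ 2 * Real.exp ((1 - β) * L) := by
    linarith [hVN'.2, Real.exp_pos ((1 - β) * L)]
  have hVleN : (V m : ℝ) ≤ N m := by
    have := Finset.card_le_univ Q
    rw [hQ, Fintype.card_fin] at this
    exact_mod_cast this
  have hmean : (1 + ε / 2) * rho r β ζ * L ≤ h i * μ₀ := by
    calc (1 + ε / 2) * rho r β ζ * L = (1 - δ) * (hmin m * μ₀) := by
          rw [hV']
          linear_combination (rho r β ζ * L) * hδε
      _ = (1 - δ) * hmin m * μ₀ := by ring
      _ ≤ _ := by gcongr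
  refine (pi_sum_score_le_of_gain hS Q a b hab
    (Real.exp ((ζ - 1 + β + η / 2) * L) / 2 - α - 4 * w) ?_ _).trans ?_
  · intro n hn
    obtain ⟨h2, h3⟩ := hQab n hn
    refine LikelySmall.lintegral_inv_likRatio_le (η := η / 2) (γ := (1 - ζ) / 2) ?_
      (by positivity) (by linarith) hS.pos₁.le hS.le₁ w1 hS.le₂
    have := hlik (a n) (b n) (hmean.trans h2) h3
    rwa [show ζ - 1 + β + η / 2 + η / 2 = ζ - 1 + β + η by ring]
  · refine ENNReal.ofReal_le_ofReal (le_trans (Real.exp_le_exp.2 ?_) hsm)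
    rw [hQ]
    have e1 : V m * α ≤ t := by
      calc V m * α ≤ N m * α := by have := hS.pos₁.le; gcongr
        _ = lam1 * L := by rw [hα]; field_simp
        _ ≤ t := hlam
    -- The exponent 1 - β - (1 - ζ)/2 is at most ζ precisely because β ≥ (1 - ζ)/2.
    have e2 : V m * w ≤ 2 * Real.exp (ζ * L) := by
      calc V m * w ≤ 2 * Real.exp ((1 - β) * L) * Real.exp (-((1 - ζ) / 2) * L) := by
            have := hS.pos₂.le
            gcongr
        _ = 2 * Real.exp ((1 - β - (1 - ζ) / 2) * L) := by
            rw [mul_assoc, ← Real.exp_add]; congr 2; ring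
        _ ≤ _ := by
            gcongr
            linarith
    -- With t = log T ≤ 2N^ζ, the terms to beat are at most 4t + 8N^ζ ≤ 16N^ζ; the remaining N^ζ is
    -- at least t/2, the decay used in `hsmall`.
    have e3 : 17 * Real.exp (ζ * L) ≤ V m * (Real.exp ((ζ - 1 + β + η / 2) * L) / 2) := by
      calc 17 * Real.exp (ζ * L) = 68 * Real.exp (ζ * L) / 4 := by ring
        _ ≤ Real.exp (η / 2 * L) * Real.exp (ζ * L) / 4 := by gcongr
        _ = Real.exp ((1 - β) * L) / 2 * (Real.exp ((ζ - 1 + β + η / 2) * L) / 2) := by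
            rw [div_mul_div_comm, ← Real.exp_add, ← Real.exp_add]
            norm_num
            ring
        _ ≤ _ := by gcongr
    have e4 : c (T m) ≤ t := by
      simp only [Real.norm_eq_abs] at hcm
      rw [abs_of_pos hT0, one_mul] at hcm
      exact (le_abs_self _).trans hcm
    linarith

end SparsityLikelihood

/-! ### Combination of the two errors. -/

theorem theorem5
    -- the asymptotic regime
    (ζ : ℝ) (hζ0 : 0 < ζ) (hζ1 : ζ ≤ 1)
    (N T : ℕ → ℕ) (hN : Tendsto N atTop atTop) (hT : Tendsto T atTop atTop)
    (hNT : (fun m => Real.log (T m)) ~[atTop] fun m => (N m : ℝ) ^ ζ)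
    -- the randomizers: uniform and independent over the sequences, in every window
    (ν : ∀ m, Measure (Randomizers (N m)))
    (hν : ∀ m w, (ν m).map (fun ξ n => ξ n w) = Measure.pi fun _ : Fin (N m) => (volume : Measure I))
    -- the lower bound on the means and the size of the changes
    (μ₀ : ℝ) (hμ₀ : 0 < μ₀) (Δ : ℝ) (hΔ : 0 < Δ)
    (r : ℝ) (hr1 : 1 < r) (hrΔ : r < Real.exp Δ)
    -- the window lengths and spacings
    (h d : ℕ → ℕ) (hh : StrictMonoOn h (Set.Ici 1)) (hd : StrictMonoOn d (Set.Ici 1))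
    (hd1 : 1 ≤ d 1) (hdh : ∀ i, 1 ≤ i → d i ≤ h i)
    (hratio : Tendsto (fun i => (h (i + 1) : ℝ) / (h i : ℝ)) atTop (𝓝 1))
    (hdo : (fun i => (d i : ℝ)) =o[atTop] fun i => (h i : ℝ))
    (hsum : logWindowSum h d =o[atTop] fun t : ℕ => Real.log t)
    -- the critical values and the score parameter
    (c : ℕ → ℝ) (hco : c =o[atTop] fun t : ℕ => Real.log t)
    (hc : Tendsto (fun t => c t - logWindowSum h d t) atTop atTop)
    (lam1 : ℝ) (hlam1 : 0 < lam1)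
    -- the sparsity and the minimal distance between change-points
    (V : ℕ → ℕ) (hmin : ℕ → ℝ) (ε : ℝ) (hε : 0 < ε)
    (hcond :
      ((fun m => (V m : ℝ)) =o[atTop] (fun m => (N m : ℝ) ^ ζ / Real.log (N m)) ∧
        ∀ᶠ m in atTop, hmin m * V m * largeDev r * μ₀ = (1 + ε) * Real.log (T m)) ∨
      (∃ β : ℝ, (1 - ζ) / 2 < β ∧ β < 1 - ζ ∧
        (fun m => (V m : ℝ)) ~[atTop] (fun m => (N m : ℝ) ^ (1 - β)) ∧
        ∀ᶠ m in atTop, hmin m * μ₀ = (1 + ε) * rho r β ζ * Real.log (N m))) :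
    Tendsto
      (fun m => totalError h d lam1 (lambda2 (T m)) (c (T m)) (N m) (T m) (ν m) μ₀ Δ (V m) (hmin m))
      atTop (𝓝 0) := by
  have hd' : ∀ i, 1 ≤ i → 1 ≤ d i := fun i hi => hd1.trans
    (hd.monotoneOn (Set.mem_Ici.2 le_rfl) (Set.mem_Ici.2 hi) hi)
  have hII : ∀ e : ℝ, 0 < e → ∀ᶠ m in atTop, ∀ μ ∈ Lam₁ (N m) (T m) μ₀ Δ (V m) (hmin m),
      dataLaw (N m) (T m) (ν m) μ
        {ω | estimatedChangePoints h d lam1 (lambda2 (T m)) (c (T m)) ω = ∅} ≤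
          ENNReal.ofReal e := by
    intro e he
    rcases hcond with ⟨hV, hhV⟩ | ⟨β, h0, h1, hV, hhV⟩
    · exact eventually_typeII_le_of_sparse hζ0 hζ1 hN hT hNT ν hν hμ₀ hΔ hr1 hrΔ hh hd' hdh hratio
        hdo hco hlam1 hε hV hhV he
    · exact eventually_typeII_le_of_dense hζ0 hζ1 hN hT hNT ν hν hμ₀ hΔ hr1 hrΔ hh hd' hdh hratio
        hdo hco hlam1 hε h0 h1 hV hhV he
  rw [ENNReal.tendsto_nhds_zero]
  intro e he
  -- The tolerance may be infinite, so a finite one is chosen below it and halved between the two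
  -- errors.
  obtain ⟨x, hx0, hxe⟩ : ∃ x : ℝ, 0 < x ∧ ENNReal.ofReal x + ENNReal.ofReal x ≤ e := by
    obtain ⟨y, hy0, hye⟩ := ENNReal.lt_iff_exists_nnreal_btwn.1 he
    refine ⟨y / 2, by simpa using hy0, ?_⟩
    rw [← ENNReal.ofReal_add (by positivity) (by positivity), add_halves, ENNReal.ofReal_coe_nnreal]
    exact hye.le
  filter_upwards [eventually_typeI_le hζ0 hζ1 hN hT hNT ν hν μ₀ hd' hdh hc hlam1 hx0, hII x hx0]
    with m hm1 hm2
  exact (add_le_add (iSup₂_le hm1) (iSup₂_le hm2)).trans hxe
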